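/- Let $m\ge 2$ and $n\ge 1$ be integers and let $\mathcal S_m=\{(x,y)\in\mathbb R^2: 0\le y\le m\}$. Take indeterminates $x_{ab}$ ($0\le a<2n$, $0<b<m$), let $K=\mathbb Q(x_{ab})$ be the field of rational functions in them, and give each lattice point of $\mathcal S_m$ the weight $w_{a,b}\in K$ determined by $w_{a+2n,b}=w_{a,b}$, by $w_{a,b}=x_{ab}$ for $0\le a<2n$, $0<b<m$, and by $w_{a,0}=w_{a,m}=1$. **Tilings.** For integers $i,j,\ell$ let $\mathcal A_m(i,j,\ell)$ be the union of all unit squares with lattice vertices contained in $\mathcal S_m\cap\{|x-i|+|y-j|\le \ell+1\}$. The weight of a domino tiling $T$ of $\mathcal A_m(i,j,\ell)$ is the product of $w_{v}^{\varepsilon(v)}$ over the lattice points $v$ in the interior of $\mathcal A_m(i,j,\ell)$, where $\varepsilon(v)=1,0,-1$ if $v$ lies on $4,3,2$ dominoes of $T$, respectively. Let $Z_m(i,j,\ell)\in K$ be the sum of the weights of all domino tilings of $\mathcal A_m(i,j,\ell)$. **Network.** Call the unit square with lower left corner $(a,b)$ black if $a+b$ is odd. Let $N=N_{n,m}$ be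 the weighted directed graph in the cylinder $\mathcal S_m/\mathbb Z(2n,0)$ whose vertices are the black squares of $\mathcal S_m$ (modulo the shift), and whose edges are the following ones, ending at the square with lower left corner $(a,b)$, whenever both ends lie in $\mathcal S_m$: from $(a-1,b-1)$, of weight $\frac{w_{a+1,b+1}}{w_{a,b}}$; from $(a-2,b)$, of weight $\frac{w_{a+1,b+1}w_{a+1,b}}{w_{a,b}w_{a,b+1}}$; from $(a-1,b+1)$, of weight $\frac{w_{a+1,b}}{w_{a,b+1}}$. An $r$-cycle in $N$ is a set of $r$ pairwise vertex-disjoint simple directed cycles of $N$ (loops allowed); its weight is the product of the weights of all its edges, and its winding number is the sum of the winding numbers of its cycles around the cylinder. Let $H_r$ be the sum of the weights of all $r$-cycles, let $d$ be the maximal winding number of an $r$-cycle over all $r\ge0$, and put $$Q(t)=\sum_{r=0}^{d}(-1)^rH_r\,t^{d-r}\in K[t].$$ If $\gamma_1,\gamma_2,\dots$ are the roots of $Q$, with multiplicity, in an algebraic closure $\overline K$, put for $r\ge 0$ $$Q^{e_r}(t)=\prod_{i_1<\dots<i_r}\bigl(t-\gamma_{i_1}\cdots\gamma_{i_r}\bigr)$$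 (so $Q^{e_0}(t)=t-1$). **Theorem.** Let $(i,j)$ be a lattice point with $0\le j\le m$, let $\ell_0$ be an integer, and let $$f(\ell)=Z_m(i+\ell n,\;j,\;\ell n+\ell_0)\qquad(\ell\in\mathbb N).$$ If $i+j-\ell_0$ is even, then $Q^{e_{m-j}}$ has coefficients in $K$, and $f$ satisfies, for all but finitely many $\ell$, the linear recurrence with characteristic polynomial $Q^{e_{m-j}}$. If $i+j-\ell_0$ is odd, the same holds with $Q^{e_{j}}$ in place of $Q^{e_{m-j}}$. Here a sequence $f$ satisfies at $\ell$ the linear recurrence with characteristic polynomial $t^D+c_{D-1}t^{D-1}+\dots+c_0$ if $f(\ell+D)+c_{D-1}f(\ell+D-1)+\dots+c_0f(\ell)=0$. -/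

import Mathlib

namespace AztecStrip

noncomputable section

/-- Indices of the `2n(m-1)` indeterminates `x_{ij}`: `i` modulo `2n`, and `0 < j < m`. -/
abbrev Idx (n m : ℕ) : Type := ZMod (2 * n) × {j : ℤ // 0 < j ∧ j < (m : ℤ)}

/-- The field of rational functions in the indeterminates `x_{ij}`. -/
abbrev K (n m : ℕ) : Type := FractionRing (MvPolynomial (Idx n m) ℚ)

/-- The weight `w_{x,y}` of a lattice point, `2n`-periodic in `x`: the indeterminate `x_{x mod 2n, y}`
in the interior of the strip `0 ≤ y ≤ m`, and `1` on the boundary lines `y = 0` and `y = m`. -/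
def w (n m : ℕ) (x : ZMod (2 * n)) (y : ℤ) : K n m :=
  if h : 0 < y ∧ y < (m : ℤ) then
    algebraMap (MvPolynomial (Idx n m) ℚ) (K n m) (MvPolynomial.X (x, ⟨y, h⟩))
  else 1

/-! ### Truncated Aztec diamonds, domino tilings and their weights

A unit square with lattice vertices is recorded by its lower left corner `(a, b)`; its centre is
`(a + 1/2, b + 1/2)`. -/

end

/-- The truncated Aztec diamond of centre `(i, j)` and order `ℓ`: the unit squares inside the strip
`0 ≤ y ≤ m` which are contained in the region `|x - i| + |y - j| ≤ ℓ + 1`.  As that region is convex,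
the containment is tested at the four corners of the square.  (The range of `a` in the box is no
restriction: it follows from the condition on the corners.) -/
noncomputable def region (m : ℕ) (i j ℓ : ℤ) : Finset (ℤ × ℤ) :=
  (Finset.Icc (i - ℓ - 1) (i + ℓ + 1) ×ˢ Finset.Ico 0 (m : ℤ)).filter fun s : ℤ × ℤ =>
    |s.1 - i| + |s.2 - j| ≤ ℓ + 1 ∧ |s.1 + 1 - i| + |s.2 - j| ≤ ℓ + 1 ∧
      |s.1 - i| + |s.2 + 1 - j| ≤ ℓ + 1 ∧ |s.1 + 1 - i| + |s.2 + 1 - j| ≤ ℓ + 1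

/-- The dominoes inside a set `R` of squares: pairs of squares of `R` that share a side. -/
def dominoes (R : Finset (ℤ × ℤ)) : Finset (Finset (ℤ × ℤ)) :=
  (R.powersetCard 2).filter fun D =>
    ∃ s ∈ R, D = {s, (s.1 + 1, s.2)} ∨ D = {s, (s.1, s.2 + 1)}

/-- The domino tilings of a set `R` of squares: the sets of dominoes inside `R` such that every
square of `R` belongs to exactly one of them. -/
def tilings (R : Finset (ℤ × ℤ)) : Finset (Finset (Finset (ℤ × ℤ))) :=
  (dominoes R).powerset.filter fun T => ∀ s ∈ R, (T.filter fun D => s ∈ D).card = 1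

/-- The four unit squares which have the lattice point `v` as a vertex. -/
def around (v : ℤ × ℤ) : Finset (ℤ × ℤ) :=
  {v, (v.1 - 1, v.2), (v.1, v.2 - 1), (v.1 - 1, v.2 - 1)}

/-- The lattice points in the interior of the union of the squares of `R`: those for which all four
surrounding squares (one of which is recorded by the point itself) belong to `R`. -/
def interiorPoints (R : Finset (ℤ × ℤ)) : Finset (ℤ × ℤ) :=
  R.filter fun v => around v ⊆ R

/-- The number of dominoes of `T` which contain the lattice point `v` (on their boundary). -/
def adjacentDominoes (T : Finset (Finset (ℤ × ℤ))) (v : ℤ × ℤ) : ℕ :=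
  (T.filter fun D => (D ∩ around v).Nonempty).card

noncomputable section

open Polynomial
open scoped Classical

/-- The weight of a tiling `T` of `R`: the product of `w_v ^ ε` over the interior lattice points `v`,
where `ε = 1, 0, -1` if `v` is adjacent to `4, 3, 2` dominoes. -/
def tilingWeight (n m : ℕ) (R : Finset (ℤ × ℤ)) (T : Finset (Finset (ℤ × ℤ))) : K n m :=
  ∏ v ∈ interiorPoints R, w n m (v.1 : ZMod (2 * n)) v.2 ^ ((adjacentDominoes T v : ℤ) - 3)

/-- `Z_m(i, j, ℓ)`: the sum of the weights of all domino tilings of the truncated Aztec diamond. -/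
def Z (n m : ℕ) (i j ℓ : ℤ) : K n m :=
  ∑ T ∈ tilings (region m i j ℓ), tilingWeight n m (region m i j ℓ) T

/-! ### The cylindrical network -/

/-- The vertices of the network in the cylinder of circumference `2n`: the black squares (those with
`i + j` odd) of the strip, with `i` taken modulo `2n`. -/
abbrev V (n m : ℕ) : Type := {p : ZMod (2 * n) × Fin m // Odd (p.1.val + (p.2 : ℕ))}

/-- The edges of the network: from a black square to the black square one step to the right and one
step up, or two steps to the right, or one step to the right and one step down. -/
def Edge {n m : ℕ} (p q : V n m) : Prop :=
  (q.1.1 = p.1.1 + 1 ∧ (q.1.2 : ℕ) = p.1.2 + 1) ∨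
  (q.1.1 = p.1.1 + 2 ∧ (q.1.2 : ℕ) = p.1.2) ∨
  (q.1.1 = p.1.1 + 1 ∧ (q.1.2 : ℕ) + 1 = p.1.2)

/-- The weight of an edge from `p` to `q`, where `q` is the square with lower left corner `(i, j)`;
the three cases are those of `Edge`. -/
def edgeWeight {n m : ℕ} (p q : V n m) : K n m :=
  let i : ZMod (2 * n) := q.1.1
  let j : ℤ := ((q.1.2 : ℕ) : ℤ)
  if (q.1.2 : ℕ) = p.1.2 + 1 then
    w n m (i + 1) (j + 1) / w n m i j
  else if (q.1.2 : ℕ) = p.1.2 then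
    (w n m (i + 1) (j + 1) * w n m (i + 1) j) / (w n m i j * w n m i (j + 1))
  else
    w n m (i + 1) j / w n m i (j + 1)

/-- The horizontal displacement of an edge (lifted to the strip): `2` for the edges which stay in
their row, and `1` for the others. -/
def edgeShift {n m : ℕ} (p q : V n m) : ℕ :=
  if (q.1.2 : ℕ) = p.1.2 then 2 else 1

/-- A simple directed cycle is given by its nonempty vertex set `S` together with its successor map,
a permutation which permutes `S` in a single cycle, along edges of the network (and is the identity
outside of `S`).  Loops, `S = {v}`, are allowed. -/
def IsSimpleCycle {n m : ℕ} (C : Finset (V n m) × Equiv.Perm (V n m)) : Prop :=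
  C.1.Nonempty ∧ C.2.IsCycleOn (C.1 : Set (V n m)) ∧ (∀ v, v ∉ C.1 → C.2 v = v) ∧
    ∀ v ∈ C.1, Edge v (C.2 v)

/-- The weight of a simple cycle: the product of the weights of its edges. -/
def cycleWeight {n m : ℕ} (C : Finset (V n m) × Equiv.Perm (V n m)) : K n m :=
  ∏ v ∈ C.1, edgeWeight v (C.2 v)

/-- The winding number of a simple cycle: a lift of the cycle to the strip is a path from a vertex to
its translate by `(2nk, 0)`, where `k` is the winding number, so that the total horizontal
displacement equals `2nk`. -/
def cycleWind {n m : ℕ} (C : Finset (V n m) × Equiv.Perm (V n m)) : ℕ :=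
  (∑ v ∈ C.1, edgeShift v (C.2 v)) / (2 * n)

/-- The set of all simple cycles of the network. -/
def simpleCycles (n m : ℕ) [NeZero n] : Finset (Finset (V n m) × Equiv.Perm (V n m)) :=
  Finset.univ.filter IsSimpleCycle

/-- The set of all (unordered) `r`-cycles: sets of `r` pairwise vertex-disjoint simple cycles. -/
def rCycles (n m : ℕ) [NeZero n] (r : ℕ) :
    Finset (Finset (Finset (V n m) × Equiv.Perm (V n m))) :=
  ((simpleCycles n m).powersetCard r).filter fun A =>
    ∀ C ∈ A, ∀ D ∈ A, C ≠ D → Disjoint C.1 D.1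

/-- The sum of the weights of all `r`-cycles. -/
def H (n m : ℕ) [NeZero n] (r : ℕ) : K n m :=
  ∑ A ∈ rCycles n m r, ∏ C ∈ A, cycleWeight C

/-- The maximal winding number of an `r`-cycle, over all `r ≥ 0`.  (An `r`-cycle has
`r ≤ #simpleCycles`, and the winding number of an `r`-cycle is the sum of those of its cycles.) -/
def maxWind (n m : ℕ) [NeZero n] : ℕ :=
  (Finset.range ((simpleCycles n m).card + 1)).sup fun r =>
    (rCycles n m r).sup fun A => ∑ C ∈ A, cycleWind C

/-- The monic polynomial `Q = ∑_{r=0}^{d} (-1)^r H_r t^{d-r}` of the network. -/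
def Q (n m : ℕ) [NeZero n] : (K n m)[X] :=
  ∑ r ∈ Finset.range (maxWind n m + 1),
    C ((-1) ^ r * H n m r) * X ^ (maxWind n m - r)

/-! ### Linear recurrences -/

/-- For a polynomial `P` with roots `γ_1, …, γ_d` (with multiplicity) in an algebraic closure, the
polynomial `P^{e_r} = ∏_{i_1 < ⋯ < i_r} (t - γ_{i_1} ⋯ γ_{i_r})`. -/
def plethE {F : Type} [Field F] (P : F[X]) (r : ℕ) : (AlgebraicClosure F)[X] :=
  (((P.aroots (AlgebraicClosure F)).powersetCard r).map fun s => X - C s.prod).prod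

/-- The sequence `f` satisfies, for all but finitely many `ℓ`, the linear recurrence with
characteristic polynomial `P = t^D + c_{D-1} t^{D-1} + ⋯ + c_0`:
`f(ℓ + D) + c_{D-1} f(ℓ + D - 1) + ⋯ + c_0 f(ℓ) = 0`. -/
def SatisfiesRecurrence {F : Type} [Field F] (f : ℕ → F) (P : F[X]) : Prop :=
  P.Monic ∧ ∀ᶠ ℓ in Filter.atTop,
    ∑ k ∈ Finset.range (P.natDegree + 1), P.coeff k * f (ℓ + k) = 0

end

end AztecStrip

/-!
# Linear recurrences for the tilings of truncated Aztec diamonds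

The partition functions `Z` are matrix elements of a power of a transfer operator on a space of
particles, and `Q` is the characteristic polynomial of the one-particle operator.

**Tilings.** The weight of a tiling is a product of weights of its dominoes (`Z_eq_dimer`): the weight
`w_v` of an interior point is attributed once to the black square which has `v` as a right vertex, and
its inverse to each domino of which `v` is the midpoint of a long side.  Expand the partition function
along the domino which covers a square, going through the squares column by column.  The region which
is left over is described by the set `S` of the rows with a particle: the frontier squares which are
black and already covered, or white and not yet covered.  Passing one square replaces the partition
functions, as a linear form on the basis of `⋀^r K^m` indexed by the sets `S` with `r` elements, by its
composition with the exterior power of an elementary operator of `K^m` (`sweepForm_square`).  Here the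
exterior power causes no signs, since particles only move to neighbouring rows.  Passing `l` full
columns is therefore composition with the exterior power of the transpose of `colProd`, a product of
`l` tridiagonal matrices `colMat` (`sweepForm_columns`).  Only sets `S` whose size `r` is the number
of rows with a black right end contribute, because a region with a tiling has as many black as white
squares (`card_eq_of_dimer_remaining_ne_zero`); this number is `m - j` or `j`, according to parity.

**Recurrence.** The step from `ℓ` to `ℓ + 1` inserts `2n` columns, and leaves the left end of the region
as it is.  Covering the left end first yields coefficients which do not depend on `ℓ`
(`dimer_union_remaining_mem_span`), and the right ends agree up to a translation by a period
(`sweepForm_shift`).  Hence `f ℓ = φ (T ^ ℓ u)` for large `ℓ`, where `T` is the `r`-th exterior power of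
the monodromy, and the Cayley-Hamilton theorem gives the recurrence with the characteristic polynomial
of `T`.  By triangularization, this polynomial has the products of `r` of the eigenvalues of the
monodromy as its roots (`map_charpoly_exteriorPower_map`).

**Network.** It remains to see that `Q` is the characteristic polynomial of the monodromy
(`Q_eq_charpoly`).  Expanding the determinant of `1 - B`, for the weighted adjacency matrix `B` of the
network with the displacements recorded as powers of an indeterminate, gives the signed sum over the
sets of disjoint cycles (`det_one_sub_eq_sum_cycleFamilies`).  Every simple cycle of the network winds
around the cylinder once (`cycleWind_eq_one`): following the other particles along the cycle is a
monotone map of the rows of a column, and such a map of finite order is the identity.  On the other hand,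
splitting the horizontal edges into halves makes the matrix block cyclic with the blocks `colMat`, so
that the determinant is that of `1 - t ^ (2 * n) • colProd` (`det_one_sub_blockCyclic`).  As `colProd`
is invertible, the maximal winding number is `m`.
-/

namespace AztecStrip

open Polynomial Module Set.powersetCard

/-! ### Exterior powers -/

/-- Every endomorphism over an algebraically closed field is triangular in some basis. -/
theorem exists_basis_upperTriangular {F : Type*} [Field F] [IsAlgClosed F] (n : ℕ) :
    ∀ (W : Type _) [AddCommGroup W] [Module F W] [FiniteDimensional F W] (_ : finrank F W = n)
      (f : W →ₗ[F] W), ∃ b : Basis (Fin n) F W, ∀ i j, j < i → b.repr (f (b j)) i = 0 := by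
  induction n with
  | zero =>
    intro W _ _ _ h f
    exact ⟨finBasisOfFinrankEq F W h, fun i => i.elim0⟩
  | succ n ih =>
    intro W _ _ _ h f
    have : Nontrivial W := nontrivial_of_finrank_pos (R := F) (by omega)
    -- an eigenvector of the transpose is a linear form with `f`-invariant kernel
    obtain ⟨μ, hμ⟩ := Module.End.exists_eigenvalue (K := F) (V := Module.Dual F W) f.dualMap
    obtain ⟨φ, hφ⟩ := hμ.exists_hasEigenvector
    have hφ0 : φ ≠ 0 := hφ.2
    have hφe : ∀ x, φ (f x) = μ * φ x := fun x => by
      simpa using LinearMap.congr_fun hφ.apply_eq_smul x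
    obtain ⟨y, hy⟩ : ∃ y, φ y ≠ 0 := by
      by_contra! hc
      exact hφ0 (LinearMap.ext hc)
    let N := LinearMap.ker φ
    have hN : ∀ x ∈ N, f x ∈ N := fun x hx => by
      simp only [N, LinearMap.mem_ker] at hx ⊢
      rw [hφe, hx, mul_zero]
    have hfr : finrank F N = n := by
      have h1 := LinearMap.finrank_range_add_finrank_ker φ
      have h2 : finrank F (LinearMap.range φ) = 1 := by
        rw [LinearMap.range_eq_top.2 (LinearMap.surjective hφ0)]
        simp
      rw [h2, h] at h1
      change finrank F (LinearMap.ker φ) = n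
      omega
    obtain ⟨b, hb⟩ := ih N hfr (f.restrict hN)
    have hli : ∀ (c : F), ∀ x ∈ N, c • y + x = 0 → c = 0 := by
      intro c x hx h0
      have := congrArg φ h0
      simp only [map_add, map_smul, LinearMap.mem_ker.1 hx, add_zero, map_zero, smul_eq_mul] at this
      exact (mul_eq_zero.1 this).resolve_right hy
    have hsp : ∀ z : W, ∃ c : F, z + c • y ∈ N := fun z => by
      refine ⟨-(φ z / φ y), ?_⟩
      simp [N, LinearMap.mem_ker, hy]
    refine ⟨Basis.mkFinSnoc b y hli hsp, ?_⟩
    set b' := Basis.mkFinSnoc b y hli hsp with hb'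
    have hcoe : (b' : Fin (n + 1) → W) = Fin.snoc ((↑) ∘ b) y := Basis.coe_mkFinSnoc _ _ _ _
    have hcast : ∀ k : Fin n, b' k.castSucc = (b k : W) := fun k => by
      rw [hcoe, Fin.snoc_castSucc]; rfl
    intro i j hij
    obtain ⟨j, rfl⟩ : ∃ j' : Fin n, j = j'.castSucc :=
      ⟨j.castLT (by omega), by simp⟩
    have hexp : f (b' j.castSucc) = ∑ k, b.repr (f.restrict hN (b j)) k • b' k.castSucc := by
      have h1 := congrArg Subtype.val (b.sum_repr (f.restrict hN (b j)))
      rw [hcast]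
      simp only [hcast]
      refine h1.symm.trans ?_
      simp only [Submodule.coe_sum, Submodule.coe_smul]
    rw [hexp]
    simp only [map_sum, map_smul, Basis.repr_self, Finsupp.coe_finsetSum, Finset.sum_apply,
      Finsupp.smul_apply, smul_eq_mul]
    refine Finset.sum_eq_zero fun k _ => ?_
    by_cases hk : k.castSucc = i
    · subst hk
      rw [hb k j (by simpa using hij), zero_mul]
    · rw [Finsupp.single_apply, if_neg hk, mul_zero]

theorem charpoly_eq_prod_of_triangular {F W ι α : Type*} [Field F] [AddCommGroup W]
    [Module F W] [Module.Finite F W] [Fintype ι] [LinearOrder α] (b : Basis ι F W) (f : W →ₗ[F] W)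
    (d : ι → α) (h : ∀ i j, i ≠ j → d j ≤ d i → b.repr (f (b j)) i = 0) :
    f.charpoly = ∏ i, (X - C (b.repr (f (b i)) i)) := by
  classical
  -- ties of `d` are broken by an arbitrary enumeration of the indices
  let e : ι → Lex (α × Fin (Fintype.card ι)) := fun i => toLex (d i, Fintype.equivFin ι i)
  have he : Function.Injective e := fun i j hij => by
    have := congrArg (fun p => (ofLex p).2) hij
    simpa [e] using this
  let _ : LinearOrder ι := LinearOrder.lift' e he
  rw [← LinearMap.charpoly_toMatrix f b, Matrix.charpoly_of_isUpperTriangular]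
  · simp [LinearMap.toMatrix_apply]
  · intro i j hij
    rw [LinearMap.toMatrix_apply]
    have hlt : e j < e i := hij
    refine h i j (fun hh => by simp [hh] at hlt) ?_
    rcases Prod.Lex.lt_iff.1 hlt with h1 | h1
    · exact h1.le
    · exact h1.1.le

/-- The matrix of `Λ^r f` consists of the `r × r` minors of the matrix of `f`. -/
theorem exteriorPower_map_repr {F W : Type*} [Field F] [AddCommGroup W]
    [Module F W] {m r : ℕ} (b : Basis (Fin m) F W) (f : W →ₗ[F] W)
    (s t : Set.powersetCard (Fin m) r) :
    (b.exteriorPower r).repr (exteriorPower.map r f (b.exteriorPower r t)) s =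
      (Matrix.of fun i j => b.repr (f (b (ofFinEmbEquiv.symm t i)))
        (ofFinEmbEquiv.symm s j)).det := by
  rw [exteriorPower.basis_apply, exteriorPower.map_apply_ιMulti_family,
    exteriorPower.basis_repr_apply, exteriorPower.ιMulti_family,
    exteriorPower.ιMultiDual_apply_ιMulti]
  rfl

/-- The characteristic polynomial of `Λ^r f` for a triangular `f`: the diagonal entries of `Λ^r f`
are the products of `r` diagonal entries of `f`. -/
theorem charpoly_exteriorPower_map_of_triangular {F W : Type*} [Field F] [AddCommGroup W]
    [Module F W] [Module.Finite F W] {m : ℕ} (b : Basis (Fin m) F W) (f : W →ₗ[F] W)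
    (h : ∀ i j, j < i → b.repr (f (b j)) i = 0) (r : ℕ) :
    (exteriorPower.map r f).charpoly =
      ∏ s : Set.powersetCard (Fin m) r, (X - C (∏ i ∈ s.1, b.repr (f (b i)) i)) := by
  have hsum : ∀ s : Set.powersetCard (Fin m) r,
      ∑ i, (ofFinEmbEquiv.symm s i : ℕ) = ∑ i ∈ s.1, (i : ℕ) := fun s => by
    conv_rhs => rw [← Finset.map_orderEmbOfFin_univ s.1 s.2]
    rw [Finset.sum_map]
    rfl
  rw [charpoly_eq_prod_of_triangular (b.exteriorPower r) _ (fun s => ∑ i ∈ s.1, (i : ℕ))]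
  · refine Finset.prod_congr rfl fun s _ => ?_
    rw [exteriorPower_map_repr, Matrix.det_of_isLowerTriangular]
    · simp only [Matrix.of_apply]
      conv_rhs => rw [← Finset.map_orderEmbOfFin_univ s.1 s.2]
      rw [Finset.prod_map]
      rfl
    · intro i j hij
      exact h _ _ ((ofFinEmbEquiv.symm s).strictMono hij)
  · intro s t hst hle
    rw [exteriorPower_map_repr, Matrix.det_apply]
    refine Finset.sum_eq_zero fun σ _ => ?_
    suffices ∃ i, (ofFinEmbEquiv.symm t (σ i)) < ofFinEmbEquiv.symm s i by
      obtain ⟨i, hi⟩ := this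
      rw [Finset.prod_eq_zero (Finset.mem_univ i) (by simpa using h _ _ hi), smul_zero]
    by_contra! hc
    have h1 : ∑ i, (ofFinEmbEquiv.symm t (σ i) : ℕ) = ∑ i, (ofFinEmbEquiv.symm t i : ℕ) :=
      Equiv.sum_comp σ fun i => (ofFinEmbEquiv.symm t i : ℕ)
    have h2 : ∑ i, (ofFinEmbEquiv.symm s i : ℕ) = ∑ i, (ofFinEmbEquiv.symm t (σ i) : ℕ) := by
      refine le_antisymm (Finset.sum_le_sum fun i _ => hc i) ?_
      rw [h1, hsum, hsum]
      exact hle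
    have h3 := (Finset.sum_eq_sum_iff_of_le fun i _ => Fin.le_def.1 (hc i)).1 h2
    refine hst (eq_iff_subset.2 fun a ha => ?_)
    obtain ⟨i, rfl⟩ := (mem_range_ofFinEmbEquiv_symm_iff_mem s a).2 ha
    rw [Fin.ext (h3 i (Finset.mem_univ i))]
    exact (mem_range_ofFinEmbEquiv_symm_iff_mem t _).1 ⟨_, rfl⟩

/-- The roots of the characteristic polynomial of `Λ^r f` are the products of `r` of the roots of
the characteristic polynomial of `f`. -/
theorem charpoly_exteriorPower_map {F : Type*} [Field F] [IsAlgClosed F] {W : Type*}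
    [AddCommGroup W] [Module F W] [Module.Finite F W] (f : W →ₗ[F] W) (r : ℕ) :
    (exteriorPower.map r f).charpoly =
      ((f.charpoly.roots.powersetCard r).map fun s => X - C s.prod).prod := by
  obtain ⟨b, hb⟩ := exists_basis_upperTriangular (finrank F W) W rfl f
  have hroots : f.charpoly.roots = Finset.univ.val.map fun i => b.repr (f (b i)) i := by
    rw [charpoly_eq_prod_of_triangular b f id fun i j hij hle => hb i j (lt_of_le_of_ne hle hij.symm)]
    have := roots_multiset_prod_X_sub_C (Finset.univ.val.map fun i => b.repr (f (b i)) i)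
    rwa [Multiset.map_map] at this
  rw [charpoly_exteriorPower_map_of_triangular b f hb, hroots, Multiset.powersetCard_map,
    Multiset.map_map, ← Finset.map_val_val_powersetCard, Multiset.map_map]
  rw [← Finset.prod_subtype (F := inferInstance) (Finset.univ.powersetCard r) (fun s => by simp)
    fun s : Finset (Fin (finrank F W)) => X - C (∏ i ∈ s, b.repr (f (b i)) i)]
  rfl

/-- The characteristic polynomial of `Λ^r f` is a model of `plethE` over the base field. -/
theorem map_charpoly_exteriorPower_map {F : Type} [Field F] {m : ℕ}
    (f : (Fin m → F) →ₗ[F] (Fin m → F)) (r : ℕ) :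
    (exteriorPower.map r f).charpoly.map (algebraMap F (AlgebraicClosure F)) =
      plethE f.charpoly r := by
  classical
  set L := AlgebraicClosure F
  let g : (Fin m → L) →ₗ[L] (Fin m → L) :=
    Matrix.toLin' ((LinearMap.toMatrix' f).map (algebraMap F L))
  have hg : g.charpoly = f.charpoly.map (algebraMap F L) := by
    rw [← LinearMap.charpoly_toMatrix g (Pi.basisFun L (Fin m)),
      ← LinearMap.charpoly_toMatrix f (Pi.basisFun F (Fin m)), ← Matrix.charpoly_map]
    congr 1
    rw [LinearMap.toMatrix_eq_toMatrix', LinearMap.toMatrix_eq_toMatrix', LinearMap.toMatrix'_toLin']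
  have hgf : ∀ i j, (Pi.basisFun L (Fin m)).repr (g (Pi.basisFun L (Fin m) i)) j =
      algebraMap F L ((Pi.basisFun F (Fin m)).repr (f (Pi.basisFun F (Fin m) i)) j) := by
    intro i j
    simp [g, LinearMap.toMatrix'_apply]
  rw [plethE, Polynomial.aroots, ← hg, ← charpoly_exteriorPower_map g r,
    ← LinearMap.charpoly_toMatrix _ ((Pi.basisFun L (Fin m)).exteriorPower r),
    ← LinearMap.charpoly_toMatrix _ ((Pi.basisFun F (Fin m)).exteriorPower r),
    ← Matrix.charpoly_map]
  congr 1
  ext s t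
  rw [Matrix.map_apply, LinearMap.toMatrix_apply, LinearMap.toMatrix_apply, exteriorPower_map_repr,
    exteriorPower_map_repr, RingHom.map_det]
  congr 1
  ext i j
  simp only [Matrix.of_apply, hgf, RingHom.mapMatrix_apply, Matrix.map_apply]
  rfl

section Elementary

variable {F : Type*} [Field F] {m r : ℕ} {f : (Fin m → F) →ₗ[F] (Fin m → F)} {k : Fin m}

/-- The basis vector of `Λ^r F^m` indexed by an `r`-element set. -/
noncomputable def wedge (F : Type*) [Field F] {m r : ℕ} (S : Set.powersetCard (Fin m) r) :
    ⋀[F]^r (Fin m → F) :=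
  (Pi.basisFun F (Fin m)).exteriorPower r S

theorem wedge_eq (S : Set.powersetCard (Fin m) r) : wedge F S =
    exteriorPower.ιMulti F r fun i => (Pi.single (ofFinEmbEquiv.symm S i) 1 : Fin m → F) := by
  rw [wedge, exteriorPower.basis_apply, exteriorPower.ιMulti_family]
  congr 1
  ext1 i
  simp

theorem map_wedge_of_notMem (hf : ∀ i, i ≠ k → f (Pi.single i 1) = Pi.single i 1)
    (S : Set.powersetCard (Fin m) r) (hk : k ∉ S.1) :
    exteriorPower.map r f (wedge F S) = wedge F S := by
  rw [wedge_eq, exteriorPower.map_apply_ιMulti]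
  congr 1
  ext1 i
  refine hf _ fun h => hk ?_
  rw [← h]
  exact (mem_range_ofFinEmbEquiv_symm_iff_mem S _).1 ⟨_, rfl⟩

theorem map_wedge_of_mem (hf : ∀ i, i ≠ k → f (Pi.single i 1) = Pi.single i 1)
    (S : Set.powersetCard (Fin m) r) {p : Fin r}
    (hp : ofFinEmbEquiv.symm S p = k) {α : F} {z : Fin m → F}
    (hfk : f (Pi.single k 1) = α • Pi.single k 1 + z) :
    exteriorPower.map r f (wedge F S) = α • wedge F S + exteriorPower.ιMulti F r
      (Function.update (fun i => (Pi.single (ofFinEmbEquiv.symm S i) 1 : Fin m → F)) p z) := by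
  have h1 : (f ∘ fun i => (Pi.single (ofFinEmbEquiv.symm S i) 1 : Fin m → F)) =
      Function.update (fun i => (Pi.single (ofFinEmbEquiv.symm S i) 1 : Fin m → F)) p
        (α • Pi.single k 1 + z) := by
    ext1 i
    by_cases hi : i = p
    · subst hi
      simp [hp, hfk]
    · rw [Function.update_of_ne hi]
      exact hf _ fun h => hi ((ofFinEmbEquiv.symm S).injective (h.trans hp.symm))
  rw [wedge_eq, exteriorPower.map_apply_ιMulti, h1, AlternatingMap.map_update_add,
    AlternatingMap.map_update_smul, ← hp, Function.update_eq_self]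

/-- `Λ^r` of a map which scales one basis vector and fixes the others. -/
theorem map_wedge_of_scale (hf : ∀ i, i ≠ k → f (Pi.single i 1) = Pi.single i 1)
    (S : Set.powersetCard (Fin m) r) (hk : k ∈ S.1) {α : F}
    (hfk : f (Pi.single k 1) = α • Pi.single k 1) :
    exteriorPower.map r f (wedge F S) = α • wedge F S := by
  obtain ⟨p, hp⟩ := (mem_range_ofFinEmbEquiv_symm_iff_mem S _).2 hk
  rw [map_wedge_of_mem hf S hp (z := 0) (by rw [hfk, add_zero]),
    (exteriorPower.ιMulti F r).map_update_zero, add_zero]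

/-- `Λ^r` of a map which adds to a basis vector a multiple of another one, on a wedge product which
already contains the latter. -/
theorem map_wedge_of_mem_of_mem (hf : ∀ i, i ≠ k → f (Pi.single i 1) = Pi.single i 1)
    (S : Set.powersetCard (Fin m) r) {k' : Fin m} (hkk : k ≠ k')
    (hk : k ∈ S.1) (hk' : k' ∈ S.1) {α β : F}
    (hfk : f (Pi.single k 1) = α • Pi.single k 1 + β • Pi.single k' 1) :
    exteriorPower.map r f (wedge F S) = α • wedge F S := by
  obtain ⟨p, hp⟩ := (mem_range_ofFinEmbEquiv_symm_iff_mem S _).2 hk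
  obtain ⟨q, hq⟩ := (mem_range_ofFinEmbEquiv_symm_iff_mem S _).2 hk'
  have hpq : p ≠ q := fun h => hkk (by rw [← hp, ← hq, h])
  rw [map_wedge_of_mem hf S hp hfk, AlternatingMap.map_update_smul,
    (exteriorPower.ιMulti F r).map_eq_zero_of_eq _ (i := p) (j := q) _ hpq, smul_zero, add_zero]
  rw [Function.update_self, Function.update_of_ne hpq.symm, hq]

/-- `Λ^r` of a map which fixes all basis vectors but one, and adds to that one a multiple of a
neighbouring basis vector: no sign appears. -/
theorem map_wedge_of_mem_of_notMem (hf : ∀ i, i ≠ k → f (Pi.single i 1) = Pi.single i 1)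
    (S S' : Set.powersetCard (Fin m) r) {k' : Fin m}
    (hadj : (k' : ℕ) = k + 1 ∨ (k : ℕ) = k' + 1) (hk : k ∈ S.1) (hk' : k' ∉ S.1)
    (hS' : S'.1 = insert k' (S.1.erase k)) {α β : F}
    (hfk : f (Pi.single k 1) = α • Pi.single k 1 + β • Pi.single k' 1) :
    exteriorPower.map r f (wedge F S) = α • wedge F S + β • wedge F S' := by
  obtain ⟨p, hp⟩ := (mem_range_ofFinEmbEquiv_symm_iff_mem S _).2 hk
  have hmem : ∀ i, ofFinEmbEquiv.symm S i ∈ S.1 := fun i =>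
    (mem_range_ofFinEmbEquiv_symm_iff_mem S _).1 ⟨i, rfl⟩
  have hne : ∀ i, (ofFinEmbEquiv.symm S i : ℕ) ≠ k' := fun i h => hk' (by
    rw [← Fin.ext h]; exact hmem i)
  have hu : Function.update (ofFinEmbEquiv.symm S) p k' = ofFinEmbEquiv.symm S' := by
    rw [ofFinEmbEquiv_symm_apply S']
    refine Finset.orderEmbOfFin_unique S'.2 (fun i => ?_) fun i j hij => ?_
    · rw [hS']
      by_cases hi : i = p
      · subst hi; simp
      · rw [Function.update_of_ne hi]
        refine Finset.mem_insert_of_mem (Finset.mem_erase.2 ⟨fun h => hi ?_, hmem i⟩)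
        exact (ofFinEmbEquiv.symm S).injective (h.trans hp.symm)
    · have hlt := (ofFinEmbEquiv.symm S).strictMono hij
      by_cases hi : i = p
      · subst hi
        rw [Function.update_self, Function.update_of_ne hij.ne']
        have := hne j
        rw [hp] at hlt
        simp only [Fin.lt_def] at hlt ⊢
        omega
      · rw [Function.update_of_ne hi]
        by_cases hj : j = p
        · subst hj
          rw [Function.update_self]
          have := hne i
          rw [hp] at hlt
          simp only [Fin.lt_def] at hlt ⊢
          omega
        · rwa [Function.update_of_ne hj]
  rw [map_wedge_of_mem hf S hp hfk, AlternatingMap.map_update_smul, wedge_eq S']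
  congr 3
  rw [← hu]
  ext1 i
  by_cases hi : i = p
  · subst hi; simp
  · simp [Function.update_of_ne hi]

end Elementary

end AztecStrip

namespace AztecStrip

open Equiv Equiv.Perm

/-! ### Determinants and families of disjoint cycles -/

section Cycles

variable {V : Type*}

/-- A cyclic permutation of a nonempty finite set `C.1`, extended by the identity.  Sets with one
element are allowed. -/
def IsCyclicOn (C : Finset V × Perm V) : Prop :=
  C.1.Nonempty ∧ C.2.IsCycleOn (C.1 : Set V) ∧ ∀ v, v ∉ C.1 → C.2 v = v

/-- A set of pairwise disjoint cyclic permutations. -/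
def IsCycleFamily (A : Finset (Finset V × Perm V)) : Prop :=
  (∀ C ∈ A, IsCyclicOn C) ∧ ∀ C ∈ A, ∀ D ∈ A, C ≠ D → Disjoint C.1 D.1

theorem IsCyclicOn.apply_mem {C : Finset V × Perm V} (h : IsCyclicOn C) {v : V} (hv : v ∈ C.1) :
    C.2 v ∈ C.1 := by
  have := (h.2.1.apply_mem_iff (x := v)).2
  simpa using this hv

theorem IsCyclicOn.sign_mul [Fintype V] [DecidableEq V] {C : Finset V × Perm V} (h : IsCyclicOn C) :
    sign C.2 * (-1) ^ C.1.card = -1 := by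
  obtain ⟨hne, hc, hfix⟩ := h
  rcases hne.exists_eq_singleton_or_nontrivial with ⟨a, ha⟩ | hnt
  · have h1 : C.2 = 1 := by
      ext1 v
      by_cases hv : v ∈ C.1
      · rw [ha] at hc hv
        rw [Finset.mem_singleton.1 hv]
        exact isCycleOn_singleton.1 (by simpa using hc)
      · exact hfix v hv
    rw [h1, ha]
    simp
  · have hcyc : C.2.IsCycle := isCycle_iff_exists_isCycleOn.2 ⟨C.1, hnt, hc, fun x hx => by
      by_contra hx'
      exact hx (hfix x hx')⟩
    have hsupp : C.2.support = C.1 := by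
      ext v
      rw [mem_support]
      refine ⟨fun hv => by_contra fun hv' => hv (hfix v hv'), fun hv => hc.apply_ne hnt hv⟩
    rw [hcyc.sign, hsupp, neg_mul, ← pow_add, ← two_mul, pow_mul]
    simp

theorem IsCycleFamily.subset {A A' : Finset (Finset V × Perm V)} (h : IsCycleFamily A)
    (hA : A' ⊆ A) : IsCycleFamily A' :=
  ⟨fun C hC => h.1 C (hA hC), fun C hC D hD => h.2 C (hA hC) D (hA hD)⟩

/-- A family of disjoint cycles is the family of cycles of one permutation. -/
theorem IsCycleFamily.exists_perm [Fintype V] [DecidableEq V]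
    (A : Finset (Finset V × Perm V)) (hA : IsCycleFamily A) :
    ∃ σ : Perm V, (∀ v, v ∉ A.biUnion Prod.fst → σ v = v) ∧ (∀ C ∈ A, ∀ v ∈ C.1, σ v = C.2 v) ∧
      sign σ * (-1) ^ (A.biUnion Prod.fst).card = (-1) ^ A.card := by
  induction A using Finset.induction_on with
  | empty => exact ⟨1, by simp⟩
  | insert C A hC ih =>
    obtain ⟨σ, h1, h2, h3⟩ := ih (hA.subset (Finset.subset_insert C A))
    have hCc := hA.1 C (Finset.mem_insert_self _ _)
    have hdis : Disjoint C.1 (A.biUnion Prod.fst) := by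
      rw [Finset.disjoint_biUnion_right]
      exact fun D hD => hA.2 C (Finset.mem_insert_self _ _) D (Finset.mem_insert_of_mem hD)
        (fun h => hC (h ▸ hD))
    refine ⟨C.2 * σ, ?_, ?_, ?_⟩
    · intro v hv
      rw [Finset.biUnion_insert, Finset.mem_union, not_or] at hv
      rw [mul_apply, h1 v hv.2, hCc.2.2 v hv.1]
    · intro D hD v hv
      rcases Finset.mem_insert.1 hD with rfl | hD
      · rw [mul_apply, h1 v (Finset.disjoint_left.1 hdis hv)]
      · rw [mul_apply, h2 D hD v hv]
        refine hCc.2.2 _ fun hmem => Finset.disjoint_left.1 hdis hmem ?_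
        exact Finset.mem_biUnion.2 ⟨D, hD, (hA.1 D (Finset.mem_insert_of_mem hD)).apply_mem hv⟩
    · rw [Finset.biUnion_insert, Finset.card_union_of_disjoint hdis, Finset.card_insert_of_notMem hC,
        Perm.sign_mul, pow_add, pow_succ, ← h3, mul_mul_mul_comm, hCc.sign_mul, mul_comm]

theorem IsCyclicOn.mem_iff_sameCycle {C : Finset V × Perm V} (h : IsCyclicOn C) {σ : Perm V}
    (hσ : ∀ v ∈ C.1, σ v = C.2 v) {u : V} (hu : u ∈ C.1) (v : V) : v ∈ C.1 ↔ σ.SameCycle u v := by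
  have hpow : ∀ k : ℕ, (σ ^ k) u = (C.2 ^ k) u ∧ (C.2 ^ k) u ∈ C.1 := by
    intro k
    induction k with
    | zero => simpa using hu
    | succ k ih =>
      rw [pow_succ', pow_succ', mul_apply, mul_apply, ih.1, hσ _ ih.2]
      exact ⟨rfl, h.apply_mem ih.2⟩
  have hcard := (h.2.1).pow_card_apply hu
  constructor
  · intro hv
    obtain ⟨k, -, hk⟩ := h.2.1.exists_pow_eq hu hv
    exact ⟨k, by rw [zpow_natCast, (hpow k).1, hk]⟩
  · rintro ⟨k, rfl⟩
    -- negative powers reduce to nonnegative ones, as a power of `σ` fixes `u`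
    have hN : 0 < C.1.card := Finset.card_pos.2 h.1
    have h1 : (σ ^ C.1.card) u = u := by rw [(hpow _).1, hcard]
    have h2 : (σ ^ k) u = (σ ^ (k % (C.1.card : ℤ))) u := by
      conv_lhs => rw [← Int.emod_add_mul_ediv k C.1.card, zpow_add, mul_apply, zpow_mul,
        zpow_natCast, zpow_apply_eq_self_of_apply_eq_self h1]
    obtain ⟨j, hj⟩ := Int.eq_ofNat_of_zero_le (Int.emod_nonneg k (by omega : (C.1.card : ℤ) ≠ 0))
    rw [h2, hj, zpow_natCast, (hpow j).1]
    exact (hpow j).2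

/-- The cycles of a permutation through the points of a set form a family of disjoint cycles. -/
theorem exists_isCycleFamily [Fintype V] [DecidableEq V] (σ : Perm V) (S : Finset V)
    (hσ : ∀ v, v ∉ S → σ v = v) :
    ∃ A : Finset (Finset V × Perm V), IsCycleFamily A ∧ A.biUnion Prod.fst = S ∧
      ∀ C ∈ A, ∀ v ∈ C.1, σ v = C.2 v := by
  classical
  have hS : ∀ u v, u ∈ S → σ.SameCycle u v → v ∈ S := by
    intro u v hu huv
    by_contra hv
    exact hv (huv.eq_of_right (hσ v hv) ▸ hu)
  refine ⟨S.image fun v => (Finset.univ.filter (σ.SameCycle v), σ.cycleOf v), ⟨?_, ?_⟩, ?_, ?_⟩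
  · intro C hC
    obtain ⟨u, hu, rfl⟩ := Finset.mem_image.1 hC
    refine ⟨⟨u, by simp [SameCycle.refl]⟩, ⟨?_, ?_⟩, ?_⟩
    · refine ⟨fun v hv => ?_, (σ.cycleOf u).injective.injOn, fun v hv => ?_⟩
      · have hv' : σ.SameCycle u v := by simpa using hv
        simp only [Finset.coe_filter, Finset.mem_univ, true_and, Set.mem_ofPred_eq]
        rw [hv'.cycleOf_apply]
        simpa using hv'
      · have hv' : σ.SameCycle u v := by simpa using hv
        have h2 : σ.SameCycle u (σ⁻¹ v) := by simpa using hv'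
        refine ⟨σ⁻¹ v, by simpa using h2, ?_⟩
        rw [h2.cycleOf_apply]
        simp
    · intro a ha b hb
      have ha' : σ.SameCycle u a := by simpa using ha
      have hb' : σ.SameCycle u b := by simpa using hb
      obtain ⟨k, hk⟩ := ha'.symm.trans hb'
      refine ⟨k, ?_⟩
      rw [ha'.cycleOf_eq, cycleOf_zpow_apply_self, hk]
    · intro v hv
      exact cycleOf_apply_of_not_sameCycle (by simpa using hv)
  · intro C hC D hD hne
    obtain ⟨u, hu, rfl⟩ := Finset.mem_image.1 hC
    obtain ⟨v, hv, rfl⟩ := Finset.mem_image.1 hD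
    rw [Finset.disjoint_left]
    intro x hx hx'
    have h1 : σ.SameCycle u v :=
      (Finset.mem_filter.1 hx).2.trans (Finset.mem_filter.1 hx').2.symm
    refine hne ?_
    rw [h1.cycleOf_eq]
    congr 1
    ext y
    simp only [Finset.mem_filter, Finset.mem_univ, true_and]
    exact ⟨fun h => h1.symm.trans h, fun h => h1.trans h⟩
  · ext v
    simp only [Finset.mem_biUnion, Finset.mem_image]
    constructor
    · rintro ⟨C, ⟨u, hu, rfl⟩, hv⟩
      exact hS u v hu (by simpa using hv)
    · intro hv
      exact ⟨_, ⟨v, hv, rfl⟩, by simp [SameCycle.refl]⟩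
  · intro C hC v hv
    obtain ⟨u, hu, rfl⟩ := Finset.mem_image.1 hC
    exact ((Finset.mem_filter.1 hv).2.cycleOf_apply).symm

/-- Expansion of `det (1 - B)` over families of disjoint cycles in the complete digraph on `V`. -/
theorem det_one_sub_eq_sum_cycleFamilies [Fintype V] [DecidableEq V] {R : Type*} [CommRing R]
    (B : Matrix V V R)
    (𝒜 : Finset (Finset (Finset V × Perm V))) (h𝒜 : ∀ A, A ∈ 𝒜 ↔ IsCycleFamily A) :
    (1 - B).det = ∑ A ∈ 𝒜, (-1) ^ A.card * ∏ C ∈ A, ∏ v ∈ C.1, B v (C.2 v) := by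
  classical
  have h1 : (1 - B).det = ∑ p ∈ (Finset.univ : Finset (Perm V × Finset V)).filter
      (fun p => ∀ v, v ∉ p.2 → p.1 v = v),
        ((sign p.1 * (-1) ^ p.2.card : ℤˣ) : ℤ) • ∏ v ∈ p.2, B v (p.1 v) := by
    rw [← Matrix.det_transpose, Matrix.det_apply, Finset.sum_filter, Fintype.sum_prod_type]
    refine Finset.sum_congr rfl fun σ _ => ?_
    have : ∀ v, (1 - B).transpose (σ v) v = - B v (σ v) + if σ v = v then 1 else 0 := fun v => by
      simp only [Matrix.transpose_apply, Matrix.sub_apply, Matrix.one_apply, eq_comm (a := v)]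
      ring
    simp only [this]
    rw [Finset.prod_add, Finset.smul_sum, Finset.powerset_univ]
    refine Finset.sum_congr rfl fun S _ => ?_
    split_ifs with h
    · rw [Finset.prod_eq_one (s := Finset.univ \ S), mul_one, Finset.prod_neg]
      · simp only [Units.smul_def, Units.val_mul, mul_smul, Units.val_pow_eq_pow_val,
          Units.val_neg, Units.val_one]
        congr 1
        simp [zsmul_eq_mul]
      · intro v hv
        rw [if_pos (h v (by simpa using hv))]
    · push Not at h
      obtain ⟨v, hv, hv'⟩ := h
      rw [Finset.prod_eq_zero (s := Finset.univ \ S) (i := v), mul_zero, smul_zero]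
      · simpa using hv
      · rw [if_neg hv']
  rw [h1]
  symm
  refine Finset.sum_bij (fun A hA => ((((h𝒜 A).1 hA).exists_perm).choose, A.biUnion Prod.fst))
    ?_ ?_ ?_ ?_
  · intro A hA
    simp only [Finset.mem_filter, Finset.mem_univ, true_and]
    exact (((h𝒜 A).1 hA).exists_perm).choose_spec.1
  · intro A hA A' hA' heq
    have hσ := (((h𝒜 A).1 hA).exists_perm).choose_spec.2.1
    have hσ' := (((h𝒜 A').1 hA').exists_perm).choose_spec.2.1
    rw [Prod.ext_iff] at heq
    simp only at heq
    rw [heq.1] at hσ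
    have key : ∀ A₁ A₂ : Finset (Finset V × Perm V), IsCycleFamily A₁ → IsCycleFamily A₂ →
        A₁.biUnion Prod.fst = A₂.biUnion Prod.fst → ∀ σ : Perm V,
        (∀ C ∈ A₁, ∀ v ∈ C.1, σ v = C.2 v) → (∀ C ∈ A₂, ∀ v ∈ C.1, σ v = C.2 v) → A₁ ⊆ A₂ := by
      intro A₁ A₂ hA₁ hA₂ hU σ h₁ h₂ C hC
      obtain ⟨v, hv⟩ := (hA₁.1 C hC).1
      have : v ∈ A₂.biUnion Prod.fst := hU ▸ Finset.mem_biUnion.2 ⟨C, hC, hv⟩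
      obtain ⟨D, hD, hvD⟩ := Finset.mem_biUnion.1 this
      have hCD : C.1 = D.1 := by
        ext x
        rw [(hA₁.1 C hC).mem_iff_sameCycle (h₁ C hC) hv,
          (hA₂.1 D hD).mem_iff_sameCycle (h₂ D hD) hvD]
      have : C = D := by
        refine Prod.ext hCD (Equiv.ext fun x => ?_)
        by_cases hx : x ∈ C.1
        · rw [← h₁ C hC x hx, h₂ D hD x (hCD ▸ hx)]
        · rw [(hA₁.1 C hC).2.2 x hx, (hA₂.1 D hD).2.2 x (hCD ▸ hx)]
      exact this ▸ hD
    exact Finset.Subset.antisymm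
      (key A A' ((h𝒜 A).1 hA) ((h𝒜 A').1 hA') heq.2 _ hσ hσ')
      (key A' A ((h𝒜 A').1 hA') ((h𝒜 A).1 hA) heq.2.symm _ hσ' hσ)
  · rintro ⟨σ, S⟩ hp
    simp only [Finset.mem_filter, Finset.mem_univ, true_and] at hp
    obtain ⟨A, hA, hU, hAσ⟩ := exists_isCycleFamily σ S hp
    refine ⟨A, (h𝒜 A).2 hA, Prod.ext (Equiv.ext fun v => ?_) hU⟩
    have h := (hA.exists_perm).choose_spec
    by_cases hv : v ∈ S
    · obtain ⟨C, hC, hvC⟩ := Finset.mem_biUnion.1 (hU ▸ hv)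
      exact (h.2.1 C hC v hvC).trans (hAσ C hC v hvC).symm
    · exact (h.1 v (hU ▸ hv)).trans (hp v hv).symm
  · intro A hA
    have h := (((h𝒜 A).1 hA).exists_perm).choose_spec
    have hdis : (A : Set (Finset V × Perm V)).PairwiseDisjoint Prod.fst :=
      fun C hC D hD hne => ((h𝒜 A).1 hA).2 C hC D hD hne
    simp only
    rw [h.2.2, Finset.prod_biUnion hdis, zsmul_eq_mul]
    congr 1
    · simp
    · exact Finset.prod_congr rfl fun C hC => Finset.prod_congr rfl fun v hv => by
        rw [h.2.1 C hC v hv]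

end Cycles

/-! ### Determinants of block cyclic matrices -/

section BlockCyclic

/-- A matrix is triangular if its entries off the diagonal strictly increase a degree `d`, which
need not be injective. -/
theorem det_eq_prod_of_triangular {R ι α : Type*} [CommRing R] [Fintype ι] [DecidableEq ι]
    [LinearOrder α] (A : Matrix ι ι R) (d : ι → α)
    (h : ∀ i j, i ≠ j → d j ≤ d i → A i j = 0) : A.det = ∏ i, A i i := by
  -- ties of `d` are broken by an arbitrary enumeration of the indices
  let e : ι → Lex (α × Fin (Fintype.card ι)) := fun i => toLex (d i, Fintype.equivFin ι i)
  have he : Function.Injective e := fun i j hij => by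
    have := congrArg (fun p => (ofLex p).2) hij
    simpa [e] using this
  let inst : LinearOrder ι := LinearOrder.lift' e he
  have := Matrix.det_of_isUpperTriangular (M := A) ?_
  · convert! this
  · intro i j hij
    have hlt : e j < e i := hij
    refine h i j (fun hh => by simp [hh] at hlt) ?_
    rcases Prod.Lex.lt_iff.1 hlt with h1 | h1
    · exact h1.le
    · exact h1.1.le

theorem det_eq_one_of_triangular {R ι α : Type*} [CommRing R] [Fintype ι] [DecidableEq ι]
    [LinearOrder α] (A : Matrix ι ι R) (d : ι → α) (h1 : ∀ i, A i i = 1)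
    (h : ∀ i j, i ≠ j → d j ≤ d i → A i j = 0) : A.det = 1 := by
  rw [det_eq_prod_of_triangular A d h, Finset.prod_eq_one fun i _ => h1 i]

variable {R : Type*} [CommRing R] {N k : ℕ} [NeZero N]

/-- The block cyclic matrix with blocks `M x` in the positions `(x, x + 1)`, `x` modulo `N`. -/
def blockCyclic (M : ZMod N → Matrix (Fin k) (Fin k) R) :
    Matrix (ZMod N × Fin k) (ZMod N × Fin k) R :=
  Matrix.of fun p q => if q.1 = p.1 + 1 then M p.1 p.2 q.2 else 0

/-- The determinant for a block cyclic matrix with blocks `M 0, …, M (N - 1)` is that of one minus the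
product of the blocks; `P x` is the product `M x * ⋯ * M (N - 1)`. -/
theorem det_one_sub_blockCyclic (hN : 2 ≤ N) (M : ZMod N → Matrix (Fin k) (Fin k) R)
    (P : ℕ → Matrix (Fin k) (Fin k) R) (hP : P N = 1)
    (hPs : ∀ x < N, P x = M (x : ZMod N) * P (x + 1)) :
    (1 - blockCyclic M).det = (1 - P 0).det := by
  have : Fact (1 < N) := ⟨hN⟩
  -- column operations clear all blocks of the first block column but the topmost
  let G : Matrix (ZMod N × Fin k) (ZMod N × Fin k) R := Matrix.of fun p q =>
    if q.1 = 0 ∧ p.1 ≠ 0 then P p.1.val p.2 q.2 else (1 : Matrix _ _ R) p q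
  have hG : G.det = 1 := by
    refine det_eq_one_of_triangular G (fun p => OrderDual.toDual p.1.val) (fun p => ?_) ?_
    · simp only [G, Matrix.of_apply, Matrix.one_apply_eq]
      rw [if_neg fun h => h.2 h.1]
    · intro p q hpq hle
      have hle' : p.1.val ≤ q.1.val := hle
      simp only [G, Matrix.of_apply]
      rw [if_neg, Matrix.one_apply_ne hpq]
      rintro ⟨h1, h2⟩
      rw [h1, ZMod.val_zero, Nat.le_zero, ZMod.val_eq_zero] at hle'
      exact h2 hle'
  have hval : ∀ x : ZMod N, x + 1 ≠ 0 → (x + 1).val = x.val + 1 := by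
    intro x hx
    have h1 : x.val + 1 < N := by
      rcases Nat.lt_or_ge (x.val + 1) N with h | h
      · exact h
      · exfalso
        have h2 := x.val_lt
        refine hx ?_
        have h3 : ((x.val + 1 : ℕ) : ZMod N) = 0 := by
          rw [show x.val + 1 = N by omega]; simp
        simpa using h3
    rw [ZMod.val_add_of_lt] <;> rw [ZMod.val_one]
    exact h1
  have hentry : ∀ p q, ((1 - blockCyclic M) * G) p q =
      G p q - ∑ c, M p.1 p.2 c * G (p.1 + 1, c) q := by
    intro p q
    rw [sub_mul, one_mul, Matrix.sub_apply, Matrix.mul_apply, Fintype.sum_prod_type,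
      Finset.sum_eq_single (p.1 + 1)]
    · simp [blockCyclic]
    · intro y _ hy
      simp [blockCyclic, hy]
    · simp
  have hcol : ∀ (p : ZMod N × Fin k) (b : Fin k),
      ∑ c, M p.1 p.2 c * G (p.1 + 1, c) (0, b) = P p.1.val p.2 b := by
    intro p b
    rw [hPs _ p.1.val_lt, Matrix.mul_apply]
    refine Finset.sum_congr rfl fun c _ => ?_
    rw [ZMod.natCast_zmod_val]
    congr 1
    simp only [G, Matrix.of_apply]
    by_cases hx : p.1 + 1 = 0
    · have h1 : p.1.val + 1 = N := by
        have h2 := p.1.val_lt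
        by_contra hne
        have h3 : (p.1 + 1).val = p.1.val + 1 := by
          rw [ZMod.val_add_of_lt] <;> rw [ZMod.val_one]
          omega
        rw [hx, ZMod.val_zero] at h3
        omega
      rw [if_neg (fun h => h.2 hx), hx, h1, hP]
      simp [Matrix.one_apply]
    · rw [if_pos ⟨trivial, hx⟩, hval _ hx]
  have hU : (1 - blockCyclic M).det = ((1 - blockCyclic M) * G).det := by
    rw [Matrix.det_mul, hG, mul_one]
  rw [hU, Matrix.twoBlockTriangular_det _ fun p => p.1 = 0]
  · have h2 : (((1 - blockCyclic M) * G).toSquareBlockProp fun p => ¬p.1 = 0).det = 1 := by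
      refine det_eq_one_of_triangular _ (fun p => p.1.1.val) ?_ ?_
      · rintro ⟨p, hp⟩
        simp only [Matrix.toSquareBlockProp_def, Matrix.of_apply]
        rw [hentry, Finset.sum_eq_zero, sub_zero]
        · simp [G, hp]
        · intro c _
          have : (p.1 + 1, c) ≠ p := fun h => by simpa using congrArg Prod.fst h
          simp only [G, Matrix.of_apply]
          rw [if_neg (fun h => hp h.1), Matrix.one_apply_ne this, mul_zero]
      · rintro ⟨p, hp⟩ ⟨q, hq⟩ hpq hle
        have hpq' : p ≠ q := fun h => hpq (Subtype.ext h)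
        have hle' : q.1.val ≤ p.1.val := hle
        simp only [Matrix.toSquareBlockProp_def, Matrix.of_apply]
        rw [hentry, Finset.sum_eq_zero, sub_zero]
        · simp only [G, Matrix.of_apply]
          rw [if_neg (fun h => hq h.1), Matrix.one_apply_ne hpq']
        · intro c _
          have : (p.1 + 1, c) ≠ q := fun h => by
            have h1 : p.1 + 1 = q.1 := congrArg Prod.fst h
            have h2 := hval p.1 (h1 ▸ hq)
            rw [h1] at h2
            omega
          simp only [G, Matrix.of_apply]
          rw [if_neg (fun h => hq h.1), Matrix.one_apply_ne this, mul_zero]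
    rw [h2, mul_one]
    let e : Fin k ≃ {p : ZMod N × Fin k // p.1 = 0} :=
      { toFun := fun a => ⟨(0, a), rfl⟩
        invFun := fun p => p.1.2
        left_inv := fun a => rfl
        right_inv := fun p => Subtype.ext (Prod.ext p.2.symm rfl) }
    rw [← Matrix.det_submatrix_equiv_self e]
    congr 1
    ext a b
    simp only [Matrix.submatrix_apply, Matrix.toSquareBlockProp_def, Matrix.of_apply, e,
      Equiv.coe_fn_mk]
    rw [hentry, hcol]
    simp [G, Matrix.one_apply]
  · intro p hp q hq
    obtain ⟨y, b⟩ := q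
    obtain rfl : y = 0 := hq
    rw [hentry, hcol]
    simp [G, hp]

end BlockCyclic

end AztecStrip

namespace AztecStrip

open Equiv Equiv.Perm

/-! ### Simple cycles of the network wind once around the cylinder -/

section Winding

variable {n m : ℕ}

theorem edgeShift_eq {p q : V n m} (h : Edge p q) :
    q.1.1 = p.1.1 + (edgeShift p q : ℕ) := by
  unfold edgeShift
  rcases h with ⟨h1, h2⟩ | ⟨h1, h2⟩ | ⟨h1, h2⟩
  · rw [if_neg (by omega), h1, Nat.cast_one]
  · rw [if_pos h2, h1, Nat.cast_ofNat]
  · rw [if_neg (by omega), h1, Nat.cast_one]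

variable {C : Finset (V n m) × Perm (V n m)}

theorem IsSimpleCycle.isCyclicOn (hC : IsSimpleCycle C) : IsCyclicOn C :=
  ⟨hC.1, hC.2.1, hC.2.2.1⟩

/-- The row at time `x + 1` of a particle which follows the cycle `C` and is in row `b` at time `x`.
A particle in a white square is halfway on a horizontal edge. -/
def nextRow (C : Finset (V n m) × Perm (V n m)) (x : ZMod (2 * n)) (b : Fin m) : Fin m :=
  if h : Odd (x.val + (b : ℕ)) then (C.2 ⟨(x, b), h⟩).1.2 else b

theorem nextRow_of_mem (v : V n m) : nextRow C v.1.1 v.1.2 = (C.2 v).1.2 := by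
  rw [nextRow, dif_pos v.2]

theorem IsSimpleCycle.pow_mem (hC : IsSimpleCycle C) {v : V n m} (hv : v ∈ C.1) (t : ℕ) :
    (C.2 ^ t) v ∈ C.1 := by
  induction t with
  | zero => simpa using hv
  | succ t ih => rw [pow_succ', mul_apply]; exact hC.isCyclicOn.apply_mem ih

/-- The horizontal distance covered by the first `t` edges of a cycle from `v`. -/
def distance (C : Finset (V n m) × Perm (V n m)) (v : V n m) (t : ℕ) : ℕ :=
  ∑ s ∈ Finset.range t, edgeShift ((C.2 ^ s) v) ((C.2 ^ (s + 1)) v)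

theorem column_pow (hC : IsSimpleCycle C) {v : V n m} (hv : v ∈ C.1) (t : ℕ) :
    ((C.2 ^ t) v).1.1 = v.1.1 + (distance C v t : ℕ) := by
  induction t with
  | zero => simp [distance]
  | succ t ih =>
    have h := edgeShift_eq (hC.2.2.2 _ (hC.pow_mem hv t))
    rw [distance, Finset.sum_range_succ, Nat.cast_add, ← add_assoc, pow_succ', mul_apply, h]
    rw [ih]
    rfl

theorem sum_edgeShift_eq_distance (hC : IsSimpleCycle C) {v : V n m} (hv : v ∈ C.1) :
    ∑ u ∈ C.1, edgeShift u (C.2 u) = distance C v C.1.card := by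
  symm
  refine Finset.sum_bij (fun s _ => (C.2 ^ s) v) (fun s _ => hC.pow_mem hv s) ?_ ?_ ?_
  · intro s hs t ht hst
    have := (hC.2.1.pow_apply_eq_pow_apply hv).1 hst
    rwa [Nat.ModEq, Nat.mod_eq_of_lt (Finset.mem_range.1 hs),
      Nat.mod_eq_of_lt (Finset.mem_range.1 ht)] at this
  · intro u hu
    obtain ⟨s, hs, rfl⟩ := hC.2.1.exists_pow_eq hv hu
    exact ⟨s, Finset.mem_range.2 hs, rfl⟩
  · intro s _
    rw [pow_succ', mul_apply]

variable [NeZero n]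

theorem odd_val_add_one (x : ZMod (2 * n)) (b : ℕ) :
    Odd ((x + 1).val + b) ↔ ¬Odd (x.val + b) := by
  have hn : 0 < n := Nat.pos_of_ne_zero (NeZero.ne n)
  have : Fact (1 < 2 * n) := ⟨by omega⟩
  have h1 : (x + 1).val % 2 = (x.val + 1) % 2 := by
    rw [ZMod.val_add, ZMod.val_one, Nat.mod_mod_of_dvd _ ⟨n, rfl⟩]
  rw [Nat.odd_iff, Nat.odd_iff]
  omega

/-- The particle positions visited by the cycle `C`: its vertices, and the midpoints of its
horizontal edges. -/
def Visits (C : Finset (V n m) × Perm (V n m)) (x : ZMod (2 * n)) (b : Fin m) : Prop :=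
  (∃ h : Odd (x.val + (b : ℕ)), (⟨(x, b), h⟩ : V n m) ∈ C.1) ∨
    ∃ u ∈ C.1, u.1.1 + 1 = x ∧ u.1.2 = b ∧ (C.2 u).1 = (x + 1, b)

theorem Visits.nextRow (hC : IsSimpleCycle C) {x : ZMod (2 * n)} {b : Fin m} (h : Visits C x b) :
    Visits C (x + 1) (nextRow C x b) := by
  rcases h with ⟨ho, hu⟩ | ⟨u, hu, h1, h2, h3⟩
  · rw [AztecStrip.nextRow, dif_pos ho]
    have hmem := hC.isCyclicOn.apply_mem hu
    have hedge := hC.2.2.2 _ hu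
    have hcase : (C.2 ⟨(x, b), ho⟩).1.1 = x + 1 →
        Visits C (x + 1) (C.2 ⟨(x, b), ho⟩).1.2 := fun h => by
      left
      have ho' : Odd ((x + 1).val + ((C.2 ⟨(x, b), ho⟩).1.2 : ℕ)) := by
        have h' := (C.2 ⟨(x, b), ho⟩).2
        rwa [h] at h'
      have : (⟨(x + 1, (C.2 ⟨(x, b), ho⟩).1.2), ho'⟩ : V n m) = C.2 ⟨(x, b), ho⟩ :=
        Subtype.ext (Prod.ext h.symm rfl)
      exact ⟨ho', by rw [this]; exact hmem⟩
    rcases hedge with ⟨h1, h2⟩ | ⟨h1, h2⟩ | ⟨h1, h2⟩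
    · exact hcase h1
    · right
      refine ⟨_, hu, rfl, (Fin.ext h2).symm, Prod.ext ?_ rfl⟩
      rw [h1, add_assoc, one_add_one_eq_two]
    · exact hcase h1
  · have hw : ¬Odd (x.val + (b : ℕ)) := by
      rw [← h1, odd_val_add_one, not_not, ← h2]
      exact u.2
    rw [AztecStrip.nextRow, dif_neg hw]
    left
    have hmem := hC.isCyclicOn.apply_mem hu
    have ho := (C.2 u).2
    rw [h3] at ho
    have : (⟨(x + 1, b), ho⟩ : V n m) = C.2 u := Subtype.ext h3.symm
    exact ⟨ho, by rw [this]; exact hmem⟩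

theorem nextRow_injOn (hC : IsSimpleCycle C) {x : ZMod (2 * n)} {b b' : Fin m} (h : Visits C x b)
    (h' : Visits C x b') (heq : nextRow C x b = nextRow C x b') : b = b' := by
  have hw : ∀ {b : Fin m} {u : V n m}, u.1.1 + 1 = x → u.1.2 = b → ¬Odd (x.val + (b : ℕ)) := by
    intro b u h1 h2
    rw [← h1, odd_val_add_one, not_not, ← h2]
    exact u.2
  -- the step of a particle which lands on a black square
  have key : ∀ {b b' : Fin m} (ho : Odd (x.val + (b : ℕ))), (⟨(x, b), ho⟩ : V n m) ∈ C.1 →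
      ¬Odd (x.val + (b' : ℕ)) → (∃ u ∈ C.1, u.1.1 + 1 = x ∧ u.1.2 = b' ∧ (C.2 u).1 = (x + 1, b')) →
      nextRow C x b ≠ nextRow C x b' := by
    rintro b b' ho hu hw' ⟨u, hu', h1, h2, h3⟩ heq
    rw [nextRow, nextRow, dif_pos ho, dif_neg hw'] at heq
    have hbb : (b : ℕ) ≠ b' := fun h => hw' (h ▸ ho)
    have hcol : (C.2 ⟨(x, b), ho⟩).1.1 = x + 1 := by
      rcases hC.2.2.2 _ hu with ⟨h4, h5⟩ | ⟨h4, h5⟩ | ⟨h4, h5⟩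
      · exact h4
      · rw [heq] at h5
        exact absurd h5.symm hbb
      · exact h4
    have h6 : C.2 ⟨(x, b), ho⟩ = C.2 u := Subtype.ext (by rw [h3]; exact Prod.ext hcol heq)
    have h7 := congrArg (fun v : V n m => v.1.2) (C.2.injective h6)
    simp only [h2] at h7
    exact hbb (congrArg Fin.val h7)
  rcases h with ⟨ho, hu⟩ | ⟨u, hu, h1, h2, h3⟩ <;>
    rcases h' with ⟨ho', hu'⟩ | ⟨u', hu', h1', h2', h3'⟩
  · rw [nextRow, nextRow, dif_pos ho, dif_pos ho'] at heq
    have hodd : (b : ℕ) % 2 = b' % 2 := by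
      rw [Nat.odd_iff] at ho ho'; omega
    have hcol : (C.2 ⟨(x, b), ho⟩).1.1 = (C.2 ⟨(x, b'), ho'⟩).1.1 := by
      have e1 := hC.2.2.2 _ hu
      have e2 := hC.2.2.2 _ hu'
      simp only [Edge, ← heq] at e1 e2
      rcases e1 with ⟨h4, h5⟩ | ⟨h4, h5⟩ | ⟨h4, h5⟩ <;>
        rcases e2 with ⟨h6, h7⟩ | ⟨h6, h7⟩ | ⟨h6, h7⟩ <;>
        first
        | (exfalso; omega)
        | rw [h4, h6]
    have h6 : C.2 ⟨(x, b), ho⟩ = C.2 ⟨(x, b'), ho'⟩ := Subtype.ext (Prod.ext hcol heq)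
    simpa using C.2.injective h6
  · exact absurd heq (key ho hu (hw h1' h2') ⟨u', hu', h1', h2', h3'⟩)
  · exact absurd heq.symm (key ho' hu' (hw h1 h2) ⟨u, hu, h1, h2, h3⟩)
  · rw [nextRow, nextRow, dif_neg (hw h1 h2), dif_neg (hw h1' h2')] at heq
    exact heq

/-- The network is planar: particles which follow the same cycle stay in order. -/
theorem nextRow_strictMonoOn (hC : IsSimpleCycle C) {x : ZMod (2 * n)} {b b' : Fin m}
    (h : Visits C x b) (h' : Visits C x b') (hlt : b < b') : nextRow C x b < nextRow C x b' := by
  refine lt_of_le_of_ne ?_ fun heq => hlt.ne (nextRow_injOn hC h h' heq)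
  have key : ∀ b : Fin m, (¬Odd (x.val + (b : ℕ)) ∧ nextRow C x b = b) ∨
      (Odd (x.val + (b : ℕ)) ∧ ((nextRow C x b : ℕ) ≤ b + 1 ∧ (b : ℕ) ≤ nextRow C x b + 1)) := by
    intro b
    by_cases ho : Odd (x.val + (b : ℕ))
    · right
      refine ⟨ho, ?_⟩
      rw [nextRow, dif_pos ho]
      by_cases hu : (⟨(x, b), ho⟩ : V n m) ∈ C.1
      · rcases hC.2.2.2 _ hu with ⟨h4, h5⟩ | ⟨h4, h5⟩ | ⟨h4, h5⟩ <;> simp only at h5 <;> omega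
      · rw [hC.2.2.1 _ hu]
        simp only
        omega
    · left
      exact ⟨ho, by rw [nextRow, dif_neg ho]⟩
  rw [Fin.lt_def] at hlt
  rw [Fin.le_def]
  rcases key b with ⟨h1, h2⟩ | ⟨h1, h2, h3⟩ <;> rcases key b' with ⟨h1', h2'⟩ | ⟨h1', h2', h3'⟩
  · rw [h2, h2']; omega
  · rw [h2]; omega
  · rw [h2']; omega
  · rw [Nat.odd_iff] at h1 h1'; omega

/-- The row of a particle `k` steps after it has been in row `b` at time `x`. -/
def rowAfter (C : Finset (V n m) × Perm (V n m)) (x : ZMod (2 * n)) (b : Fin m) : ℕ → Fin m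
  | 0 => b
  | k + 1 => nextRow C (x + k) (rowAfter C x b k)

theorem Visits.rowAfter (hC : IsSimpleCycle C) {x : ZMod (2 * n)} {b : Fin m} (h : Visits C x b)
    (k : ℕ) : Visits C (x + k) (rowAfter C x b k) := by
  induction k with
  | zero =>
    rw [Nat.cast_zero, add_zero]
    exact h
  | succ k ih =>
    rw [Nat.cast_succ, ← add_assoc]
    exact ih.nextRow hC

theorem rowAfter_strictMonoOn (hC : IsSimpleCycle C) {x : ZMod (2 * n)} {b b' : Fin m}
    (h : Visits C x b) (h' : Visits C x b') (hlt : b < b') (k : ℕ) :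
    rowAfter C x b k < rowAfter C x b' k := by
  induction k with
  | zero => exact hlt
  | succ k ih => exact nextRow_strictMonoOn hC (h.rowAfter hC k) (h'.rowAfter hC k) ih

/-- After one turn around the cylinder every particle is back in its row, since a strictly monotone
map of a finite chain into itself is the identity. -/
theorem rowAfter_turn (hC : IsSimpleCycle C) {x : ZMod (2 * n)} {b : Fin m} (h : Visits C x b) :
    rowAfter C x b (2 * n) = b := by
  have hturn : ∀ b, Visits C x b → Visits C x (rowAfter C x b (2 * n)) := fun b hb => by
    have := hb.rowAfter hC (2 * n)
    rwa [ZMod.natCast_self, add_zero] at this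
  let F : {b // Visits C x b} → {b // Visits C x b} := fun b => ⟨_, hturn b.1 b.2⟩
  have hF : StrictMono F := fun b b' hlt => rowAfter_strictMonoOn hC b.2 b'.2 hlt _
  exact congrArg Subtype.val (le_antisymm (hF.apply_le (x := ⟨b, h⟩)) (hF.le_apply (x := ⟨b, h⟩)))

theorem rowAfter_distance (hC : IsSimpleCycle C) {v : V n m} (hv : v ∈ C.1) (t : ℕ) :
    rowAfter C v.1.1 v.1.2 (distance C v t) = ((C.2 ^ t) v).1.2 := by
  induction t with
  | zero => rfl
  | succ t ih =>
    have hcol := column_pow hC hv t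
    have hstep : rowAfter C v.1.1 v.1.2 (distance C v t + 1) = ((C.2 ^ (t + 1)) v).1.2 := by
      rw [rowAfter, ih, ← hcol, nextRow_of_mem, pow_succ', mul_apply]
    have hd : distance C v (t + 1) =
        distance C v t + edgeShift ((C.2 ^ t) v) ((C.2 ^ (t + 1)) v) := by
      rw [distance, Finset.sum_range_succ]; rfl
    rw [hd, edgeShift]
    split_ifs with hrow
    · change nextRow C (v.1.1 + (distance C v t + 1 : ℕ))
        (rowAfter C v.1.1 v.1.2 (distance C v t + 1)) = _
      rw [hstep, Nat.cast_add, Nat.cast_one,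
        ← add_assoc, ← hcol, nextRow, dif_neg]
      rw [odd_val_add_one, not_not, hrow]
      exact ((C.2 ^ t) v).2
    · exact hstep

/-- A simple cycle winds exactly once around the cylinder. -/
theorem sum_edgeShift (hC : IsSimpleCycle C) : ∑ u ∈ C.1, edgeShift u (C.2 u) = 2 * n := by
  obtain ⟨v, hv⟩ := hC.1
  rw [sum_edgeShift_eq_distance hC hv]
  have hn : 0 < n := Nat.pos_of_ne_zero (NeZero.ne n)
  have hT : 0 < C.1.card := Finset.card_pos.2 hC.1
  have hsucc : ∀ t, distance C v (t + 1) = distance C v t + 1 ∨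
      (distance C v (t + 1) = distance C v t + 2 ∧
        ((C.2 ^ (t + 1)) v).1.2 = ((C.2 ^ t) v).1.2) := by
    intro t
    have hd : distance C v (t + 1) =
        distance C v t + edgeShift ((C.2 ^ t) v) ((C.2 ^ (t + 1)) v) := by
      rw [distance, Finset.sum_range_succ]; rfl
    rw [hd, edgeShift]
    split_ifs with hrow
    · exact Or.inr ⟨rfl, Fin.ext hrow⟩
    · exact Or.inl rfl
  have hmono : StrictMono (distance C v) := strictMono_nat_of_lt_succ fun t => by
    rcases hsucc t with h | h <;> omega
  have h0 : distance C v 0 = 0 := rfl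
  have hvis : Visits C v.1.1 v.1.2 := Or.inl ⟨v.2, hv⟩
  have hcycle : (C.2 ^ C.1.card) v = v := hC.2.1.pow_card_apply hv
  have hge : 2 * n ≤ distance C v C.1.card := by
    have h1 := column_pow hC hv C.1.card
    rw [hcycle, left_eq_add, ZMod.natCast_eq_zero_iff] at h1
    exact Nat.le_of_dvd (h0 ▸ hmono hT) h1
  -- the first vertex at distance at least one turn
  obtain ⟨t, ht, hmin⟩ : ∃ t, 2 * n ≤ distance C v (t + 1) ∧ distance C v t < 2 * n := by
    have hex : ∃ t, 2 * n ≤ distance C v t := ⟨_, hge⟩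
    classical
    have h1 := Nat.find_spec hex
    have h2 : Nat.find hex ≠ 0 := fun h => by rw [h, h0] at h1; omega
    obtain ⟨t, ht⟩ := Nat.exists_eq_succ_of_ne_zero h2
    rw [ht] at h1
    refine ⟨t, h1, ?_⟩
    have := Nat.find_min hex (m := t) (by omega)
    omega
  have hturn := rowAfter_turn hC hvis
  by_cases heq : distance C v (t + 1) = 2 * n
  · have h1 := column_pow hC hv (t + 1)
    have h2 := rowAfter_distance hC hv (t + 1)
    rw [heq, ZMod.natCast_self, add_zero] at h1
    rw [heq, hturn] at h2
    have h3 : (C.2 ^ (t + 1)) v = v := Subtype.ext (Prod.ext h1 h2.symm)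
    have h4 : C.1.card ≤ t + 1 := Nat.le_of_dvd (by omega) ((hC.2.1.pow_apply_eq hv).1 h3)
    have h5 := hmono.monotone h4
    omega
  · -- a horizontal edge over the starting point would have its start in a white square
    exfalso
    rcases hsucc t with h | ⟨h, hrow⟩
    · omega
    · have h1 := column_pow hC hv t
      have h2 := rowAfter_distance hC hv t
      have h3 : distance C v t + 1 = 2 * n := by omega
      have h4 : rowAfter C v.1.1 v.1.2 (2 * n) = ((C.2 ^ t) v).1.2 := by
        rw [← congrArg (rowAfter C v.1.1 v.1.2) h3, rowAfter, h2, ← h1, nextRow_of_mem, ← hrow,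
          pow_succ', mul_apply]
      rw [hturn] at h4
      have h5 : v.1.1 = ((C.2 ^ t) v).1.1 + 1 := by
        rw [h1, add_assoc, ← Nat.cast_one, ← Nat.cast_add, h3, ZMod.natCast_self, add_zero]
      have h6 := v.2
      rw [h4, h5, odd_val_add_one] at h6
      exact h6 ((C.2 ^ t) v).2

theorem cycleWind_eq_one (hC : IsSimpleCycle C) : cycleWind C = 1 := by
  have hn : 0 < n := Nat.pos_of_ne_zero (NeZero.ne n)
  rw [cycleWind, sum_edgeShift hC, Nat.div_self (by omega)]

end Winding

end AztecStrip

namespace AztecStrip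

open Equiv Equiv.Perm Polynomial
open scoped Classical

/-! ### The polynomial `Q` as a characteristic polynomial -/

section Network

variable {n m : ℕ}

/-- The one-column transfer matrix: the entry at `(b, b')` is the weight of the step of a particle
from row `b` at time `x - 1` to row `b'` at time `x`.  The weight of a horizontal edge is attributed
to its first half. -/
noncomputable def colMat (n m : ℕ) (x : ZMod (2 * n)) : Matrix (Fin m) (Fin m) (K n m) :=
  Matrix.of fun b b' =>
    if Odd (x.val + (b : ℕ)) then if b' = b then 1 else 0
    else if (b' : ℕ) = b + 1 then w n m (x + 1) ((b' : ℕ) + 1) / w n m x (b' : ℕ)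
    else if b' = b then
      w n m (x + 1 + 1) ((b : ℕ) + 1) * w n m (x + 1 + 1) (b : ℕ) /
        (w n m (x + 1) (b : ℕ) * w n m (x + 1) ((b : ℕ) + 1))
    else if (b' : ℕ) + 1 = b then w n m (x + 1) (b' : ℕ) / w n m x ((b' : ℕ) + 1)
    else 0

/-- The product of the transfer matrices of `l` consecutive columns from column `x` on. -/
noncomputable def colProd (n m : ℕ) : ZMod (2 * n) → ℕ → Matrix (Fin m) (Fin m) (K n m)
  | _, 0 => 1
  | x, l + 1 => colMat n m x * colProd n m (x + 1) l

/-- The weighted adjacency matrix of the network, in which the power of `X` records the horizontal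
displacement. -/
noncomputable def networkMat (n m : ℕ) : Matrix (V n m) (V n m) (K n m)[X] :=
  Matrix.of fun p q => if Edge p q then C (edgeWeight p q) * X ^ edgeShift p q else 0

theorem w_ne_zero (x : ZMod (2 * n)) (y : ℤ) : w n m x y ≠ 0 := by
  rw [w]
  split_ifs with h
  · rw [Ne, FaithfulSMul.algebraMap_eq_zero_iff]
    exact MvPolynomial.X_ne_zero _
  · exact one_ne_zero

/-- The matrix is triangular for an order of the rows which separates the colours. -/
theorem det_colMat_ne_zero (x : ZMod (2 * n)) : (colMat n m x).det ≠ 0 := by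
  rw [det_eq_prod_of_triangular _ fun b : Fin m => if Odd (x.val + (b : ℕ)) then 1 else 0]
  · refine Finset.prod_ne_zero_iff.2 fun b _ => ?_
    simp only [colMat, Matrix.of_apply, if_true]
    split_ifs
    · exact one_ne_zero
    · omega
    · simp [w_ne_zero]
  · intro b b' hne hle
    simp only [colMat, Matrix.of_apply]
    by_cases h : Odd (x.val + (b : ℕ))
    · rw [if_pos h, if_neg hne.symm]
    · rw [if_neg h] at hle ⊢
      have h' : ¬Odd (x.val + (b' : ℕ)) := fun h' => by simp [h'] at hle
      rw [Nat.odd_iff] at h h'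
      rw [if_neg (by omega), if_neg hne.symm, if_neg (by omega)]

theorem det_colProd_ne_zero (x : ZMod (2 * n)) (l : ℕ) : (colProd n m x l).det ≠ 0 := by
  induction l generalizing x with
  | zero => simp [colProd]
  | succ l ih => rw [colProd, Matrix.det_mul]; exact mul_ne_zero (det_colMat_ne_zero x) (ih _)

variable [NeZero n]

theorem prod_networkMat {Cy : Finset (V n m) × Perm (V n m)} (hC : IsCyclicOn Cy) :
    ∏ v ∈ Cy.1, networkMat n m v (Cy.2 v) =
      if IsSimpleCycle Cy then C (cycleWeight Cy) * X ^ (2 * n) else 0 := by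
  split_ifs with h
  · rw [← sum_edgeShift h, ← Finset.prod_pow_eq_pow_sum, cycleWeight, map_prod,
      ← Finset.prod_mul_distrib]
    refine Finset.prod_congr rfl fun v hv => ?_
    rw [networkMat, Matrix.of_apply, if_pos (h.2.2.2 v hv)]
  · obtain ⟨v, hv, hne⟩ : ∃ v ∈ Cy.1, ¬Edge v (Cy.2 v) := by
      by_contra! hc
      exact h ⟨hC.1, hC.2.1, hC.2.2, hc⟩
    refine Finset.prod_eq_zero hv ?_
    rw [networkMat, Matrix.of_apply, if_neg hne]

theorem mem_rCycles {r : ℕ} {A : Finset (Finset (V n m) × Perm (V n m))} :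
    A ∈ rCycles n m r ↔ IsCycleFamily A ∧ (∀ C ∈ A, IsSimpleCycle C) ∧ A.card = r := by
  simp only [rCycles, simpleCycles, Finset.mem_filter, Finset.mem_powersetCard, IsCycleFamily]
  constructor
  · rintro ⟨⟨h1, h2⟩, h3⟩
    have h4 : ∀ C ∈ A, IsSimpleCycle C := fun C hC => by simpa using h1 hC
    exact ⟨⟨fun C hC => (h4 C hC).isCyclicOn, h3⟩, h4, h2⟩
  · rintro ⟨⟨_, h1⟩, h2, h3⟩
    exact ⟨⟨fun C hC => by simpa using h2 C hC, h3⟩, h1⟩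

theorem rCycles_eq_empty {r : ℕ} (hr : (simpleCycles n m).card < r) : rCycles n m r = ∅ := by
  rw [rCycles, Finset.powersetCard_eq_empty.2 hr, Finset.filter_empty]

/-- Families with a cycle which does not follow the edges contribute nothing, and the displacement
of an `r`-cycle is `2 * n * r`. -/
theorem det_one_sub_networkMat : (1 - networkMat n m).det =
    ∑ r ∈ Finset.range ((simpleCycles n m).card + 1),
      C ((-1) ^ r * H n m r) * (X ^ (2 * n)) ^ r := by
  rw [det_one_sub_eq_sum_cycleFamilies (networkMat n m) (Finset.univ.filter IsCycleFamily)
    (fun A => by simp)]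
  have h1 : ∀ r, C ((-1) ^ r * H n m r) * (X ^ (2 * n)) ^ r =
      ∑ A ∈ rCycles n m r,
        (-1) ^ A.card * ∏ Cy ∈ A, ∏ v ∈ Cy.1, networkMat n m v (Cy.2 v) := by
    intro r
    rw [H, Finset.mul_sum, map_sum, Finset.sum_mul]
    refine Finset.sum_congr rfl fun A hA => ?_
    obtain ⟨hA1, hA2, rfl⟩ := mem_rCycles.1 hA
    have h2 : ∏ Cy ∈ A, ∏ v ∈ Cy.1, networkMat n m v (Cy.2 v) =
        ∏ Cy ∈ A, C (cycleWeight Cy) * X ^ (2 * n) := Finset.prod_congr rfl fun Cy hCy => by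
      rw [prod_networkMat (hA1.1 Cy hCy), if_pos (hA2 Cy hCy)]
    rw [h2, Finset.prod_mul_distrib, Finset.prod_const, map_mul, map_prod]
    simp only [map_pow, map_neg, map_one]
    ring
  simp only [h1]
  rw [← Finset.sum_biUnion]
  · symm
    refine Finset.sum_subset_zero_on_sdiff ?_ ?_ fun _ _ => rfl
    · intro A hA
      obtain ⟨r, -, hr⟩ := Finset.mem_biUnion.1 hA
      simpa using (mem_rCycles.1 hr).1
    · intro A hA
      rw [Finset.mem_sdiff] at hA
      have hfam : IsCycleFamily A := by simpa using hA.1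
      obtain ⟨Cy, hCy, hns⟩ : ∃ Cy ∈ A, ¬IsSimpleCycle Cy := by
        by_contra! hc
        have hmem : A ∈ rCycles n m A.card := mem_rCycles.2 ⟨hfam, hc, rfl⟩
        refine hA.2 (Finset.mem_biUnion.2 ⟨A.card, ?_, hmem⟩)
        rw [Finset.mem_range, Nat.lt_succ_iff]
        by_contra! hlt
        rw [rCycles_eq_empty hlt] at hmem
        simp at hmem
      rw [Finset.prod_eq_zero hCy, mul_zero]
      rw [prod_networkMat (hfam.1 Cy hCy), if_neg hns]
  · intro r _ s _ hrs
    rw [Function.onFun, Finset.disjoint_left]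
    intro A hA hA'
    exact hrs ((mem_rCycles.1 hA).2.2.symm.trans (mem_rCycles.1 hA').2.2)

/-- Splitting every horizontal edge at its midpoint does not change the determinant: a Schur
complement. -/
theorem det_one_sub_networkMat_eq_blockCyclic : (1 - networkMat n m).det =
    (1 - blockCyclic fun x : ZMod (2 * n) => (X : (K n m)[X]) • (colMat n m (x + 1)).map C).det := by
  set D := blockCyclic fun x : ZMod (2 * n) => (X : (K n m)[X]) • (colMat n m (x + 1)).map C with hD
  let p : ZMod (2 * n) × Fin m → Prop := fun s => Odd (s.1.val + (s.2 : ℕ))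
  have hww : ∀ s t, ¬p s → ¬p t → D s t = 0 := by
    intro s t hs ht
    simp only [p] at hs ht
    simp only [hD, blockCyclic, Matrix.of_apply]
    split_ifs with h
    · have h1 : Odd ((s.1 + 1).val + (s.2 : ℕ)) := (odd_val_add_one _ _).2 hs
      have h2 : t.2 ≠ s.2 := fun h2 => ht (by rw [h, h2]; exact h1)
      simp [colMat, h1, h2]
    · rfl
  have hwb : ∀ s t, ¬p s → D s t = if t = (s.1 + 1, s.2) then X else 0 := by
    intro s t hs
    have h1 : Odd ((s.1 + 1).val + (s.2 : ℕ)) := (odd_val_add_one _ _).2 hs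
    simp only [hD, blockCyclic, Matrix.of_apply, Matrix.smul_apply, Matrix.map_apply, colMat, h1,
      if_true, smul_eq_mul, Prod.ext_iff]
    by_cases h2 : t.1 = s.1 + 1 <;> by_cases h3 : t.2 = s.2 <;> simp [h2, h3]
  rw [Matrix.det_toBlock (1 - D) p]
  have h22 : (1 - D).toBlock (fun s => ¬p s) (fun s => ¬p s) = 1 := by
    ext s t
    rw [Matrix.toBlock_apply, Matrix.sub_apply, hww _ _ s.2 t.2, sub_zero, Matrix.one_apply,
      Matrix.one_apply]
    simp [Subtype.ext_iff]
  rw [h22, Matrix.det_fromBlocks_one₂₂]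
  congr 1
  ext q t : 1
  obtain ⟨⟨x, b⟩, hq⟩ := q
  obtain ⟨⟨y, b'⟩, ht⟩ := t
  have hw : ¬Odd ((x + 1).val + (b : ℕ)) := by rw [odd_val_add_one, not_not]; exact hq
  have hmid : ¬p (x + 1, b) := hw
  have hD1 : D (x, b) (x + 1, b) = X * C (w n m (x + 1 + 1 + 1) ((b : ℕ) + 1) *
      w n m (x + 1 + 1 + 1) (b : ℕ) /
        (w n m (x + 1 + 1) (b : ℕ) * w n m (x + 1 + 1) ((b : ℕ) + 1))) := by
    simp [hD, blockCyclic, colMat, hw]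
  have hne : ∀ s : ZMod (2 * n) × Fin m, ¬p s → (1 : Matrix _ _ (K n m)[X]) (x, b) s = 0 :=
    fun s hs => Matrix.one_apply_ne fun h => hs (h ▸ hq)
  have hne' : ∀ s : ZMod (2 * n) × Fin m, ¬p s → (1 : Matrix _ _ (K n m)[X]) s (y, b') = 0 :=
    fun s hs => Matrix.one_apply_ne fun h => hs (h ▸ ht)
  have hsum : ((1 - D).toBlock p (fun s => ¬p s) * (1 - D).toBlock (fun s => ¬p s) p)
      ⟨(x, b), hq⟩ ⟨(y, b'), ht⟩ = D (x, b) (x + 1, b) * D (x + 1, b) (y, b') := by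
    rw [Matrix.mul_apply, Finset.sum_eq_single ⟨(x + 1, b), hmid⟩]
    · simp only [Matrix.toBlock_apply, Matrix.sub_apply, hne _ hmid, hne' _ hmid]
      ring
    · rintro ⟨⟨z, c⟩, hz⟩ _ hzc
      simp only [Matrix.toBlock_apply, Matrix.sub_apply, hne _ hz]
      suffices D (x, b) (z, c) = 0 by rw [this]; ring
      simp only [hD, blockCyclic, Matrix.of_apply]
      split_ifs with h
      · subst h
        have h1 : c ≠ b := fun h => hzc (by simp [h])
        have h2 : ¬Odd ((x + 1).val + (c : ℕ)) := hz
        simp only [Matrix.smul_apply, Matrix.map_apply, colMat, Matrix.of_apply, hw, h1, if_false]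
        rw [Nat.odd_iff] at hw h2
        rw [if_neg (by omega), if_neg (by omega), map_zero, smul_zero]
      · rfl
    · simp
  rw [Matrix.sub_apply, Matrix.sub_apply, hsum, Matrix.toBlock_apply, Matrix.sub_apply, sub_sub]
  congr 1
  · simp [Matrix.one_apply, Subtype.ext_iff]
  · have hy : y = x + 1 → b' ≠ b := by
      rintro rfl rfl
      exact hw ht
    rw [hD1, hwb _ _ hmid]
    simp only [networkMat, Matrix.of_apply, hD, blockCyclic, Matrix.smul_apply,
      Matrix.map_apply, colMat, hw, if_false, smul_eq_mul, Edge, edgeWeight, edgeShift,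
      Prod.mk.injEq]
    have h11 : x + 2 = x + 1 + 1 := by rw [add_assoc, one_add_one_eq_two]
    rcases lt_trichotomy (b' : ℕ) b with hb | hb | hb
    · have h1 : b' ≠ b := fun h => by simp [h] at hb
      have h1' : (b' : ℕ) ≠ b + 1 := by omega
      by_cases h3 : y = x + 1 <;> by_cases h2 : (b' : ℕ) + 1 = b <;>
        simp only [h1, h1', hb.ne, h2, h3, and_true, and_false, and_self, or_false, or_true,
          if_true, if_false, mul_zero, add_zero, map_zero, pow_one] <;> ring
    · obtain rfl : b' = b := Fin.ext hb
      have h3 : y ≠ x + 1 := fun h => hy h rfl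
      have h1 : ¬(b' : ℕ) = b' + 1 := by omega
      have h1' : ¬(b' : ℕ) + 1 = b' := by omega
      by_cases h4 : y = x + 1 + 1
      · subst h4
        simp only [h1, h1', h3, h11, and_self, or_false, false_or,
          if_true, if_false, zero_add]
        ring
      · simp only [h1, h1', h3, h4, h11, and_true, and_false, or_false,
          if_false, zero_add, mul_zero]
    · have h1 : b' ≠ b := fun h => by simp [h] at hb
      have h1' : (b' : ℕ) + 1 ≠ b := by omega
      have h4 : (b : ℕ) + 1 ≠ b := by omega
      have h5 : (b : ℕ) + 1 + 1 ≠ b := by omega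
      by_cases h3 : y = x + 1 <;> by_cases h2 : (b' : ℕ) = b + 1 <;>
        simp only [h1, h1', hb.ne', h2, h3, h4, h5, and_true, and_false, and_self, or_false,
          if_true, if_false, mul_zero, add_zero, map_zero, pow_one] <;> ring

theorem charpolyRev_colProd : (colProd n m 1 (2 * n)).charpolyRev =
    ∑ r ∈ Finset.range ((simpleCycles n m).card + 1), C ((-1) ^ r * H n m r) * X ^ r := by
  have hn : 0 < n := Nat.pos_of_ne_zero (NeZero.ne n)
  apply Polynomial.expand_injective (n := 2 * n) (by omega)
  rw [map_sum]
  simp only [map_mul, map_pow, expand_C, expand_X]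
  have h := det_one_sub_networkMat (n := n) (m := m)
  simp only [map_mul, map_pow] at h
  rw [← h, det_one_sub_networkMat_eq_blockCyclic, det_one_sub_blockCyclic (by omega) _
    fun x => (X : (K n m)[X]) ^ (2 * n - x) • (colProd n m ((x : ZMod (2 * n)) + 1) (2 * n - x)).map C]
  · rw [Matrix.charpolyRev, ← AlgHom.coe_toRingHom, RingHom.map_det]
    congr 1
    ext i j : 1
    simp [Matrix.one_apply, apply_ite]
  · simp [colProd]
  · intro x hx
    obtain ⟨l, hl⟩ : ∃ l, 2 * n - x = l + 1 := ⟨2 * n - x - 1, by omega⟩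
    rw [show 2 * n - (x + 1) = l by omega, hl, colProd, pow_succ', Matrix.map_mul,
      Matrix.smul_mul, Matrix.mul_smul, smul_smul, Nat.cast_succ]

/-- Half of the squares are black: the translation by one column exchanges the colours. -/
theorem card_V : Fintype.card (V n m) = n * m := by
  let e : {s : ZMod (2 * n) × Fin m // ¬Odd (s.1.val + (s.2 : ℕ))} ≃ V n m :=
    { toFun := fun s => ⟨(s.1.1 + 1, s.1.2), (odd_val_add_one _ _).2 s.2⟩
      invFun := fun s => ⟨(s.1.1 - 1, s.1.2), by
        have := s.2
        rw [← sub_add_cancel s.1.1 1, odd_val_add_one] at this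
        exact this⟩
      left_inv := fun s => by simp
      right_inv := fun s => by simp }
  have h1 := Fintype.card_congr e
  rw [Fintype.card_subtype_compl, Fintype.card_prod, ZMod.card, Fintype.card_fin] at h1
  have h2 : Fintype.card (V n m) ≤ Fintype.card (ZMod (2 * n) × Fin m) := Fintype.card_subtype_le _
  rw [Fintype.card_prod, ZMod.card, Fintype.card_fin] at h2
  have h3 : 2 * n * m - Fintype.card (V n m) = Fintype.card (V n m) := h1
  rw [mul_assoc] at h2 h3
  omega

theorem H_eq_coeff_charpoly {r : ℕ} (hr : r ≤ m) :
    (colProd n m 1 (2 * n)).charpoly.coeff (m - r) = (-1) ^ r * H n m r := by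
  have hnd := (colProd n m 1 (2 * n)).charpoly_natDegree_eq_dim
  have hrev : (colProd n m 1 (2 * n)).charpoly.coeff (m - r) =
      (colProd n m 1 (2 * n)).charpoly.reverse.coeff r := by
    rw [Fintype.card_fin] at hnd
    simp [Polynomial.coeff_reverse, hnd, hr]
  rw [hrev, Matrix.reverse_charpoly, charpolyRev_colProd, finsetSum_coeff]
  simp only [coeff_C_mul, coeff_X_pow, mul_ite, mul_one, mul_zero]
  rw [Finset.sum_ite_eq]
  split_ifs with h
  · rfl
  · rw [H, rCycles_eq_empty (by simpa using h), Finset.sum_empty, mul_zero]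

theorem sum_cycleWind {r : ℕ} {A : Finset (Finset (V n m) × Perm (V n m))}
    (hA : A ∈ rCycles n m r) : ∑ C ∈ A, cycleWind C = r := by
  obtain ⟨-, h1, rfl⟩ := mem_rCycles.1 hA
  rw [Finset.sum_congr rfl fun C hC => cycleWind_eq_one (h1 C hC)]
  simp

/-- The winding number of an `r`-cycle is `r`; there is an `m`-cycle, as `H m` is up to sign the
determinant of the monodromy. -/
theorem maxWind_eq : maxWind n m = m := by
  have hn : 0 < n := Nat.pos_of_ne_zero (NeZero.ne n)
  apply le_antisymm
  · refine Finset.sup_le fun r _ => Finset.sup_le fun A hA => ?_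
    rw [sum_cycleWind hA]
    obtain ⟨hfam, h1, rfl⟩ := mem_rCycles.1 hA
    have hdis : (A : Set (Finset (V n m) × Perm (V n m))).PairwiseDisjoint Prod.fst :=
      fun C hC D hD hne => hfam.2 C hC D hD hne
    -- the total displacement is `2n` for each cycle, and at most `2` for each vertex
    have h2 : A.card * (2 * n) ≤ 2 * (n * m) := by
      calc A.card * (2 * n) = ∑ C ∈ A, ∑ v ∈ C.1, edgeShift v (C.2 v) := by
            rw [Finset.sum_congr rfl fun C hC => sum_edgeShift (h1 C hC)]
            simp
        _ ≤ ∑ C ∈ A, ∑ v ∈ C.1, 2 := by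
            refine Finset.sum_le_sum fun C _ => Finset.sum_le_sum fun v _ => ?_
            rw [edgeShift]; split_ifs <;> omega
        _ = ∑ v ∈ A.biUnion Prod.fst, 2 := (Finset.sum_biUnion hdis).symm
        _ ≤ 2 * (n * m) := by
            rw [Finset.sum_const, smul_eq_mul, mul_comm, ← card_V (n := n) (m := m)]
            exact Nat.mul_le_mul_left _ (Finset.card_le_univ (α := V n m) _)
    have h3 : A.card * (2 * n) ≤ m * (2 * n) := h2.trans (le_of_eq (by ring))
    exact Nat.le_of_mul_le_mul_right h3 (by omega)
  · have hH : H n m m ≠ 0 := by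
      intro h0
      have h1 := H_eq_coeff_charpoly (n := n) (le_refl m)
      rw [h0, mul_zero, Nat.sub_self] at h1
      have h2 := (colProd n m 1 (2 * n)).det_eq_sign_charpoly_coeff
      rw [h1, mul_zero] at h2
      exact det_colProd_ne_zero 1 (2 * n) h2
    obtain ⟨A, hA⟩ : (rCycles n m m).Nonempty := by
      rw [Finset.nonempty_iff_ne_empty]
      intro h
      rw [H, h, Finset.sum_empty] at hH
      exact hH rfl
    have hmem : m ∈ Finset.range ((simpleCycles n m).card + 1) := by
      rw [Finset.mem_range]
      by_contra! hlt
      rw [rCycles_eq_empty hlt] at hA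
      simp at hA
    have h1 := Finset.le_sup (f := fun A => ∑ C ∈ A, cycleWind C) hA
    rw [sum_cycleWind hA] at h1
    exact h1.trans (Finset.le_sup (f := fun r => (rCycles n m r).sup fun A => ∑ C ∈ A, cycleWind C)
      hmem)

theorem Q_eq_charpoly : Q n m = (colProd n m 1 (2 * n)).charpoly := by
  rw [Q, maxWind_eq, Polynomial.as_sum_range_C_mul_X_pow (colProd n m 1 (2 * n)).charpoly,
    Matrix.charpoly_natDegree_eq_dim, Fintype.card_fin, ← Finset.sum_range_reflect]
  refine Finset.sum_congr rfl fun r hr => ?_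
  have hr' : r ≤ m := Nat.lt_succ_iff.1 (Finset.mem_range.1 hr)
  rw [show m + 1 - 1 - r = m - r by omega, ← H_eq_coeff_charpoly (Nat.sub_le m r),
    show m - (m - r) = r by omega]

end Network

end AztecStrip

namespace AztecStrip

/-! ### Domino tilings as a dimer model -/

section Dimer

variable {F : Type*} [Field F]

/-- The dimer partition function of a set `R` of squares, for the domino weights `c`. -/
def dimer (c : Finset (ℤ × ℤ) → F) (R : Finset (ℤ × ℤ)) : F :=
  ∑ T ∈ tilings R, ∏ D ∈ T, c D

/-- The four squares which share a side with a square. -/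
def nbrs (s : ℤ × ℤ) : Finset (ℤ × ℤ) :=
  {(s.1 + 1, s.2), (s.1 - 1, s.2), (s.1, s.2 + 1), (s.1, s.2 - 1)}

theorem mem_dominoes {R D : Finset (ℤ × ℤ)} : D ∈ dominoes R ↔
    ∃ s ∈ R, ∃ s' ∈ R, (s' = (s.1 + 1, s.2) ∨ s' = (s.1, s.2 + 1)) ∧ D = {s, s'} := by
  simp only [dominoes, Finset.mem_filter, Finset.mem_powersetCard]
  constructor
  · rintro ⟨⟨hD, _⟩, s, hs, rfl | rfl⟩
    · exact ⟨s, hs, _, hD (by simp), Or.inl rfl, rfl⟩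
    · exact ⟨s, hs, _, hD (by simp), Or.inr rfl, rfl⟩
  · rintro ⟨s, hs, s', hs', h, rfl⟩
    refine ⟨⟨?_, ?_⟩, s, hs, ?_⟩
    · intro x hx
      rcases Finset.mem_insert.1 hx with rfl | hx
      · exact hs
      · rw [Finset.mem_singleton.1 hx]; exact hs'
    · refine Finset.card_pair ?_
      rcases h with rfl | rfl <;> simp [Prod.ext_iff]
    · rcases h with rfl | rfl <;> simp

theorem pair_mem_dominoes {R : Finset (ℤ × ℤ)} {s s' : ℤ × ℤ} (hs : s ∈ R) (hs' : s' ∈ R)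
    (h : s' ∈ nbrs s) : ({s, s'} : Finset (ℤ × ℤ)) ∈ dominoes R := by
  rw [mem_dominoes]
  simp only [nbrs, Finset.mem_insert, Finset.mem_singleton] at h
  rcases h with rfl | rfl | rfl | rfl
  · exact ⟨s, hs, _, hs', Or.inl rfl, rfl⟩
  · exact ⟨_, hs', s, hs, Or.inl (by simp), Finset.pair_comm _ _⟩
  · exact ⟨s, hs, _, hs', Or.inr rfl, rfl⟩
  · exact ⟨_, hs', s, hs, Or.inr (by simp), Finset.pair_comm _ _⟩

theorem exists_eq_pair_of_mem_dominoes {R D : Finset (ℤ × ℤ)} {s : ℤ × ℤ} (hD : D ∈ dominoes R)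
    (hs : s ∈ D) : ∃ s' ∈ nbrs s ∩ R, D = {s, s'} := by
  obtain ⟨a, ha, b, hb, h, rfl⟩ := mem_dominoes.1 hD
  rcases Finset.mem_insert.1 hs with rfl | hs
  · refine ⟨b, Finset.mem_inter.2 ⟨?_, hb⟩, rfl⟩
    rcases h with rfl | rfl <;> simp [nbrs]
  · rw [Finset.mem_singleton] at hs
    subst hs
    refine ⟨a, Finset.mem_inter.2 ⟨?_, ha⟩, Finset.pair_comm _ _⟩
    rcases h with rfl | rfl <;> simp [nbrs]

theorem mem_tilings {R : Finset (ℤ × ℤ)} {T : Finset (Finset (ℤ × ℤ))} : T ∈ tilings R ↔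
    (∀ D ∈ T, D ∈ dominoes R) ∧ ∀ s ∈ R, ∃! D, D ∈ T ∧ s ∈ D := by
  simp only [tilings, Finset.mem_filter, Finset.mem_powerset, Finset.subset_iff]
  refine and_congr_right fun _ => forall₂_congr fun s _ => ?_
  rw [Finset.card_eq_one]
  simp only [Finset.eq_singleton_iff_unique_mem, Finset.mem_filter, ExistsUnique]

theorem subset_of_mem_dominoes {R D : Finset (ℤ × ℤ)} (h : D ∈ dominoes R) : D ⊆ R :=
  (Finset.mem_powersetCard.1 (Finset.mem_filter.1 h).1).1

theorem card_of_mem_dominoes {R D : Finset (ℤ × ℤ)} (h : D ∈ dominoes R) : D.card = 2 :=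
  (Finset.mem_powersetCard.1 (Finset.mem_filter.1 h).1).2

theorem dominoes_mono {R R' : Finset (ℤ × ℤ)} (h : R ⊆ R') : dominoes R ⊆ dominoes R' := by
  intro D hD
  obtain ⟨s, hs, s', hs', h1, rfl⟩ := mem_dominoes.1 hD
  exact mem_dominoes.2 ⟨s, h hs, s', h hs', h1, rfl⟩

theorem insert_mem_tilings {R : Finset (ℤ × ℤ)} {s s' : ℤ × ℤ} (hs : s ∈ R)
    (hs' : s' ∈ nbrs s ∩ R) {T : Finset (Finset (ℤ × ℤ))} (hT : T ∈ tilings (R \ {s, s'})) :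
    insert {s, s'} T ∈ tilings R ∧ ({s, s'} : Finset (ℤ × ℤ)) ∉ T := by
  rw [Finset.mem_inter] at hs'
  obtain ⟨h1, h2⟩ := mem_tilings.1 hT
  have hdis : ∀ D ∈ T, ∀ x ∈ D, x ∉ ({s, s'} : Finset (ℤ × ℤ)) := fun D hD x hx =>
    (Finset.mem_sdiff.1 (subset_of_mem_dominoes (h1 D hD) hx)).2
  refine ⟨mem_tilings.2 ⟨?_, ?_⟩, fun h => hdis _ h s (by simp) (by simp)⟩
  · intro D hD
    rcases Finset.mem_insert.1 hD with rfl | hD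
    · exact pair_mem_dominoes hs hs'.2 hs'.1
    · exact dominoes_mono Finset.sdiff_subset (h1 D hD)
  · intro x hx
    by_cases hxp : x ∈ ({s, s'} : Finset (ℤ × ℤ))
    · refine ⟨{s, s'}, ⟨Finset.mem_insert_self _ _, hxp⟩, ?_⟩
      rintro D ⟨hD, hxD⟩
      rcases Finset.mem_insert.1 hD with rfl | hD
      · rfl
      · exact absurd hxp (hdis D hD x hxD)
    · obtain ⟨D, ⟨hD, hxD⟩, hu⟩ := h2 x (Finset.mem_sdiff.2 ⟨hx, hxp⟩)
      refine ⟨D, ⟨Finset.mem_insert_of_mem hD, hxD⟩, ?_⟩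
      rintro D' ⟨hD', hxD'⟩
      rcases Finset.mem_insert.1 hD' with rfl | hD'
      · exact absurd hxD' hxp
      · exact hu D' ⟨hD', hxD'⟩

theorem erase_mem_tilings {R D : Finset (ℤ × ℤ)} {T : Finset (Finset (ℤ × ℤ))}
    (hT : T ∈ tilings R) (hD : D ∈ T) : T.erase D ∈ tilings (R \ D) := by
  obtain ⟨h1, h2⟩ := mem_tilings.1 hT
  have hdis : ∀ D' ∈ T.erase D, ∀ x ∈ D', x ∉ D := by
    intro D' hD' x hx hxD
    rw [Finset.mem_erase] at hD'
    exact hD'.1 ((h2 x (subset_of_mem_dominoes (h1 D hD) hxD)).unique ⟨hD'.2, hx⟩ ⟨hD, hxD⟩)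
  refine mem_tilings.2 ⟨fun D' hD' => ?_, fun x hx => ?_⟩
  · obtain ⟨a, ha, b, hb, h, hab⟩ := mem_dominoes.1 (h1 D' (Finset.mem_of_mem_erase hD'))
    refine mem_dominoes.2 ⟨a, Finset.mem_sdiff.2 ⟨ha, hdis D' hD' a ?_⟩, b,
      Finset.mem_sdiff.2 ⟨hb, hdis D' hD' b ?_⟩, h, hab⟩ <;> simp [hab]
  · rw [Finset.mem_sdiff] at hx
    obtain ⟨D', ⟨hD', hxD'⟩, hu⟩ := h2 x hx.1
    refine ⟨D', ⟨Finset.mem_erase.2 ⟨fun h => hx.2 (h ▸ hxD'), hD'⟩, hxD'⟩, ?_⟩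
    rintro D'' ⟨hD'', hxD''⟩
    exact hu D'' ⟨Finset.mem_of_mem_erase hD'', hxD''⟩

/-- Expansion of the partition function along the domino which covers a given square. -/
theorem dimer_expand (c : Finset (ℤ × ℤ) → F) {R : Finset (ℤ × ℤ)} {s : ℤ × ℤ} (hs : s ∈ R) :
    dimer c R = ∑ s' ∈ nbrs s ∩ R, c {s, s'} * dimer c (R \ {s, s'}) := by
  simp only [dimer, Finset.mul_sum]
  rw [Finset.sum_sigma']
  symm
  have hpair : ∀ {a b : ℤ × ℤ}, a ∈ nbrs s → ({s, a} : Finset (ℤ × ℤ)) = {s, b} → a = b := by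
    intro a b ha h
    have h1 : a ∈ ({s, b} : Finset (ℤ × ℤ)) := h ▸ by simp
    rcases Finset.mem_insert.1 h1 with rfl | h1
    · simp only [nbrs, Finset.mem_insert, Finset.mem_singleton, Prod.ext_iff] at ha
      omega
    · exact Finset.mem_singleton.1 h1
  refine Finset.sum_bij (fun p _ => insert {s, p.1} p.2) ?_ ?_ ?_ ?_
  · rintro ⟨s', T⟩ hp
    rw [Finset.mem_sigma] at hp
    exact (insert_mem_tilings hs hp.1 hp.2).1
  · rintro ⟨a, T⟩ hp ⟨b, T'⟩ hp' h
    rw [Finset.mem_sigma] at hp hp'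
    simp only at hp hp' h
    have h1 := insert_mem_tilings hs hp.1 hp.2
    have h2 := insert_mem_tilings hs hp'.1 hp'.2
    have h3 : ({s, a} : Finset (ℤ × ℤ)) = {s, b} :=
      ((mem_tilings.1 h1.1).2 s hs).unique ⟨Finset.mem_insert_self _ _, by simp⟩
        ⟨h ▸ Finset.mem_insert_self _ _, by simp⟩
    obtain rfl := hpair (Finset.mem_inter.1 hp.1).1 h3
    have h4 : T = T' := by
      rw [← Finset.erase_insert h1.2, h, Finset.erase_insert h2.2]
    rw [h4]
  · intro T hT
    obtain ⟨D, ⟨hD, hsD⟩, -⟩ := (mem_tilings.1 hT).2 s hs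
    obtain ⟨s', hs', rfl⟩ := exists_eq_pair_of_mem_dominoes ((mem_tilings.1 hT).1 D hD) hsD
    exact ⟨⟨s', T.erase {s, s'}⟩, Finset.mem_sigma.2 ⟨hs', erase_mem_tilings hT hD⟩,
      Finset.insert_erase hD⟩
  · rintro ⟨s', T⟩ hp
    rw [Finset.mem_sigma] at hp
    rw [Finset.prod_insert (insert_mem_tilings hs hp.1 hp.2).2]

theorem pairwiseDisjoint_of_mem_tilings {R : Finset (ℤ × ℤ)} {T : Finset (Finset (ℤ × ℤ))}
    (hT : T ∈ tilings R) : (T : Set (Finset (ℤ × ℤ))).PairwiseDisjoint id := by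
  intro D hD D' hD' hne
  obtain ⟨h1, h2⟩ := mem_tilings.1 hT
  rw [Function.onFun, Finset.disjoint_left]
  intro x hx hx'
  exact hne ((h2 x (subset_of_mem_dominoes (h1 D hD) hx)).unique ⟨hD, hx⟩ ⟨hD', hx'⟩)

theorem biUnion_of_mem_tilings {R : Finset (ℤ × ℤ)} {T : Finset (Finset (ℤ × ℤ))}
    (hT : T ∈ tilings R) : T.biUnion id = R := by
  obtain ⟨h1, h2⟩ := mem_tilings.1 hT
  ext x
  rw [Finset.mem_biUnion]
  constructor
  · rintro ⟨D, hD, hx⟩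
    exact subset_of_mem_dominoes (h1 D hD) hx
  · intro hx
    obtain ⟨D, ⟨hD, hxD⟩, -⟩ := h2 x hx
    exact ⟨D, hD, hxD⟩

/-- The colour of a square: `1` for the black squares, `-1` for the white ones. -/
def colour (s : ℤ × ℤ) : ℤ := if Odd (s.1 + s.2) then 1 else -1

/-- Only regions with as many black as white squares have domino tilings. -/
theorem sum_colour_eq_zero {c : Finset (ℤ × ℤ) → F} {R : Finset (ℤ × ℤ)} (h : dimer c R ≠ 0) :
    ∑ s ∈ R, colour s = 0 := by
  obtain ⟨T, hT, -⟩ := Finset.exists_ne_zero_of_sum_ne_zero h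
  rw [← biUnion_of_mem_tilings hT, Finset.sum_biUnion (pairwiseDisjoint_of_mem_tilings hT)]
  refine Finset.sum_eq_zero fun D hD => ?_
  obtain ⟨a, ha, b, hb, h, rfl⟩ := mem_dominoes.1 ((mem_tilings.1 hT).1 D hD)
  have hne : a ≠ b := by rcases h with rfl | rfl <;> simp [Prod.ext_iff]
  rw [id, Finset.sum_pair hne, colour, colour]
  simp only [Int.odd_iff]
  rcases h with rfl | rfl <;> simp only <;> split_ifs <;> omega

/-- The vertices of a square. -/
def corners (s : ℤ × ℤ) : Finset (ℤ × ℤ) :=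
  {s, (s.1 + 1, s.2), (s.1, s.2 + 1), (s.1 + 1, s.2 + 1)}

/-- The midpoints of the two long sides of a domino. -/
def midpoints (D : Finset (ℤ × ℤ)) : Finset (ℤ × ℤ) :=
  (D.biUnion corners).filter fun v => D ⊆ around v

theorem mem_around {s v : ℤ × ℤ} : s ∈ around v ↔ v ∈ corners s := by
  simp only [around, corners, Finset.mem_insert, Finset.mem_singleton, Prod.ext_iff]
  omega

theorem mem_midpoints {D : Finset (ℤ × ℤ)} (hD : D.Nonempty) {v : ℤ × ℤ} :
    v ∈ midpoints D ↔ D ⊆ around v := by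
  rw [midpoints, Finset.mem_filter, and_iff_right_iff_imp]
  intro h
  obtain ⟨s, hs⟩ := hD
  exact Finset.mem_biUnion.2 ⟨s, hs, mem_around.1 (h hs)⟩

/-- The weight of a domino in terms of vertex weights `W`: the product of the weights of the two
right vertices of its black square, divided by those of the midpoints of its long sides. -/
def dominoWeight (W : ℤ × ℤ → F) (D : Finset (ℤ × ℤ)) : F :=
  (∏ s ∈ D.filter fun s => Odd (s.1 + s.2), W (s.1 + 1, s.2) * W (s.1 + 1, s.2 + 1)) *
    (∏ v ∈ midpoints D, W v)⁻¹

theorem midpoints_horizontal (x y : ℤ) :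
    midpoints {(x, y), (x + 1, y)} = {(x + 1, y), (x + 1, y + 1)} := by
  ext v
  rw [mem_midpoints (by simp)]
  simp only [Finset.insert_subset_iff, Finset.singleton_subset_iff, mem_around, corners,
    Finset.mem_insert, Finset.mem_singleton, Prod.ext_iff]
  omega

theorem midpoints_vertical (x y : ℤ) :
    midpoints {(x, y), (x, y + 1)} = {(x, y + 1), (x + 1, y + 1)} := by
  ext v
  rw [mem_midpoints (by simp)]
  simp only [Finset.insert_subset_iff, Finset.singleton_subset_iff, mem_around, corners,
    Finset.mem_insert, Finset.mem_singleton, Prod.ext_iff]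
  omega

variable {W : ℤ × ℤ → F} {x y : ℤ}

theorem dominoWeight_horizontal_of_odd (hW : ∀ v, W v ≠ 0) (h : Odd (x + y)) :
    dominoWeight W {(x, y), (x + 1, y)} = 1 := by
  have h' : ¬Odd (x + 1 + y) := by rw [Int.odd_iff] at h ⊢; omega
  rw [dominoWeight, midpoints_horizontal, Finset.filter_insert, if_pos h, Finset.filter_singleton,
    if_neg h', insert_empty_eq, Finset.prod_singleton, Finset.prod_pair (by simp)]
  exact mul_inv_cancel₀ (mul_ne_zero (hW _) (hW _))

theorem dominoWeight_horizontal_of_even (h : ¬Odd (x + y)) :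
    dominoWeight W {(x, y), (x + 1, y)} =
      W (x + 1 + 1, y + 1) * W (x + 1 + 1, y) / (W (x + 1, y) * W (x + 1, y + 1)) := by
  have h' : Odd (x + 1 + y) := by rw [Int.odd_iff] at h ⊢; omega
  rw [dominoWeight, midpoints_horizontal, Finset.filter_insert, if_neg h, Finset.filter_singleton,
    if_pos h', Finset.prod_singleton, Finset.prod_pair (by simp), div_eq_mul_inv,
    mul_comm (W (x + 1 + 1, y))]

theorem dominoWeight_vertical_of_odd (hW : ∀ v, W v ≠ 0) (h : Odd (x + y)) :
    dominoWeight W {(x, y), (x, y + 1)} = W (x + 1, y) / W (x, y + 1) := by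
  have h' : ¬Odd (x + (y + 1)) := by rw [Int.odd_iff] at h ⊢; omega
  rw [dominoWeight, midpoints_vertical, Finset.filter_insert, if_pos h, Finset.filter_singleton,
    if_neg h', insert_empty_eq, Finset.prod_singleton, Finset.prod_pair (by simp)]
  have := hW (x + 1, y + 1)
  have := hW (x, y + 1)
  field_simp

theorem dominoWeight_vertical_of_even (hW : ∀ v, W v ≠ 0) (h : ¬Odd (x + y)) :
    dominoWeight W {(x, y), (x, y + 1)} = W (x + 1, y + 1 + 1) / W (x, y + 1) := by
  have h' : Odd (x + (y + 1)) := by rw [Int.odd_iff] at h ⊢; omega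
  rw [dominoWeight, midpoints_vertical, Finset.filter_insert, if_neg h, Finset.filter_singleton,
    if_pos h', Finset.prod_singleton, Finset.prod_pair (by simp)]
  have := hW (x + 1, y + 1)
  have := hW (x, y + 1)
  field_simp

end Dimer

section Weights

variable {n m : ℕ}

/-- The vertex weights of a region: `w` in its interior and `1` elsewhere. -/
noncomputable def interiorWeight (n m : ℕ) (R : Finset (ℤ × ℤ)) (v : ℤ × ℤ) : K n m :=
  if around v ⊆ R then w n m (v.1 : ZMod (2 * n)) v.2 else 1

theorem interiorWeight_ne_zero (R : Finset (ℤ × ℤ)) (v : ℤ × ℤ) : interiorWeight n m R v ≠ 0 := by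
  rw [interiorWeight]
  split_ifs
  · exact w_ne_zero _ _
  · exact one_ne_zero

theorem mem_interiorPoints {R : Finset (ℤ × ℤ)} {v : ℤ × ℤ} :
    v ∈ interiorPoints R ↔ around v ⊆ R := by
  rw [interiorPoints, Finset.mem_filter, and_iff_right_iff_imp]
  exact fun h => h (by simp [around])

/-- Every interior point is a right vertex of exactly one black square. -/
theorem prod_black_interiorWeight (R : Finset (ℤ × ℤ)) :
    ∏ s ∈ R.filter (fun s => Odd (s.1 + s.2)),
      interiorWeight n m R (s.1 + 1, s.2) * interiorWeight n m R (s.1 + 1, s.2 + 1) =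
    ∏ v ∈ interiorPoints R, w n m (v.1 : ZMod (2 * n)) v.2 := by
  have key : ∀ e : ℤ, (e = 0 ∨ e = 1) → ∏ s ∈ R.filter (fun s => Odd (s.1 + s.2)),
      interiorWeight n m R (s.1 + 1, s.2 + e) =
      ∏ v ∈ (interiorPoints R).filter (fun v => Odd (v.1 - 1 + (v.2 - e))),
        w n m (v.1 : ZMod (2 * n)) v.2 := by
    intro e he
    simp only [interiorWeight]
    rw [← Finset.prod_filter]
    refine Finset.prod_bij (fun s _ => (s.1 + 1, s.2 + e)) ?_ ?_ ?_ fun _ _ => rfl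
    · intro s hs
      simp only [Finset.mem_filter] at hs ⊢
      exact ⟨mem_interiorPoints.2 hs.2, by simpa using hs.1.2⟩
    · intro s _ t _ h
      simp only [Prod.ext_iff, add_left_inj] at h
      exact Prod.ext h.1 h.2
    · intro v hv
      simp only [Finset.mem_filter] at hv
      have hv' := mem_interiorPoints.1 hv.1
      refine ⟨(v.1 - 1, v.2 - e), ?_, by simp⟩
      simp only [Finset.mem_filter, sub_add_cancel]
      refine ⟨⟨hv' ?_, hv.2⟩, hv'⟩
      rcases he with rfl | rfl <;> simp [around]
  rw [Finset.prod_mul_distrib]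
  have h0 := key 0 (Or.inl rfl)
  simp only [add_zero, sub_zero] at h0
  rw [h0, key 1 (Or.inr rfl),
    ← Finset.prod_filter_mul_prod_filter_not (interiorPoints R) fun v => Odd (v.1 - 1 + v.2)]
  congr 1
  refine Finset.prod_congr (Finset.filter_congr fun v _ => ?_) fun _ _ => rfl
  rw [Int.odd_iff, Int.odd_iff]
  omega

theorem card_around (v : ℤ × ℤ) : (around v).card = 4 := by
  rw [around, Finset.card_insert_of_notMem, Finset.card_insert_of_notMem,
    Finset.card_insert_of_notMem, Finset.card_singleton] <;>
    simp only [Finset.mem_insert, Finset.mem_singleton, Prod.ext_iff] <;> omega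

/-- A domino of a tiling has no, one or two of the four squares around an interior point. -/
theorem adjacentDominoes_add_card {R : Finset (ℤ × ℤ)} {T : Finset (Finset (ℤ × ℤ))}
    (hT : T ∈ tilings R) {v : ℤ × ℤ} (hv : around v ⊆ R) :
    adjacentDominoes T v + (T.filter fun D => D ⊆ around v).card = 4 := by
  rw [adjacentDominoes, Finset.card_filter, Finset.card_filter, ← Finset.sum_add_distrib]
  have h1 : ∀ D ∈ T, ((if (D ∩ around v).Nonempty then 1 else 0) +
      if D ⊆ around v then 1 else 0) = ∑ s ∈ D, if s ∈ around v then 1 else 0 := by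
    intro D hD
    have hcard := card_of_mem_dominoes ((mem_tilings.1 hT).1 D hD)
    rw [← Finset.card_filter, Finset.filter_mem_eq_inter]
    by_cases hsub : D ⊆ around v
    · rw [Finset.inter_eq_left.2 hsub, hcard, if_pos hsub, if_pos]
      exact Finset.card_pos.1 (by omega)
    · rw [if_neg hsub]
      have hlt : (D ∩ around v).card < 2 := by
        rw [← hcard]
        refine Finset.card_lt_card (Finset.ssubset_iff_subset_ne.2 ⟨Finset.inter_subset_left, ?_⟩)
        exact fun h => hsub (Finset.inter_eq_left.1 h)
      split_ifs with hne
      · have := Finset.card_pos.2 hne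
        omega
      · rw [Finset.not_nonempty_iff_eq_empty.1 hne]
        rfl
  rw [Finset.sum_congr rfl h1]
  have h2 := Finset.sum_biUnion (f := fun s => if s ∈ around v then 1 else 0)
    (pairwiseDisjoint_of_mem_tilings hT)
  rw [biUnion_of_mem_tilings hT] at h2
  refine h2.symm.trans ?_
  rw [← Finset.card_filter, Finset.filter_mem_eq_inter, Finset.inter_eq_right.2 hv, card_around]

/-- The exponent `ε` of an interior point is `1` minus the number of dominoes of which it is the
midpoint of a long side. -/
theorem tilingWeight_eq {R : Finset (ℤ × ℤ)} {T : Finset (Finset (ℤ × ℤ))} (hT : T ∈ tilings R) :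
    tilingWeight n m R T = ∏ D ∈ T, dominoWeight (interiorWeight n m R) D := by
  simp only [dominoWeight]
  rw [Finset.prod_mul_distrib]
  have h1 : ∏ D ∈ T, ∏ s ∈ D.filter (fun s => Odd (s.1 + s.2)),
      interiorWeight n m R (s.1 + 1, s.2) * interiorWeight n m R (s.1 + 1, s.2 + 1) =
      ∏ v ∈ interiorPoints R, w n m (v.1 : ZMod (2 * n)) v.2 := by
    rw [← prod_black_interiorWeight, Finset.prod_filter]
    conv_rhs => rw [← biUnion_of_mem_tilings hT]
    rw [Finset.prod_biUnion (pairwiseDisjoint_of_mem_tilings hT)]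
    refine Finset.prod_congr rfl fun D _ => ?_
    rw [Finset.prod_filter, biUnion_of_mem_tilings hT]
    rfl
  have h2 : ∏ D ∈ T, (∏ v ∈ midpoints D, interiorWeight n m R v)⁻¹ =
      ∏ v ∈ interiorPoints R,
        (w n m (v.1 : ZMod (2 * n)) v.2 ^ (T.filter fun D => D ⊆ around v).card)⁻¹ := by
    rw [Finset.prod_inv_distrib, Finset.prod_inv_distrib]
    congr 1
    have h3 : ∀ D ∈ T, ∏ v ∈ midpoints D, interiorWeight n m R v =
        ∏ v ∈ interiorPoints R, if D ⊆ around v then w n m (v.1 : ZMod (2 * n)) v.2 else 1 := by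
      intro D hD
      have hne : D.Nonempty := Finset.card_pos.1 (by
        rw [card_of_mem_dominoes ((mem_tilings.1 hT).1 D hD)]; omega)
      simp only [interiorWeight]
      rw [← Finset.prod_filter, ← Finset.prod_filter]
      refine Finset.prod_congr ?_ fun _ _ => rfl
      ext v
      rw [Finset.mem_filter, Finset.mem_filter, mem_midpoints hne, mem_interiorPoints, and_comm]
    rw [Finset.prod_congr rfl h3, Finset.prod_comm]
    refine Finset.prod_congr rfl fun v _ => ?_
    rw [← Finset.prod_filter, Finset.prod_const]
  rw [h1, h2, ← Finset.prod_mul_distrib, tilingWeight]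
  refine Finset.prod_congr rfl fun v hv => ?_
  have h4 := adjacentDominoes_add_card hT (mem_interiorPoints.1 hv)
  rw [show ((adjacentDominoes T v : ℤ) - 3) =
    1 - ((T.filter fun D => D ⊆ around v).card : ℤ) by omega, zpow_sub₀ (w_ne_zero _ _), zpow_one,
    zpow_natCast, div_eq_mul_inv]

theorem Z_eq_dimer (i j ℓ : ℤ) : Z n m i j ℓ =
    dimer (dominoWeight (interiorWeight n m (region m i j ℓ))) (region m i j ℓ) :=
  Finset.sum_congr rfl fun _ hT => tilingWeight_eq hT

end Weights

end AztecStrip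

namespace AztecStrip

open Module Set.powersetCard

/-! ### Sweeping a region square by square -/

section Sweep

variable {F : Type*} [Field F] {m r : ℕ}

/-- The heights of the rows in a set of rows. -/
def rows (S : Finset (Fin m)) : Finset ℤ := S.image fun i : Fin m => ((i : ℕ) : ℤ)

theorem mem_rows {S : Finset (Fin m)} (i : Fin m) : ((i : ℕ) : ℤ) ∈ rows S ↔ i ∈ S := by
  rw [rows, Finset.mem_image]
  constructor
  · rintro ⟨j, hj, h⟩
    rwa [← Fin.ext (Int.ofNat_inj.1 h)]
  · exact fun h => ⟨i, h, rfl⟩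

/-- The squares of `R` which are left over when the squares before `(x, k)`, in the order by columns,
have been covered.  The frontier consists of the squares `(x + 1, b)` with `b < k` and `(x, b)` with
`k ≤ b`; a black square of the frontier is left over if there is no particle in its row, and a white
one if there is a particle in its row. -/
def remaining (R : Finset (ℤ × ℤ)) (x : ℤ) (k : ℕ) (S : Finset (Fin m)) : Finset (ℤ × ℤ) :=
  R.filter fun s => x + 1 < s.1 ∨ (s.1 = x + 1 ∧ (k : ℤ) ≤ s.2) ∨
    ((s.1 = x ∧ (k : ℤ) ≤ s.2 ∨ s.1 = x + 1 ∧ s.2 < k) ∧ (Odd (s.1 + s.2) ↔ s.2 ∉ rows S))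

variable {R : Finset (ℤ × ℤ)} {x : ℤ} {k : ℕ} {S S' : Finset (Fin m)}

theorem mem_remaining_frontier (h : (x, (k : ℤ)) ∈ R) :
    (x, (k : ℤ)) ∈ remaining R x k S ↔ (Odd (x + k) ↔ (k : ℤ) ∉ rows S) := by
  simp [remaining, h]

theorem remaining_succ_of_notMem (h : (x, (k : ℤ)) ∉ remaining R x k S) (hR : (x, (k : ℤ)) ∈ R) :
    remaining R x k S = remaining R x (k + 1) S := by
  rw [mem_remaining_frontier hR, Int.odd_iff] at h
  refine Finset.filter_congr fun s _ => ?_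
  obtain ⟨a, b⟩ := s
  simp only [Int.odd_iff, Nat.cast_succ]
  by_cases hb : b = k
  · subst hb
    by_cases hS : (k : ℤ) ∈ rows S <;> simp only [hS, not_true, not_false_iff, iff_true, iff_false] at h ⊢ <;> grind
  · by_cases hS : b ∈ rows S <;> simp only [hS, not_true, not_false_iff, iff_true, iff_false] <;> omega

/-- Covering the square `(x, k)` by a horizontal domino leaves the particles in their rows. -/
theorem remaining_sdiff_horizontal (h : (x, (k : ℤ)) ∈ remaining R x k S) (hR : (x, (k : ℤ)) ∈ R) :
    remaining R x k S \ {(x, (k : ℤ)), (x + 1, (k : ℤ))} = remaining R x (k + 1) S := by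
  rw [mem_remaining_frontier hR, Int.odd_iff] at h
  ext ⟨a, b⟩
  simp only [remaining, Finset.mem_sdiff, Finset.mem_filter, Finset.mem_insert,
    Finset.mem_singleton, Prod.ext_iff, and_assoc, Int.odd_iff, Nat.cast_succ]
  refine and_congr_right fun _ => ?_
  by_cases hb : b = k
  · subst hb
    by_cases hS : (k : ℤ) ∈ rows S <;> simp only [hS, not_true, not_false_iff, iff_true, iff_false] at h ⊢ <;> grind
  · by_cases hS : b ∈ rows S <;> simp only [hS, not_true, not_false_iff, iff_true, iff_false] <;> omega

/-- A vertical domino moves a particle between the rows `k` and `k + 1`. -/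
theorem remaining_sdiff_vertical (h : (x, (k : ℤ)) ∈ remaining R x k S)
    (h' : (x, (k : ℤ) + 1) ∈ remaining R x k S)
    (hk : (k : ℤ) ∈ rows S' ↔ (k : ℤ) ∉ rows S) (hk' : (k : ℤ) + 1 ∈ rows S' ↔ (k : ℤ) + 1 ∉ rows S)
    (hS : ∀ b : ℤ, b ≠ k → b ≠ k + 1 → (b ∈ rows S' ↔ b ∈ rows S)) :
    remaining R x k S \ {(x, (k : ℤ)), (x, (k : ℤ) + 1)} = remaining R x (k + 1) S' := by
  simp only [remaining, Finset.mem_filter, Int.odd_iff] at h h'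
  ext ⟨a, b⟩
  simp only [remaining, Finset.mem_sdiff, Finset.mem_filter, Finset.mem_insert,
    Finset.mem_singleton, Prod.ext_iff, and_assoc, Int.odd_iff, Nat.cast_succ]
  refine and_congr_right fun _ => ?_
  by_cases hb : b = k
  · subst hb
    rw [hk]
    by_cases hS : (k : ℤ) ∈ rows S <;> simp only [hS, not_true, not_false_iff, iff_true, iff_false] at h ⊢ <;> grind
  by_cases hb' : b = k + 1
  · subst hb'
    rw [hk']
    by_cases hS : (k : ℤ) + 1 ∈ rows S <;> simp only [hS, not_true, not_false_iff, iff_true, iff_false] at h' ⊢ <;> grind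
  rw [hS b hb hb']
  by_cases hS : b ∈ rows S <;> simp only [hS, not_true, not_false_iff, iff_true, iff_false] <;> omega

theorem nbrs_inter_remaining (h : (x + 1, (k : ℤ)) ∈ R) :
    nbrs (x, (k : ℤ)) ∩ remaining R x k S =
      insert (x + 1, (k : ℤ)) ((remaining R x k S).filter fun s => s = (x, (k : ℤ) + 1)) := by
  ext ⟨a, b⟩
  simp only [nbrs, remaining, Finset.mem_inter, Finset.mem_filter, Finset.mem_insert,
    Finset.mem_singleton, Prod.mk.injEq]
  constructor
  · rintro ⟨h1, hR, h2⟩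
    rcases h1 with h1 | h1 | h1 | h1
    · exact Or.inl h1
    · omega
    · exact Or.inr ⟨⟨hR, h2⟩, h1⟩
    · omega
  · rintro (⟨rfl, rfl⟩ | ⟨⟨hR, h2⟩, h1⟩)
    · exact ⟨Or.inl ⟨rfl, rfl⟩, h, Or.inr (Or.inl ⟨rfl, le_rfl⟩)⟩
    · exact ⟨Or.inr (Or.inr (Or.inl h1)), hR, h2⟩

theorem remaining_column_end (hstrip : ∀ s ∈ R, 0 ≤ s.2 ∧ s.2 < m) :
    remaining R x m S = remaining R (x + 1) 0 S := by
  refine Finset.filter_congr fun s hs => ?_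
  have h1 := hstrip s hs
  by_cases hS : s.2 ∈ rows S <;>
    simp only [hS, not_true, not_false_iff, iff_true, iff_false, Nat.cast_zero, Int.odd_iff] <;> omega

variable (c : Finset (ℤ × ℤ) → F)

theorem dimer_remaining_of_notMem_up (hR : (x, (k : ℤ)) ∈ R) (hR' : (x + 1, (k : ℤ)) ∈ R)
    (h : (x, (k : ℤ)) ∈ remaining R x k S) (h' : (x, (k : ℤ) + 1) ∉ remaining R x k S) :
    dimer c (remaining R x k S) =
      c {(x, (k : ℤ)), (x + 1, (k : ℤ))} * dimer c (remaining R x (k + 1) S) := by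
  rw [dimer_expand c h, nbrs_inter_remaining hR', Finset.filter_eq', if_neg h', insert_empty_eq,
    Finset.sum_singleton, remaining_sdiff_horizontal h hR]

theorem dimer_remaining_of_mem_up (hR : (x, (k : ℤ)) ∈ R) (hR' : (x + 1, (k : ℤ)) ∈ R)
    (h : (x, (k : ℤ)) ∈ remaining R x k S) (h' : (x, (k : ℤ) + 1) ∈ remaining R x k S)
    (hk : (k : ℤ) ∈ rows S' ↔ (k : ℤ) ∉ rows S) (hk' : (k : ℤ) + 1 ∈ rows S' ↔ (k : ℤ) + 1 ∉ rows S)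
    (hS : ∀ b : ℤ, b ≠ k → b ≠ k + 1 → (b ∈ rows S' ↔ b ∈ rows S)) :
    dimer c (remaining R x k S) =
      c {(x, (k : ℤ)), (x + 1, (k : ℤ))} * dimer c (remaining R x (k + 1) S) +
      c {(x, (k : ℤ)), (x, (k : ℤ) + 1)} * dimer c (remaining R x (k + 1) S') := by
  rw [dimer_expand c h, nbrs_inter_remaining hR', Finset.filter_eq', if_pos h',
    Finset.sum_pair (by simp), remaining_sdiff_horizontal h hR,
    remaining_sdiff_vertical h h' hk hk' hS]

/-- The standard basis vector of a row, or zero if there is no such row. -/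
def rowVec (F : Type*) [Field F] (m b : ℕ) : Fin m → F := fun i => if (i : ℕ) = b then 1 else 0

theorem rowVec_eq_single (i : Fin m) : rowVec F m i = Pi.single i 1 := by
  ext j
  simp [rowVec, Pi.single_apply, Fin.ext_iff]

theorem rowVec_eq_zero {b : ℕ} (h : m ≤ b) : rowVec F m b = 0 := by
  ext j
  rw [rowVec, if_neg (by omega)]
  rfl

/-- The one-particle operator of the square in row `k` of a column whose black squares are in the
rows `p`.  Particles in white squares may move up with weight `v`, and stay with weight `h`, at their
own square; they may move down with weight `d` at the square below. -/
noncomputable def squareMap (m : ℕ) (p : ℕ → Prop) [DecidablePred p] (h v d : ℕ → F) (k : ℕ) :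
    (Fin m → F) →ₗ[F] (Fin m → F) :=
  (Pi.basisFun F (Fin m)).constr F fun i =>
    if p i then rowVec F m i
    else if (i : ℕ) = k then h i • rowVec F m i + v i • rowVec F m (i + 1)
    else if (i : ℕ) = k + 1 then rowVec F m i + d i • rowVec F m k
    else rowVec F m i

theorem squareMap_single (p : ℕ → Prop) [DecidablePred p] (h v d : ℕ → F) (i : Fin m) :
    squareMap m p h v d k (Pi.single i 1) =
      if p i then rowVec F m i
      else if (i : ℕ) = k then h i • rowVec F m i + v i • rowVec F m (i + 1)
      else if (i : ℕ) = k + 1 then rowVec F m i + d i • rowVec F m k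
      else rowVec F m i := by
  rw [squareMap, ← Pi.basisFun_apply, Basis.constr_basis]

/-- The partition functions of the remaining regions, as a linear form on the `r`-particle space. -/
noncomputable def sweepForm (r : ℕ) (m : ℕ) (c : Finset (ℤ × ℤ) → F) (R : Finset (ℤ × ℤ)) (x : ℤ)
    (k : ℕ) : ⋀[F]^r (Fin m → F) →ₗ[F] F :=
  ((Pi.basisFun F (Fin m)).exteriorPower r).constr F fun S => dimer c (remaining R x k S.1)

theorem sweepForm_wedge (S : Set.powersetCard (Fin m) r) :
    sweepForm r m c R x k (wedge F S) = dimer c (remaining R x k S.1) := by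
  rw [sweepForm, wedge, Basis.constr_basis]

/-- Sweeping one square acts on the `r`-particle space as the exterior power of a one-particle
operator. -/
theorem sweepForm_square {p : ℕ → Prop} [DecidablePred p] {h v d : ℕ → F}
    (hp : ∀ b : ℕ, p b ↔ Odd (x + b)) (hk : k < m)
    (hstrip : ∀ s ∈ R, 0 ≤ s.2 ∧ s.2 < m) (hR : ∀ b : ℕ, b < m → (x, (b : ℤ)) ∈ R)
    (hR' : (x + 1, (k : ℤ)) ∈ R)
    (c1 : p k → c {(x, (k : ℤ)), (x + 1, (k : ℤ))} = 1)
    (c2 : ¬p k → c {(x, (k : ℤ)), (x + 1, (k : ℤ))} = h k)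
    (c3 : p k → c {(x, (k : ℤ)), (x, (k : ℤ) + 1)} = d (k + 1))
    (c4 : ¬p k → c {(x, (k : ℤ)), (x, (k : ℤ) + 1)} = v k) :
    sweepForm r m c R x k =
      sweepForm r m c R x (k + 1) ∘ₗ exteriorPower.map r (squareMap m p h v d k) := by
  refine ((Pi.basisFun F (Fin m)).exteriorPower r).ext fun S => ?_
  change sweepForm r m c R x k (wedge F S) =
    sweepForm r m c R x (k + 1) (exteriorPower.map r (squareMap m p h v d k) (wedge F S))
  rw [sweepForm_wedge]
  have hpk : p (k + 1) ↔ ¬p k := by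
    rw [hp, hp, Int.odd_iff, Int.odd_iff]; push_cast; omega
  have hRk := hR k hk
  have hmem : (x, (k : ℤ)) ∈ remaining R x k S.1 ↔ (p k ↔ (⟨k, hk⟩ : Fin m) ∉ S.1) := by
    rw [mem_remaining_frontier hRk, hp, ← mem_rows ⟨k, hk⟩]
  have hup : ∀ hk1 : k + 1 < m, (x, (k : ℤ) + 1) ∈ remaining R x k S.1 ↔
      (p (k + 1) ↔ (⟨k + 1, hk1⟩ : Fin m) ∉ S.1) := by
    intro hk1
    have h1 := hR (k + 1) hk1
    rw [Nat.cast_succ] at h1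
    rw [hp, ← mem_rows ⟨k + 1, hk1⟩]
    simp [remaining, h1]
  have hup' : ¬k + 1 < m → (x, (k : ℤ) + 1) ∉ remaining R x k S.1 := fun hk1 hmem => by
    have := (hstrip _ (Finset.mem_filter.1 hmem).1).2
    simp only at this
    omega
  have hmove : ∀ (hk1 : k + 1 < m) (a b : Fin m),
      (a = ⟨k, hk⟩ ∧ b = ⟨k + 1, hk1⟩ ∨ a = ⟨k + 1, hk1⟩ ∧ b = ⟨k, hk⟩) → a ∈ S.1 → b ∉ S.1 →
      (x, (k : ℤ)) ∈ remaining R x k S.1 → (x, (k : ℤ) + 1) ∈ remaining R x k S.1 →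
      dimer c (remaining R x k S.1) =
        c {(x, (k : ℤ)), (x + 1, (k : ℤ))} * dimer c (remaining R x (k + 1) S.1) +
        c {(x, (k : ℤ)), (x, (k : ℤ) + 1)} *
          dimer c (remaining R x (k + 1) (insert b (S.1.erase a))) := by
    intro hk1 a b hab ha hb h1 h2
    have hne : (⟨k, hk⟩ : Fin m) ≠ ⟨k + 1, hk1⟩ := by simp [Fin.ext_iff]
    refine dimer_remaining_of_mem_up c hRk hR' h1 h2 ?_ ?_ ?_
    · rw [mem_rows ⟨k, hk⟩, mem_rows ⟨k, hk⟩]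
      rcases hab with ⟨rfl, rfl⟩ | ⟨rfl, rfl⟩
      · simp [ha, hne]
      · simp [hb]
    · rw [← Nat.cast_succ, mem_rows ⟨k + 1, hk1⟩, mem_rows ⟨k + 1, hk1⟩]
      rcases hab with ⟨rfl, rfl⟩ | ⟨rfl, rfl⟩
      · simp [hb]
      · simp [ha, hne.symm]
    · intro y hy1 hy2
      have hya : y ≠ ((a : ℕ) : ℤ) := by
        rcases hab with ⟨rfl, rfl⟩ | ⟨rfl, rfl⟩
        · exact hy1
        · simpa using hy2
      have hyb : y ≠ ((b : ℕ) : ℤ) := by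
        rcases hab with ⟨rfl, rfl⟩ | ⟨rfl, rfl⟩
        · simpa using hy2
        · exact hy1
      simp only [rows, Finset.mem_image, Finset.mem_insert, Finset.mem_erase]
      constructor
      · rintro ⟨i, rfl | hi, rfl⟩
        · exact absurd rfl hyb
        · exact ⟨i, hi.2, rfl⟩
      · rintro ⟨i, hi, rfl⟩
        exact ⟨i, Or.inr ⟨fun h => hya (by rw [h]), hi⟩, rfl⟩
  have hcard : ∀ a b : Fin m, a ∈ S.1 → b ∉ S.1 → (insert b (S.1.erase a)).card = r := by
    intro a b ha hb
    rw [Finset.card_insert_of_notMem fun h => hb (Finset.mem_of_mem_erase h),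
      Finset.card_erase_of_mem ha, S.2]
    have : 0 < S.1.card := Finset.card_pos.2 ⟨a, ha⟩
    rw [S.2] at this
    omega
  by_cases hpb : p k
  · have hpk' : ¬p (k + 1) := fun h => hpk.1 h hpb
    by_cases hk1 : k + 1 < m
    · have hf : ∀ i, i ≠ (⟨k + 1, hk1⟩ : Fin m) →
          squareMap m p h v d k (Pi.single i 1) = Pi.single i 1 := by
        intro i hi
        have hi' : (i : ℕ) ≠ k + 1 := fun h => hi (Fin.ext h)
        rw [squareMap_single, ← rowVec_eq_single]
        by_cases hik : (i : ℕ) = k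
        · rw [if_pos (hik ▸ hpb)]
        · rw [if_neg hik, if_neg hi', ite_self]
      have hfk : squareMap m p h v d k (Pi.single ⟨k + 1, hk1⟩ 1) =
          (1 : F) • Pi.single ⟨k + 1, hk1⟩ 1 + d (k + 1) • Pi.single ⟨k, hk⟩ 1 := by
        rw [squareMap_single, if_neg hpk', if_neg (by simp), if_pos rfl, one_smul,
          ← rowVec_eq_single, ← rowVec_eq_single]
      by_cases h1 : (⟨k + 1, hk1⟩ : Fin m) ∈ S.1
      · by_cases h0 : (⟨k, hk⟩ : Fin m) ∈ S.1
        · rw [map_wedge_of_mem_of_mem hf S (by simp [Fin.ext_iff]) h1 h0 hfk, one_smul,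
            sweepForm_wedge, remaining_succ_of_notMem _ hRk]
          rw [hmem]
          simp [hpb, h0]
        · rw [map_wedge_of_mem_of_notMem hf S ⟨_, hcard _ _ h1 h0⟩ (Or.inr rfl) h1 h0 rfl hfk,
            map_add, map_smul, map_smul, sweepForm_wedge, sweepForm_wedge,
            hmove hk1 ⟨k + 1, hk1⟩ ⟨k, hk⟩ (Or.inr ⟨rfl, rfl⟩) h1 h0, c1 hpb, c3 hpb]
          · rfl
          · rw [hmem]; simp [hpb, h0]
          · rw [hup hk1]; simp [hpk', h1]
      · rw [map_wedge_of_notMem hf S h1, sweepForm_wedge]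
        by_cases h0 : (⟨k, hk⟩ : Fin m) ∈ S.1
        · rw [remaining_succ_of_notMem _ hRk]
          rw [hmem]
          simp [hpb, h0]
        · rw [dimer_remaining_of_notMem_up c hRk hR', c1 hpb, one_mul]
          · rw [hmem]; simp [hpb, h0]
          · rw [hup hk1]; simp [hpk', h1]
    · have hid : squareMap m p h v d k = LinearMap.id := by
        refine (Pi.basisFun F (Fin m)).ext fun i => ?_
        rw [Pi.basisFun_apply, squareMap_single, LinearMap.id_apply, ← rowVec_eq_single]
        by_cases hik : (i : ℕ) = k
        · rw [if_pos (hik ▸ hpb)]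
        · rw [if_neg hik, if_neg (by have := i.2; omega : ¬(i : ℕ) = k + 1), ite_self]
      rw [hid, exteriorPower.map_id, LinearMap.id_apply, sweepForm_wedge]
      by_cases h0 : (⟨k, hk⟩ : Fin m) ∈ S.1
      · rw [remaining_succ_of_notMem _ hRk]
        rw [hmem]
        simp [hpb, h0]
      · rw [dimer_remaining_of_notMem_up c hRk hR' _ (hup' hk1), c1 hpb, one_mul]
        rw [hmem]; simp [hpb, h0]
  · have hpk' : p (k + 1) := hpk.2 hpb
    have hf : ∀ i, i ≠ (⟨k, hk⟩ : Fin m) →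
        squareMap m p h v d k (Pi.single i 1) = Pi.single i 1 := by
      intro i hi
      have hi' : (i : ℕ) ≠ k := fun h => hi (Fin.ext h)
      rw [squareMap_single, ← rowVec_eq_single]
      by_cases hik : (i : ℕ) = k + 1
      · rw [if_pos (hik ▸ hpk')]
      · rw [if_neg hi', if_neg hik, ite_self]
    have hfk0 : squareMap m p h v d k (Pi.single ⟨k, hk⟩ 1) =
        h k • Pi.single ⟨k, hk⟩ 1 + v k • rowVec F m (k + 1) := by
      rw [squareMap_single, if_neg hpb, if_pos rfl, ← rowVec_eq_single]
    by_cases h0 : (⟨k, hk⟩ : Fin m) ∈ S.1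
    · have hin : (x, (k : ℤ)) ∈ remaining R x k S.1 := by
        rw [hmem]; simp [hpb, h0]
      by_cases hk1 : k + 1 < m
      · have hfk : squareMap m p h v d k (Pi.single ⟨k, hk⟩ 1) =
            h k • Pi.single ⟨k, hk⟩ 1 + v k • Pi.single ⟨k + 1, hk1⟩ 1 := by
          rw [hfk0, ← rowVec_eq_single ⟨k + 1, hk1⟩]
        by_cases h1 : (⟨k + 1, hk1⟩ : Fin m) ∈ S.1
        · rw [map_wedge_of_mem_of_mem hf S (by simp [Fin.ext_iff]) h0 h1 hfk, map_smul,
            sweepForm_wedge, dimer_remaining_of_notMem_up c hRk hR' hin, c2 hpb, smul_eq_mul]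
          rw [hup hk1]; simp [hpk', h1]
        · rw [map_wedge_of_mem_of_notMem hf S ⟨_, hcard _ _ h0 h1⟩ (Or.inl rfl) h0 h1 rfl hfk,
            map_add, map_smul, map_smul, sweepForm_wedge, sweepForm_wedge,
            hmove hk1 ⟨k, hk⟩ ⟨k + 1, hk1⟩ (Or.inl ⟨rfl, rfl⟩) h0 h1 hin, c2 hpb, c4 hpb]
          · rfl
          · rw [hup hk1]; simp [hpk', h1]
      · rw [rowVec_eq_zero (by omega), smul_zero, add_zero] at hfk0
        rw [map_wedge_of_scale hf S h0 hfk0, map_smul, sweepForm_wedge,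
          dimer_remaining_of_notMem_up c hRk hR' hin (hup' hk1), c2 hpb, smul_eq_mul]
    · rw [map_wedge_of_notMem hf S h0, sweepForm_wedge, remaining_succ_of_notMem _ hRk]
      rw [hmem]
      simp [hpb, h0]

end Sweep

end AztecStrip

namespace AztecStrip

open Module Set.powersetCard

/-! ### Sweeping columns -/

section Column

variable {F : Type*} [Field F] {m r : ℕ}

/-- The one-particle operator of the first `k` squares of a column. -/
noncomputable def columnMap (m : ℕ) (p : ℕ → Prop) [DecidablePred p] (h v d : ℕ → F) :
    ℕ → (Fin m → F) →ₗ[F] (Fin m → F)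
  | 0 => LinearMap.id
  | k + 1 => squareMap m p h v d k ∘ₗ columnMap m p h v d k

theorem squareMap_rowVec_of_pos {p : ℕ → Prop} [DecidablePred p] (h v d : ℕ → F) (k : ℕ) {b : ℕ}
    (hb : p b) : squareMap m p h v d k (rowVec F m b) = rowVec F m b := by
  by_cases hbm : b < m
  · rw [rowVec_eq_single ⟨b, hbm⟩, squareMap_single, if_pos hb, ← rowVec_eq_single]
  · rw [rowVec_eq_zero (not_lt.1 hbm), map_zero]

theorem columnMap_single_of_pos {p : ℕ → Prop} [DecidablePred p] (h v d : ℕ → F) (k : ℕ)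
    {i : Fin m} (hi : p i) : columnMap m p h v d k (Pi.single i 1) = Pi.single i 1 := by
  induction k with
  | zero => rfl
  | succ k ih =>
    rw [columnMap, LinearMap.comp_apply, ih, ← rowVec_eq_single, squareMap_rowVec_of_pos h v d k hi]

theorem columnMap_single_of_neg {p : ℕ → Prop} [DecidablePred p] (h v d : ℕ → F) (k : ℕ)
    {i : Fin m} (hi : ¬p i) (hup : p (i + 1)) (hdown : ∀ b : ℕ, b + 1 = i → p b) :
    columnMap m p h v d k (Pi.single i 1) =
      (if (i : ℕ) < k then h i else 1) • rowVec F m i +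
        (if (i : ℕ) < k then v i else 0) • rowVec F m (i + 1) +
        (if 1 ≤ (i : ℕ) ∧ (i : ℕ) ≤ k then d i else 0) • rowVec F m (i - 1) := by
  induction k with
  | zero =>
    rw [if_neg (Nat.not_lt_zero _), if_neg (Nat.not_lt_zero _), if_neg (by omega), one_smul,
      zero_smul, zero_smul, add_zero, add_zero, rowVec_eq_single]
    rfl
  | succ k ih =>
    rw [columnMap, LinearMap.comp_apply, ih, map_add, map_add, map_smul, map_smul, map_smul,
      squareMap_rowVec_of_pos h v d k hup, rowVec_eq_single i, squareMap_single, if_neg hi,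
      ← rowVec_eq_single i]
    have hd : (if 1 ≤ (i : ℕ) ∧ (i : ℕ) ≤ k then d i else 0) •
        squareMap m p h v d k (rowVec F m (i - 1)) =
        (if 1 ≤ (i : ℕ) ∧ (i : ℕ) ≤ k then d i else 0) • rowVec F m (i - 1) := by
      split_ifs with h1
      · rw [squareMap_rowVec_of_pos h v d k (hdown _ (by omega))]
      · rw [zero_smul, zero_smul]
    rw [hd]
    rcases lt_trichotomy (i : ℕ) k with h1 | h1 | h1
    · have h2 : ¬(i : ℕ) = k := h1.ne
      have h3 : ¬(i : ℕ) = k + 1 := by omega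
      have h4 : (i : ℕ) < k + 1 := by omega
      have h5 : (i : ℕ) ≤ k := h1.le
      have h6 : (i : ℕ) ≤ k + 1 := h4.le
      simp only [h1, h2, h3, h4, h5, h6, ↓reduceIte, and_true]
    · have h2 : ¬(i : ℕ) < k := h1.not_lt
      have h4 : (i : ℕ) < k + 1 := by omega
      have h5 : (i : ℕ) ≤ k := h1.le
      have h6 : (i : ℕ) ≤ k + 1 := h4.le
      simp only [h2, h4, h5, h6, ↓reduceIte, and_true, one_smul, zero_smul, add_zero]
      rw [if_pos h1]
    · have h2 : ¬(i : ℕ) = k := h1.ne'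
      have h3 : ¬(i : ℕ) < k := by omega
      have h4 : ¬(i : ℕ) < k + 1 := by omega
      have h5 : ¬(i : ℕ) ≤ k := by omega
      simp only [h2, h3, h4, h5, ↓reduceIte, and_false, one_smul, zero_smul, add_zero]
      by_cases h6 : (i : ℕ) = k + 1
      · rw [if_pos h6, if_pos (by omega), show (i : ℕ) - 1 = k by omega]
      · rw [if_neg h6, if_neg (by omega), zero_smul, add_zero]

theorem sweepForm_columnMap {c : Finset (ℤ × ℤ) → F} {R : Finset (ℤ × ℤ)} {x : ℤ}
    {p : ℕ → Prop} [DecidablePred p] {h v d : ℕ → F}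
    (hp : ∀ b : ℕ, p b ↔ Odd (x + b)) (hstrip : ∀ s ∈ R, 0 ≤ s.2 ∧ s.2 < m)
    (hR : ∀ b : ℕ, b < m → (x, (b : ℤ)) ∈ R) (hR' : ∀ b : ℕ, b < m → (x + 1, (b : ℤ)) ∈ R)
    (c1 : ∀ k : ℕ, p k → c {(x, (k : ℤ)), (x + 1, (k : ℤ))} = 1)
    (c2 : ∀ k : ℕ, ¬p k → c {(x, (k : ℤ)), (x + 1, (k : ℤ))} = h k)
    (c3 : ∀ k : ℕ, p k → c {(x, (k : ℤ)), (x, (k : ℤ) + 1)} = d (k + 1))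
    (c4 : ∀ k : ℕ, ¬p k → c {(x, (k : ℤ)), (x, (k : ℤ) + 1)} = v k) {k : ℕ} (hk : k ≤ m) :
    sweepForm r m c R x 0 =
      sweepForm r m c R x k ∘ₗ exteriorPower.map r (columnMap m p h v d k) := by
  induction k with
  | zero => rw [columnMap, exteriorPower.map_id, LinearMap.comp_id]
  | succ k ih =>
    rw [ih (by omega), sweepForm_square c hp hk hstrip hR (hR' k hk) (c1 k) (c2 k) (c3 k) (c4 k),
      columnMap, exteriorPower.map_comp, LinearMap.comp_assoc]

end Column

section Bulk

variable {n m r : ℕ}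

/-- A set of squares of the strip which contains all squares of the columns from `x` to `y`. -/
def IsFullOn (m : ℕ) (R : Finset (ℤ × ℤ)) (x y : ℤ) : Prop :=
  (∀ s ∈ R, 0 ≤ s.2 ∧ s.2 < m) ∧ ∀ a b : ℤ, x ≤ a → a ≤ y → 0 ≤ b → b < m → (a, b) ∈ R

theorem IsFullOn.mono {R : Finset (ℤ × ℤ)} {x y x' y' : ℤ} (h : IsFullOn m R x y) (hx : x ≤ x')
    (hy : y' ≤ y) : IsFullOn m R x' y' :=
  ⟨h.1, fun a b h1 h2 => h.2 a b (hx.trans h1) (h2.trans hy)⟩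

/-- On the lines bounding the strip, both weights are `1`. -/
theorem interiorWeight_of_isFullOn {R : Finset (ℤ × ℤ)} {x y : ℤ} (h : IsFullOn m R x y) {a b : ℤ}
    (hx : x < a) (hy : a ≤ y) : interiorWeight n m R (a, b) = w n m (a : ZMod (2 * n)) b := by
  rw [interiorWeight]
  split_ifs with h1
  · rfl
  · rw [w, dif_neg]
    intro hb
    refine h1 fun s hs => ?_
    simp only [around, Finset.mem_insert, Finset.mem_singleton] at hs
    rcases hs with rfl | rfl | rfl | rfl <;> exact h.2 _ _ (by omega) (by omega) (by omega) (by omega)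

theorem odd_val_intCast_add [NeZero n] (x : ℤ) (b : ℕ) :
    Odd ((x : ZMod (2 * n)).val + b) ↔ Odd (x + b) := by
  have h : (((x : ZMod (2 * n)).val : ℤ)) = x % (2 * n : ℕ) := ZMod.val_intCast x
  have h2 : x % (2 * n : ℕ) % 2 = x % 2 :=
    Int.emod_emod_of_dvd x (by push_cast; exact dvd_mul_right _ _)
  rw [← Int.odd_coe_nat, Nat.cast_add, h, Int.odd_add, Int.odd_add, Int.odd_iff, h2, ← Int.odd_iff]

/-- The one-particle operator of a column is the transpose of its transfer matrix. -/
theorem columnMap_eq_toLin' [NeZero n] (x : ℤ) (p : ℕ → Prop) [DecidablePred p]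
    (hp : ∀ b : ℕ, p b ↔ Odd (x + b)) (X : ZMod (2 * n)) (hX : X = x) :
    columnMap m p
      (fun b => w n m (X + 1 + 1) ((b : ℤ) + 1) * w n m (X + 1 + 1) (b : ℤ) /
        (w n m (X + 1) (b : ℤ) * w n m (X + 1) ((b : ℤ) + 1)))
      (fun b => w n m (X + 1) ((b : ℤ) + 1 + 1) / w n m X ((b : ℤ) + 1))
      (fun b => w n m (X + 1) ((b : ℤ) - 1) / w n m X (b : ℤ)) m =
    (colMat n m X).transpose.toLin' := by
  refine (Pi.basisFun _ (Fin m)).ext fun i => ?_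
  rw [Pi.basisFun_apply, Matrix.toLin'_apply, Matrix.mulVec_single_one]
  have hodd := odd_val_intCast_add (n := n) x i
  rw [← hX] at hodd
  by_cases hi : p i
  · rw [columnMap_single_of_pos _ _ _ _ hi]
    ext j
    rw [Matrix.col_apply, Matrix.transpose_apply, colMat, Matrix.of_apply,
      if_pos (hodd.2 ((hp _).1 hi)), Pi.single_apply]
  · have hi' : ¬(x + (i : ℕ)) % 2 = 1 := fun h => hi ((hp _).2 (Int.odd_iff.2 h))
    rw [columnMap_single_of_neg _ _ _ _ hi ((hp _).2 (Int.odd_iff.2 (by push_cast; omega)))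
      fun b hb => (hp _).2 (Int.odd_iff.2 (by omega)), if_pos i.2, if_pos i.2]
    ext j
    rw [Matrix.col_apply, Matrix.transpose_apply, colMat, Matrix.of_apply,
      if_neg fun h => hi ((hp _).2 (hodd.1 h))]
    simp only [Pi.add_apply, Pi.smul_apply, rowVec, smul_eq_mul, mul_ite, mul_one, mul_zero]
    by_cases h1 : (j : ℕ) = i + 1
    · rw [if_neg (by omega), if_pos h1, if_neg (by omega), if_pos h1, zero_add, add_zero, h1,
        Nat.cast_succ]
    by_cases h2 : j = i
    · subst h2
      rw [if_pos rfl, if_neg h1, add_zero, if_neg h1, if_pos rfl]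
      by_cases h3 : 1 ≤ (j : ℕ)
      · rw [if_neg (by omega), add_zero]
      · rw [if_neg (not_and_of_not_left _ h3), ite_self, add_zero]
    have h2' : (j : ℕ) ≠ i := fun h => h2 (Fin.ext h)
    rw [if_neg h2', if_neg h1, if_neg h1, if_neg h2, zero_add, zero_add]
    by_cases h3 : (j : ℕ) + 1 = i
    · have := i.2
      rw [if_pos (by omega), if_pos (by omega), if_pos h3, ← h3, Nat.cast_succ, add_sub_cancel_right]
    · rw [if_neg h3]
      by_cases h4 : 1 ≤ (i : ℕ)
      · rw [if_neg (by omega)]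
      · rw [if_neg (not_and_of_not_left _ h4), ite_self]

/-- Sweeping a full column acts as the exterior power of the transpose of the transfer matrix. -/
theorem sweepForm_column [NeZero n] {R : Finset (ℤ × ℤ)} {x : ℤ} (h : IsFullOn m R (x - 1) (x + 2)) :
    sweepForm r m (dominoWeight (interiorWeight n m R)) R x 0 =
      sweepForm r m (dominoWeight (interiorWeight n m R)) R (x + 1) 0 ∘ₗ
        exteriorPower.map r (colMat n m (x : ZMod (2 * n))).transpose.toLin' := by
  classical
  have hW0 : ∀ v, interiorWeight n m R v ≠ 0 := interiorWeight_ne_zero R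
  have hw0 : ∀ b : ℤ, interiorWeight n m R (x, b) = w n m (x : ZMod (2 * n)) b := fun b =>
    interiorWeight_of_isFullOn h (by omega) (by omega)
  have hw1 : ∀ b : ℤ, interiorWeight n m R (x + 1, b) = w n m ((x : ZMod (2 * n)) + 1) b :=
    fun b => by
      rw [interiorWeight_of_isFullOn h (by omega) (by omega), Int.cast_add, Int.cast_one]
  have hw2 : ∀ b : ℤ, interiorWeight n m R (x + 1 + 1, b) = w n m ((x : ZMod (2 * n)) + 1 + 1) b :=
    fun b => by
      rw [interiorWeight_of_isFullOn h (by omega) (by omega), Int.cast_add, Int.cast_add,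
        Int.cast_one]
  have hend : sweepForm r m (dominoWeight (interiorWeight n m R)) R x m =
      sweepForm r m (dominoWeight (interiorWeight n m R)) R (x + 1) 0 := by
    refine ((Pi.basisFun _ (Fin m)).exteriorPower r).ext fun S => ?_
    change sweepForm r m _ R x m (wedge _ S) = sweepForm r m _ R (x + 1) 0 (wedge _ S)
    rw [sweepForm_wedge, sweepForm_wedge, remaining_column_end h.1]
  rw [← hend, ← columnMap_eq_toLin' x (fun b => Odd (x + b)) (fun _ => Iff.rfl) _ rfl]
  refine sweepForm_columnMap (fun b => Iff.rfl) h.1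
    (fun b hb => h.2 _ _ (by omega) (by omega) (by omega) (by omega))
    (fun b hb => h.2 _ _ (by omega) (by omega) (by omega) (by omega)) ?_ ?_ ?_ ?_ le_rfl
  · exact fun k hk => dominoWeight_horizontal_of_odd hW0 hk
  · intro k hk
    rw [dominoWeight_horizontal_of_even hk, hw1, hw1, hw2, hw2]
  · intro k hk
    rw [dominoWeight_vertical_of_odd hW0 hk, hw1, hw0, Nat.cast_succ, add_sub_cancel_right]
  · intro k hk
    rw [dominoWeight_vertical_of_even hW0 hk, hw1, hw0]

theorem sweepForm_columns [NeZero n] {R : Finset (ℤ × ℤ)} (l : ℕ) {x : ℤ}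
    (h : IsFullOn m R (x - 1) (x + l + 1)) :
    sweepForm r m (dominoWeight (interiorWeight n m R)) R x 0 =
      sweepForm r m (dominoWeight (interiorWeight n m R)) R (x + l) 0 ∘ₗ
        exteriorPower.map r (colProd n m (x : ZMod (2 * n)) l).transpose.toLin' := by
  induction l generalizing x with
  | zero =>
    rw [colProd, Matrix.transpose_one, Matrix.toLin'_one, exteriorPower.map_id, LinearMap.comp_id,
      Nat.cast_zero, add_zero]
  | succ l ih =>
    rw [Nat.cast_succ] at h ⊢
    rw [sweepForm_column (h.mono (by omega) (by omega)), ih (h.mono (by omega) (by omega)), colProd,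
      Matrix.transpose_mul, Matrix.toLin'_mul, exteriorPower.map_comp, LinearMap.comp_assoc,
      Int.cast_add, Int.cast_one, add_assoc x 1, add_comm (1 : ℤ)]

end Bulk

end AztecStrip

namespace AztecStrip

open Module Set.powersetCard

/-! ### The number of particles -/

section Balance

variable {F : Type*} [Field F] {m : ℕ} {R : Finset (ℤ × ℤ)} {x : ℤ} {S : Finset (Fin m)}

theorem mem_remaining_zero (hstrip : ∀ s ∈ R, 0 ≤ s.2 ∧ s.2 < m) {s : ℤ × ℤ} :
    s ∈ remaining R x 0 S ↔
      s ∈ R ∧ (x < s.1 ∨ s.1 = x ∧ (Odd (x + s.2) ↔ s.2 ∉ rows S)) := by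
  rw [remaining, Finset.mem_filter]
  refine and_congr_right fun hs => ?_
  have h1 := hstrip s hs
  constructor
  · rintro (h | ⟨h, -⟩ | ⟨⟨h, -⟩ | h, h2⟩)
    · exact Or.inl (by omega)
    · exact Or.inl (by omega)
    · exact Or.inr ⟨h, h ▸ h2⟩
    · exact Or.inl (by omega)
  · rintro (h | ⟨h, h2⟩)
    · by_cases h3 : s.1 = x + 1
      · exact Or.inr (Or.inl ⟨h3, by simpa using h1.1⟩)
      · exact Or.inl (by omega)
    · exact Or.inr (Or.inr ⟨Or.inl ⟨h, by simpa using h1.1⟩, by rwa [h]⟩)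

theorem sum_colour_Ioc {e : ℤ} (h : x ≤ e) (b : ℤ) : ∑ a ∈ Finset.Ioc x e, colour (a, b) =
    (if Odd (e + b) then 1 else 0) - if Odd (x + b) then 1 else 0 := by
  induction e, h using Int.leInduction with
  | base => rw [Finset.Ioc_self, Finset.sum_empty, sub_self]
  | succ e he ih =>
    have h1 : Finset.Ioc x (e + 1) = insert (e + 1) (Finset.Ioc x e) := by
      ext a
      simp only [Finset.mem_Ioc, Finset.mem_insert]
      omega
    rw [h1, Finset.sum_insert (by simp), ih, colour]
    simp only [Int.odd_iff]
    split_ifs <;> omega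

theorem sum_colour_remaining (hstrip : ∀ s ∈ R, 0 ≤ s.2 ∧ s.2 < m) {e : Fin m → ℤ}
    (hx : ∀ i, x ≤ e i)
    (hR : ∀ (a : ℤ) (i : Fin m), x ≤ a → ((a, ((i : ℕ) : ℤ)) ∈ R ↔ a ≤ e i)) :
    ∑ s ∈ remaining R x 0 S, colour s =
      ((Finset.univ.filter fun i : Fin m => Odd (e i + (i : ℕ))).card : ℤ) - S.card := by
  classical
  let row : Fin m → Finset ℤ := fun i =>
    (Finset.Icc x (e i)).filter fun a => x < a ∨ (Odd (x + (i : ℕ)) ↔ i ∉ S)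
  have h1 : remaining R x 0 S =
      Finset.univ.biUnion fun i : Fin m => (row i).image fun a => (a, ((i : ℕ) : ℤ)) := by
    ext ⟨a, b⟩
    simp only [mem_remaining_zero hstrip, Finset.mem_biUnion, Finset.mem_univ, true_and,
      Finset.mem_image, row, Finset.mem_filter, Finset.mem_Icc]
    constructor
    · rintro ⟨h2, h3⟩
      have hb := hstrip _ h2
      simp only at hb
      obtain ⟨k, rfl⟩ := Int.eq_ofNat_of_zero_le hb.1
      have hk : k < m := by omega
      have hxa : x ≤ a := by omega
      refine ⟨⟨k, hk⟩, a, ⟨⟨hxa, (hR a ⟨k, hk⟩ hxa).1 h2⟩, ?_⟩, rfl⟩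
      exact h3.imp id fun h => by rw [← mem_rows]; exact h.2
    · rintro ⟨i, a', ⟨⟨h2, h3⟩, h4⟩, h5⟩
      obtain ⟨rfl, rfl⟩ := Prod.mk.inj h5
      refine ⟨(hR _ i h2).2 h3, ?_⟩
      rw [mem_rows]
      by_cases h6 : x < a'
      · exact Or.inl h6
      · exact Or.inr ⟨by omega, h4.resolve_left h6⟩
  have h2 : ∀ i : Fin m, ∑ a ∈ row i, colour (a, ((i : ℕ) : ℤ)) =
      (if Odd (e i + (i : ℕ)) then 1 else 0) - if i ∈ S then 1 else 0 := by
    intro i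
    have h3 : Finset.Icc x (e i) = insert x (Finset.Ioc x (e i)) :=
      (Finset.Ioc_insert_left (hx i)).symm
    have h4 : ∑ a ∈ Finset.Ioc x (e i),
        (if x < a ∨ (Odd (x + (i : ℕ)) ↔ i ∉ S) then colour (a, ((i : ℕ) : ℤ)) else 0) =
        ∑ a ∈ Finset.Ioc x (e i), colour (a, ((i : ℕ) : ℤ)) :=
      Finset.sum_congr rfl fun a ha => if_pos (Or.inl (Finset.mem_Ioc.1 ha).1)
    rw [Finset.sum_filter, h3, Finset.sum_insert (by simp), h4, sum_colour_Ioc (hx i), colour]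
    by_cases h5 : Odd (x + (i : ℕ)) <;> by_cases h6 : i ∈ S <;> simp [h5, h6, neg_add_eq_sub]
  rw [h1, Finset.sum_biUnion]
  · rw [Finset.sum_congr rfl fun i _ => (Finset.sum_image (s := row i) fun a _ a' _ h =>
      (Prod.mk.inj h).1).trans (h2 i), Finset.sum_sub_distrib, Finset.sum_boole, Finset.sum_boole]
    simp
  · intro i _ i' _ hne
    rw [Function.onFun, Finset.disjoint_left]
    intro s hs hs'
    obtain ⟨a, -, rfl⟩ := Finset.mem_image.1 hs
    obtain ⟨a', -, h⟩ := Finset.mem_image.1 hs'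
    exact hne (Fin.ext (Int.ofNat_inj.1 (Prod.mk.inj h).2.symm))

/-- The number of particles is the number of rows which end with a black square. -/
theorem card_eq_of_dimer_remaining_ne_zero {c : Finset (ℤ × ℤ) → F}
    (hstrip : ∀ s ∈ R, 0 ≤ s.2 ∧ s.2 < m) {e : Fin m → ℤ} (hx : ∀ i, x ≤ e i)
    (hR : ∀ (a : ℤ) (i : Fin m), x ≤ a → ((a, ((i : ℕ) : ℤ)) ∈ R ↔ a ≤ e i))
    (h : dimer c (remaining R x 0 S) ≠ 0) :
    S.card = (Finset.univ.filter fun i : Fin m => Odd (e i + (i : ℕ))).card := by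
  have h1 := sum_colour_eq_zero h
  rw [sum_colour_remaining hstrip hx hR] at h1
  omega

end Balance

/-! ### The left end of the region -/

section LeftEnd

variable {F : Type*} [Field F] {m : ℕ}

/-- Covering a fixed set `L` of squares to the left of column `x` first, the partition functions of
the regions composed of `L` and of the squares remaining from column `x` on are linear combinations,
with the same coefficients for all members of a family, of those of the remaining squares. -/
theorem dimer_union_remaining_mem_span {ι : Type*} (c : ι → Finset (ℤ × ℤ) → F)
    (c₀ : Finset (ℤ × ℤ) → F) (R : ι → Finset (ℤ × ℤ)) {x : ℤ}
    (hstrip : ∀ t, ∀ s ∈ R t, 0 ≤ s.2 ∧ s.2 < m)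
    (hcol : ∀ (t : ι) (b : ℕ), b < m → (x, (b : ℤ)) ∈ R t)
    (hc : ∀ t s s', s.1 < x → s' ∈ nbrs s → c t {s, s'} = c₀ {s, s'})
    (L : Finset (ℤ × ℤ)) (hL : ∀ s ∈ L, s.1 < x) (S : Finset (Fin m)) :
    (fun t => dimer (c t) (L ∪ remaining (R t) x 0 S)) ∈ Submodule.span F
      (Set.range fun (S : Finset (Fin m)) t => dimer (c t) (remaining (R t) x 0 S)) := by
  classical
  induction hn : L.card using Nat.strong_induction_on generalizing L S with
  | _ N ih =>
  subst hn
  rcases L.eq_empty_or_nonempty with rfl | ⟨s, hs⟩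
  · simp only [Finset.empty_union]
    exact Submodule.subset_span ⟨S, rfl⟩
  have hsx := hL s hs
  let E : Finset (ℤ × ℤ) := (Finset.univ.filter fun i : Fin m => Odd (x + (i : ℕ)) ↔ i ∉ S).image
    fun i : Fin m => (x, ((i : ℕ) : ℤ))
  have hE : ∀ t s', s'.1 ≤ x → (s' ∈ remaining (R t) x 0 S ↔ s' ∈ E) := by
    rintro t ⟨a, b⟩ ha
    simp only [mem_remaining_zero (hstrip t), E, Finset.mem_image, Finset.mem_filter,
      Finset.mem_univ, true_and] at ha ⊢
    constructor
    · rintro ⟨h1, h2 | ⟨rfl, h2⟩⟩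
      · omega
      · have hb := hstrip t _ h1
        simp only at hb
        obtain ⟨k, rfl⟩ := Int.eq_ofNat_of_zero_le hb.1
        exact ⟨⟨k, by omega⟩, by rw [← mem_rows]; exact h2, rfl⟩
    · rintro ⟨i, h1, h2⟩
      obtain ⟨rfl, rfl⟩ := Prod.mk.inj h2
      exact ⟨hcol t i i.2, Or.inr ⟨rfl, by rwa [mem_rows]⟩⟩
  have hnbrs : ∀ s' ∈ nbrs s, s'.1 ≤ x := by
    intro s' hs'
    simp only [nbrs, Finset.mem_insert, Finset.mem_singleton] at hs'
    rcases hs' with rfl | rfl | rfl | rfl <;> simp only <;> omega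
  have hinter : ∀ t, nbrs s ∩ (L ∪ remaining (R t) x 0 S) = nbrs s ∩ (L ∪ E) := by
    intro t
    ext s'
    rw [Finset.mem_inter, Finset.mem_inter, Finset.mem_union, Finset.mem_union]
    exact and_congr_right fun h => or_congr_right (hE t s' (hnbrs s' h))
  have hexp : (fun t => dimer (c t) (L ∪ remaining (R t) x 0 S)) =
      ∑ s' ∈ nbrs s ∩ (L ∪ E), c₀ {s, s'} •
        fun t => dimer (c t) ((L ∪ remaining (R t) x 0 S) \ {s, s'}) := by
    funext t
    rw [dimer_expand (c t) (Finset.mem_union_left _ hs), hinter, Finset.sum_apply]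
    refine Finset.sum_congr rfl fun s' hs' => ?_
    rw [hc t s s' hsx (Finset.mem_inter.1 hs').1]
    rfl
  rw [hexp]
  refine Submodule.sum_mem _ fun s' hs' => Submodule.smul_mem _ _ ?_
  rcases Finset.mem_union.1 (Finset.mem_inter.1 hs').2 with h | h
  · have h1 : ∀ t, (L ∪ remaining (R t) x 0 S) \ {s, s'} =
        (L \ {s, s'}) ∪ remaining (R t) x 0 S := by
      intro t
      rw [Finset.union_sdiff_distrib]
      refine congrArg _ (Finset.sdiff_eq_self_of_disjoint (Finset.disjoint_left.2 fun u hu hu' => ?_))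
      have h2 := (mem_remaining_zero (hstrip t)).1 hu
      have h3 : u.1 < x := by
        rcases Finset.mem_insert.1 hu' with rfl | hu'
        · exact hsx
        · rw [Finset.mem_singleton.1 hu']
          exact hL _ h
      omega
    simp only [h1]
    refine ih _ (Finset.card_lt_card ?_) _ (fun u hu => hL u (Finset.mem_sdiff.1 hu).1) S rfl
    exact Finset.ssubset_iff_subset_ne.2 ⟨Finset.sdiff_subset, fun h2 => by
      have := h2 ▸ hs
      simp at this⟩
  · simp only [E, Finset.mem_image, Finset.mem_filter, Finset.mem_univ, true_and] at h
    obtain ⟨i, hi, rfl⟩ := h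
    -- covering a square of column `x` from the left toggles the particle in its row
    let S' : Finset (Fin m) := if i ∈ S then S.erase i else insert i S
    have hS' : ∀ k : Fin m, k ∈ S' ↔ (k ∈ S ↔ k ≠ i) := by
      intro k
      by_cases h1 : i ∈ S <;> by_cases h2 : k = i <;> simp [S', h1, h2]
    have h1 : ∀ t, (L ∪ remaining (R t) x 0 S) \ {s, (x, ((i : ℕ) : ℤ))} =
        L.erase s ∪ remaining (R t) x 0 S' := by
      intro t
      ext ⟨a, b⟩
      simp only [Finset.mem_sdiff, Finset.mem_union, Finset.mem_erase, Finset.mem_insert,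
        Finset.mem_singleton, mem_remaining_zero (hstrip t), not_or]
      by_cases h2 : (a, b) ∈ L
      · have h3 := hL _ h2
        simp only at h3
        have h4 : (a, b) ≠ (x, ((i : ℕ) : ℤ)) := fun h => by
          rw [Prod.mk.injEq] at h; omega
        have h5 : ¬x < a := by omega
        have h6 : ¬a = x := by omega
        simp [h2, h4, h5, h6]
      have h2' : (a, b) ≠ s := fun h => h2 (h ▸ hs)
      simp only [h2, h2', false_or, and_false, not_false_eq_true, true_and, and_assoc, ne_eq,
        Prod.mk.injEq]
      refine and_congr_right fun hab => ?_
      have hb := hstrip t _ hab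
      simp only at hb
      obtain ⟨k, rfl⟩ := Int.eq_ofNat_of_zero_le hb.1
      have hk : k < m := by omega
      have h3 := mem_rows (S := S) ⟨k, hk⟩
      have h4 := mem_rows (S := S') ⟨k, hk⟩
      rw [hS'] at h4
      simp only [ne_eq, Fin.ext_iff] at h3 h4
      rw [h3, h4]
      by_cases h5 : a = x
      · subst h5
        by_cases h6 : k = i
        · subst h6
          simp only [Fin.eta]
          simp [hi]
        · have : ¬(k : ℤ) = ((i : ℕ) : ℤ) := by omega
          simp [h6, this]
      · simp [h5]
    simp only [h1]
    exact ih _ (Finset.card_erase_lt_of_mem hs) _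
      (fun u hu => hL u (Finset.mem_of_mem_erase hu)) S' rfl

end LeftEnd

/-! ### Translations -/

section Translation

variable {F : Type*} [Field F]

/-- The horizontal translation by `q`. -/
def shift (q : ℤ) : ℤ × ℤ ↪ ℤ × ℤ :=
  ⟨fun s => (s.1 + q, s.2), fun s t h => by
    rw [Prod.mk.injEq, add_left_inj] at h
    exact Prod.ext h.1 h.2⟩

theorem shift_apply (q : ℤ) (s : ℤ × ℤ) : shift q s = (s.1 + q, s.2) := rfl

theorem nbrs_shift (q : ℤ) (s : ℤ × ℤ) : nbrs (shift q s) = (nbrs s).map (shift q) := by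
  simp only [nbrs, Finset.map_insert, Finset.map_singleton, shift_apply, add_right_comm,
    sub_add_eq_add_sub]

theorem dimer_empty (c : Finset (ℤ × ℤ) → F) : dimer c ∅ = 1 := by
  have h : tilings ∅ = {∅} := by
    ext T
    rw [mem_tilings, Finset.mem_singleton]
    constructor
    · rintro ⟨h, -⟩
      refine Finset.eq_empty_of_forall_notMem fun D hD => ?_
      obtain ⟨s, hs, -⟩ := mem_dominoes.1 (h D hD)
      exact Finset.notMem_empty s hs
    · rintro rfl
      simp
  rw [dimer, h, Finset.sum_singleton, Finset.prod_empty]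

theorem dimer_map_shift {c c' : Finset (ℤ × ℤ) → F} {R : Finset (ℤ × ℤ)} (q : ℤ)
    (h : ∀ s ∈ R, ∀ s' ∈ R, c' (({s, s'} : Finset (ℤ × ℤ)).map (shift q)) = c {s, s'}) :
    dimer c' (R.map (shift q)) = dimer c R := by
  induction hn : R.card using Nat.strong_induction_on generalizing R with
  | _ N ih =>
  subst hn
  rcases R.eq_empty_or_nonempty with rfl | ⟨s, hs⟩
  · rw [Finset.map_empty, dimer_empty, dimer_empty]
  rw [dimer_expand c hs, dimer_expand c' (Finset.mem_map_of_mem _ hs), nbrs_shift,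
    ← Finset.map_inter, Finset.sum_map]
  refine Finset.sum_congr rfl fun s' hs' => ?_
  have h1 : ({shift q s, shift q s'} : Finset (ℤ × ℤ)) = ({s, s'} : Finset (ℤ × ℤ)).map (shift q) := by
    rw [Finset.map_insert, Finset.map_singleton]
  rw [h1, h s hs s' (Finset.mem_inter.1 hs').2, ← Finset.map_sdiff, ih _ _ _ rfl]
  · refine Finset.card_lt_card (Finset.ssubset_iff_subset_ne.2 ⟨Finset.sdiff_subset, fun h2 => ?_⟩)
    have := h2 ▸ hs
    simp at this
  · exact fun u hu u' hu' => h u (Finset.mem_sdiff.1 hu).1 u' (Finset.mem_sdiff.1 hu').1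

theorem dominoWeight_congr {W W' : ℤ × ℤ → F} {D : Finset (ℤ × ℤ)}
    (h : ∀ s ∈ D, ∀ v ∈ corners s, W v = W' v) : dominoWeight W D = dominoWeight W' D := by
  rw [dominoWeight, dominoWeight]
  congr 1
  · refine Finset.prod_congr rfl fun s hs => ?_
    have hs' := (Finset.mem_filter.1 hs).1
    rw [h s hs' _ (by simp [corners]), h s hs' _ (by simp [corners])]
  · congr 1
    refine Finset.prod_congr rfl fun v hv => ?_
    obtain ⟨s, hs, hsv⟩ := Finset.mem_biUnion.1 (Finset.mem_filter.1 hv).1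
    exact h s hs v hsv

theorem around_shift (q : ℤ) (v : ℤ × ℤ) : around (shift q v) = (around v).map (shift q) := by
  simp only [around, Finset.map_insert, Finset.map_singleton, shift_apply, sub_add_eq_add_sub]

theorem corners_shift (q : ℤ) (s : ℤ × ℤ) : corners (shift q s) = (corners s).map (shift q) := by
  simp only [corners, Finset.map_insert, Finset.map_singleton, shift_apply, add_right_comm]

theorem midpoints_map_shift (q : ℤ) (D : Finset (ℤ × ℤ)) :
    midpoints (D.map (shift q)) = (midpoints D).map (shift q) := by
  ext v
  obtain ⟨u, rfl⟩ : ∃ u, shift q u = v := ⟨(v.1 - q, v.2), by simp [shift_apply]⟩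
  rw [Finset.mem_map', midpoints, midpoints, Finset.mem_filter, Finset.mem_filter, around_shift,
    Finset.map_subset_map]
  refine and_congr_left fun _ => ?_
  simp only [Finset.mem_biUnion, Finset.mem_map, exists_exists_and_eq_and, corners_shift,
    EmbeddingLike.apply_eq_iff_eq, exists_eq_right]

theorem dominoWeight_map_shift {q : ℤ} (hq : Even q) (W : ℤ × ℤ → F) (D : Finset (ℤ × ℤ)) :
    dominoWeight W (D.map (shift q)) = dominoWeight (fun v => W (shift q v)) D := by
  rw [dominoWeight, dominoWeight, midpoints_map_shift, Finset.prod_map, Finset.filter_map,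
    Finset.prod_map]
  congr 1
  refine Finset.prod_congr (Finset.filter_congr fun s _ => ?_) fun s _ => ?_
  · rw [Function.comp_apply, shift_apply, add_right_comm, Int.odd_add, iff_true_right hq]
  · simp only [shift_apply, add_right_comm]

end Translation

end AztecStrip

namespace AztecStrip

open Module Set.powersetCard Polynomial

/-! ### The recurrence -/

section Recurrence

variable {n m r : ℕ}

theorem fst_of_mem_around {s v : ℤ × ℤ} (h : s ∈ around v) : v.1 - 1 ≤ s.1 ∧ s.1 ≤ v.1 := by
  simp only [around, Finset.mem_insert, Finset.mem_singleton, Prod.ext_iff] at h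
  omega

theorem fst_of_mem_corners {s v : ℤ × ℤ} (h : v ∈ corners s) : s.1 ≤ v.1 ∧ v.1 ≤ s.1 + 1 := by
  have := fst_of_mem_around (mem_around.2 h)
  omega

theorem interiorWeight_congr {R R' : Finset (ℤ × ℤ)} {x : ℤ}
    (h : ∀ s : ℤ × ℤ, s.1 ≤ x → (s ∈ R ↔ s ∈ R')) {v : ℤ × ℤ} (hv : v.1 ≤ x) :
    interiorWeight n m R v = interiorWeight n m R' v := by
  refine if_congr ?_ rfl rfl
  rw [Finset.subset_iff, Finset.subset_iff]
  refine forall₂_congr fun s hs => h s ?_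
  have := fst_of_mem_around hs
  omega

theorem interiorWeight_shift {R R' : Finset (ℤ × ℤ)} {x : ℤ}
    (h : ∀ s : ℤ × ℤ, x - 1 ≤ s.1 → (shift (2 * n) s ∈ R' ↔ s ∈ R)) {v : ℤ × ℤ} (hv : x ≤ v.1) :
    interiorWeight n m R' (shift (2 * n) v) = interiorWeight n m R v := by
  rw [interiorWeight, interiorWeight, around_shift]
  have h1 : ((v.1 + 2 * n : ℤ) : ZMod (2 * n)) = v.1 := by
    have h2 : ((2 * n : ℕ) : ZMod (2 * n)) = 0 := ZMod.natCast_self _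
    push_cast at h2 ⊢
    rw [h2, add_zero]
  refine if_congr ?_ (by rw [shift_apply, h1]) rfl
  rw [Finset.subset_iff, Finset.subset_iff, Finset.forall_mem_map]
  refine forall₂_congr fun s hs => h s ?_
  have := fst_of_mem_around hs
  omega

/-- The linear form of a region only depends on the part of the region to the right of the frontier,
up to translations by the period. -/
theorem sweepForm_shift {R R' : Finset (ℤ × ℤ)} {x : ℤ} (hstrip : ∀ s ∈ R, 0 ≤ s.2 ∧ s.2 < m)
    (hstrip' : ∀ s ∈ R', 0 ≤ s.2 ∧ s.2 < m)
    (h : ∀ s : ℤ × ℤ, x - 1 ≤ s.1 → (shift (2 * n) s ∈ R' ↔ s ∈ R)) :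
    sweepForm r m (dominoWeight (interiorWeight n m R')) R' (x + 2 * n) 0 =
      sweepForm r m (dominoWeight (interiorWeight n m R)) R x 0 := by
  rw [sweepForm, sweepForm]
  refine congrArg _ (funext fun S => ?_)
  have h1 : remaining R' (x + 2 * n) 0 S.1 = (remaining R x 0 S.1).map (shift (2 * n)) := by
    ext v
    obtain ⟨u, rfl⟩ : ∃ u, shift (2 * n) u = v := ⟨(v.1 - 2 * n, v.2), by simp [shift_apply]⟩
    rw [Finset.mem_map', mem_remaining_zero hstrip, mem_remaining_zero hstrip']
    have h2 : Odd (x + 2 * n + u.2) ↔ Odd (x + u.2) := by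
      rw [Int.odd_iff, Int.odd_iff]; omega
    by_cases hu : x ≤ u.1
    · rw [h u (by omega), shift_apply]
      simp only [add_lt_add_iff_right, add_left_inj, h2]
    · simp only [shift_apply, add_lt_add_iff_right, add_left_inj]
      constructor
      · rintro ⟨-, h3⟩; omega
      · rintro ⟨-, h3⟩; omega
  rw [h1]
  refine dimer_map_shift _ fun s hs s' hs' => ?_
  rw [dominoWeight_map_shift (even_two_mul _)]
  refine dominoWeight_congr fun u hu v hv => interiorWeight_shift h ?_
  have h3 : x ≤ u.1 := by
    rcases Finset.mem_insert.1 hu with rfl | hu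
    · have := (mem_remaining_zero hstrip).1 hs
      omega
    · rw [Finset.mem_singleton.1 hu]
      have := (mem_remaining_zero hstrip).1 hs'
      omega
  have := fst_of_mem_corners hv
  omega

/-- Cayley-Hamilton as a recurrence for a sequence of linear forms. -/
theorem sum_coeff_charpoly_mul_eq_zero {F M : Type*} [Field F] [AddCommGroup M] [Module F M]
    [Module.Finite F M] [Module.Free F M] {φ : ℕ → M →ₗ[F] F} {T : M →ₗ[F] M}
    (hφ : ∀ t, φ (t + 1) = φ t ∘ₗ T) (u : M) (t : ℕ) :
    ∑ k ∈ Finset.range (T.charpoly.natDegree + 1), T.charpoly.coeff k * φ (t + k) u = 0 := by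
  have h1 : ∀ k u, φ (t + k) u = φ t ((T ^ k) u) := by
    intro k
    induction k with
    | zero => exact fun u => rfl
    | succ k ih =>
      intro u
      rw [← add_assoc, hφ, LinearMap.comp_apply, ih, pow_succ, Module.End.mul_apply]
  have h2 := congrArg (fun f : M →ₗ[F] M => φ t (f u)) T.aeval_self_charpoly
  simp only [aeval_eq_sum_range, LinearMap.sum_apply, LinearMap.smul_apply, map_sum, map_smul,
    LinearMap.zero_apply, map_zero, smul_eq_mul] at h2
  simpa only [h1] using h2

/-- A sequence of regions with the same left end, each of which is obtained from the previous one by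
inserting `2n` full columns, and in which all rows but those of `r` particles end with a white
square, satisfies the recurrence given by the characteristic polynomial of the `r`-th exterior power of
the transfer matrix of a period. -/
theorem sum_coeff_mul_dimer_eq_zero [NeZero n] {R : ℕ → Finset (ℤ × ℤ)} {x : ℤ}
    (hx : (x : ZMod (2 * n)) = 1)
    (hfull : ∀ t, IsFullOn m (R t) (x - 1) (x + (2 * n : ℕ) + 1))
    (hleft : ∀ (t : ℕ) (s : ℤ × ℤ), s.1 ≤ x + 1 → (s ∈ R t ↔ s ∈ R 0))
    (hright : ∀ (t : ℕ) (s : ℤ × ℤ), x - 1 ≤ s.1 → (shift (2 * n) s ∈ R (t + 1) ↔ s ∈ R t))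
    (hcard : ∀ (t : ℕ) (S : Finset (Fin m)),
      dimer (dominoWeight (interiorWeight n m (R t))) (remaining (R t) x 0 S) ≠ 0 → S.card = r)
    {T : ⋀[K n m]^r (Fin m → K n m) →ₗ[K n m] ⋀[K n m]^r (Fin m → K n m)}
    (hT : T = exteriorPower.map r (colProd n m 1 (2 * n)).transpose.toLin') (t : ℕ) :
    ∑ k ∈ Finset.range (T.charpoly.natDegree + 1), T.charpoly.coeff k *
      dimer (dominoWeight (interiorWeight n m (R (t + k)))) (R (t + k)) = 0 := by
  let c : ℕ → Finset (ℤ × ℤ) → K n m := fun t => dominoWeight (interiorWeight n m (R t))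
  let φ : ℕ → ⋀[K n m]^r (Fin m → K n m) →ₗ[K n m] K n m := fun t => sweepForm r m (c t) (R t) x 0
  have hφ : ∀ t, φ (t + 1) = φ t ∘ₗ T := by
    intro t
    have h1 := sweepForm_columns (n := n) (r := r) (2 * n) (hfull (t + 1))
    rw [hx, ← hT] at h1
    refine h1.trans ?_
    push_cast
    rw [sweepForm_shift (hfull t).1 (hfull (t + 1)).1 (hright t)]
  have hc : ∀ t s s', s.1 < x → s' ∈ nbrs s → c t {s, s'} = c 0 {s, s'} := by
    intro t s s' hs hs'
    refine dominoWeight_congr fun u hu v hv => interiorWeight_congr (hleft t) ?_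
    simp only [nbrs, Finset.mem_insert, Finset.mem_singleton] at hs' hu
    have hu' : u.1 ≤ x := by
      rcases hu with rfl | rfl
      · exact hs.le
      · rcases hs' with rfl | rfl | rfl | rfl <;> simp only <;> omega
    have := fst_of_mem_corners hv
    omega
  -- for this set of rows nothing of column `x` is covered: particles in all white squares
  let S₀ : Finset (Fin m) := Finset.univ.filter fun i => ¬Odd (x + (i : ℕ))
  have hsplit : ∀ t, (R 0).filter (fun s => s.1 < x) ∪ remaining (R t) x 0 S₀ = R t := by
    intro t
    ext s
    rw [Finset.mem_union, Finset.mem_filter, mem_remaining_zero (hfull t).1]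
    constructor
    · rintro (⟨h1, h2⟩ | ⟨h1, -⟩)
      · exact (hleft t s (by omega)).2 h1
      · exact h1
    · intro h1
      rcases lt_trichotomy s.1 x with h2 | h2 | h2
      · exact Or.inl ⟨(hleft t s (by omega)).1 h1, h2⟩
      · refine Or.inr ⟨h1, Or.inr ⟨h2, ?_⟩⟩
        have hb := (hfull t).1 s h1
        obtain ⟨k, hk⟩ := Int.eq_ofNat_of_zero_le hb.1
        have hkm : k < m := by omega
        have h3 := mem_rows (S := S₀) ⟨k, hkm⟩
        simp only at h3
        rw [hk, h3]
        simp [S₀]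
      · exact Or.inr ⟨h1, Or.inl h2⟩
  have hspan := dimer_union_remaining_mem_span c (c 0) R (x := x) (fun t => (hfull t).1)
    (fun t b hb => (hfull t).2 _ _ (by omega) (by omega) (by omega) (by omega)) hc
    ((R 0).filter fun s => s.1 < x) (fun s hs => (Finset.mem_filter.1 hs).2) S₀
  simp only [hsplit] at hspan
  have hrange : Submodule.span (K n m) (Set.range fun (S : Finset (Fin m)) t =>
      dimer (c t) (remaining (R t) x 0 S)) ≤ LinearMap.range (LinearMap.pi φ) := by
    rw [Submodule.span_le]
    rintro _ ⟨S, rfl⟩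
    by_cases hS : S.card = r
    · exact ⟨wedge _ ⟨S, hS⟩, funext fun t => sweepForm_wedge (c t) ⟨S, hS⟩⟩
    · have h1 : (fun t => dimer (c t) (remaining (R t) x 0 S)) = 0 :=
        funext fun t => by_contra fun h => hS (hcard t S h)
      exact ⟨0, (map_zero _).trans h1.symm⟩
  obtain ⟨u, hu⟩ := hrange hspan
  have hu' : ∀ t, dimer (c t) (R t) = φ t u := fun t => (congrFun hu t).symm
  have := sum_coeff_charpoly_mul_eq_zero hφ u t
  simpa only [← hu'] using this

end Recurrence

/-! ### Truncated Aztec diamonds -/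

section Region

theorem abs_add_abs_le_iff {a b c : ℤ} :
    |a| + |b| ≤ c ↔ a + b ≤ c ∧ a - b ≤ c ∧ -a + b ≤ c ∧ -a - b ≤ c := by
  rcases abs_cases a with ⟨h, _⟩ | ⟨h, _⟩ <;> rcases abs_cases b with ⟨h', _⟩ | ⟨h', _⟩ <;>
    rw [h, h'] <;> omega

/-- The columns of the squares in the row of height `b` form the interval which is obtained from
`[i - ℓ - 1, i + ℓ]` by removing `max (b - j + 1) (j - b)` numbers at both ends. -/
theorem mem_region {m : ℕ} {i j ℓ : ℤ} {s : ℤ × ℤ} : s ∈ region m i j ℓ ↔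
    (0 ≤ s.2 ∧ s.2 < m) ∧ i - ℓ + (s.2 - j) ≤ s.1 ∧ i - ℓ - 1 + (j - s.2) ≤ s.1 ∧
      s.1 ≤ i + ℓ - (s.2 - j + 1) ∧ s.1 ≤ i + ℓ - (j - s.2) := by
  simp only [region, Finset.mem_filter, Finset.mem_product, Finset.mem_Icc, Finset.mem_Ico,
    abs_add_abs_le_iff]
  omega

/-- The recurrence, with the number `r` of rows that end with a black square on the right; the
rightmost square of row `b` is in column `i + ℓ₀ + 2 * ℓ * n - max (b - j + 1) (j - b)`. -/
theorem exists_recurrence {m n : ℕ} [NeZero n] (i : ℤ) {j : ℕ} (hj : j ≤ m) (ℓ₀ : ℤ) {r : ℕ}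
    (hr : (Finset.univ.filter fun b : Fin m =>
      Odd (i + ℓ₀ - max ((b : ℕ) - j + 1) (j - (b : ℕ)) + (b : ℕ))).card = r) :
    ∃ P : (K n m)[X], P.map (algebraMap (K n m) (AlgebraicClosure (K n m))) = plethE (Q n m) r ∧
      SatisfiesRecurrence (fun ℓ : ℕ => Z n m (i + ℓ * n) j (ℓ * n + ℓ₀)) P := by
  refine ⟨(exteriorPower.map r (colProd n m 1 (2 * n)).transpose.toLin').charpoly, ?_,
    LinearMap.charpoly_monic _, ?_⟩
  · rw [map_charpoly_exteriorPower_map, Matrix.charpoly_toLin', Matrix.charpoly_transpose,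
      ← Q_eq_charpoly]
  have hn : 1 ≤ (n : ℤ) := by exact_mod_cast NeZero.one_le
  -- from column `x - 1` on, the left boundary of the region is not met
  obtain ⟨x, hx, hx1⟩ : ∃ x : ℤ, (x : ZMod (2 * n)) = 1 ∧ i - ℓ₀ + m + 1 ≤ x := by
    refine ⟨(2 * n : ℕ) * (|i - ℓ₀| + m) + 1, ?_, ?_⟩
    · rw [Int.cast_add, Int.cast_mul, Int.cast_natCast, ZMod.natCast_self, zero_mul, zero_add,
        Int.cast_one]
    · have h1 := le_abs_self (i - ℓ₀)
      have h2 := abs_nonneg (i - ℓ₀)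
      push_cast
      nlinarith
  -- for `ℓ₁ ≤ ℓ`, the columns from `x - 1` to `x + 2 * n + 1` are full
  obtain ⟨ℓ₁, hℓ₁⟩ : ∃ ℓ₁ : ℕ, x + 2 * n + 1 + m ≤ i + ℓ₀ + 2 * (ℓ₁ * n) := by
    refine ⟨(x + 2 * n + 1 + m - i - ℓ₀).toNat, ?_⟩
    have h1 := Int.self_le_toNat (x + 2 * n + 1 + m - i - ℓ₀)
    nlinarith
  let R : ℕ → Finset (ℤ × ℤ) := fun t =>
    region m (i + ((ℓ₁ + t : ℕ) : ℤ) * n) j (((ℓ₁ + t : ℕ) : ℤ) * n + ℓ₀)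
  have hR : ∀ t s, s ∈ R t ↔ (0 ≤ s.2 ∧ s.2 < m) ∧ i - ℓ₀ + (s.2 - j) ≤ s.1 ∧
      i - ℓ₀ - 1 + (j - s.2) ≤ s.1 ∧
      s.1 ≤ i + ℓ₀ + 2 * (ℓ₁ * n) + 2 * (t * n) - (s.2 - j + 1) ∧
      s.1 ≤ i + ℓ₀ + 2 * (ℓ₁ * n) + 2 * (t * n) - (j - s.2) := by
    intro t s
    simp only [R, mem_region]
    rw [Nat.cast_add, add_mul]
    omega
  have htn : ∀ t : ℕ, 0 ≤ (t : ℤ) * n := fun t => by positivity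
  have hfull : ∀ t, IsFullOn m (R t) (x - 1) (x + (2 * n : ℕ) + 1) := by
    intro t
    have h1 := htn t
    refine ⟨fun s hs => ((hR t s).1 hs).1, fun a b ha ha' hb hb' => (hR t _).2 ?_⟩
    simp only
    push_cast at ha'
    omega
  have key := sum_coeff_mul_dimer_eq_zero (r := r) (R := R) hx hfull (fun t s hs => ?_)
    (fun t s hs => ?_) (fun t S hS => ?_) rfl
  · rw [Filter.eventually_atTop]
    refine ⟨ℓ₁, fun ℓ hℓ => ?_⟩
    obtain ⟨t, rfl⟩ := Nat.exists_eq_add_of_le hℓ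
    simpa only [Z_eq_dimer, R, add_assoc] using key t
  · have h1 := htn t
    rw [hR, hR, Nat.cast_zero, zero_mul]
    omega
  · have h1 := htn t
    rw [hR, hR, shift_apply, Nat.cast_succ, add_mul, one_mul]
    simp only
    omega
  · have h1 := htn t
    rw [card_eq_of_dimer_remaining_ne_zero (e := fun b : Fin m =>
      i + ℓ₀ + 2 * (ℓ₁ * n) + 2 * (t * n) - max ((b : ℕ) - j + 1) (j - (b : ℕ))) (hfull t).1 ?_ ?_ hS,
      ← hr]
    · congr 1
      refine Finset.filter_congr fun b _ => ?_
      rw [Int.odd_iff, Int.odd_iff]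
      omega
    · intro b
      have := b.2
      omega
    · intro a b ha
      have := b.2
      rw [hR]
      simp only
      omega

end Region

end AztecStrip

theorem theorem5p9 (m n : ℕ) [NeZero n] (hm : 2 ≤ m) (i : ℤ) (j : ℕ) (hj : j ≤ m) (ℓ₀ : ℤ) :
    (Even (i + j - ℓ₀) →
      ∃ P : Polynomial (AztecStrip.K n m),
        P.map (algebraMap (AztecStrip.K n m) (AlgebraicClosure (AztecStrip.K n m))) =
          AztecStrip.plethE (AztecStrip.Q n m) (m - j) ∧
        AztecStrip.SatisfiesRecurrence
          (fun ℓ : ℕ => AztecStrip.Z n m (i + ℓ * n) j (ℓ * n + ℓ₀)) P) ∧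
    (Odd (i + j - ℓ₀) →
      ∃ P : Polynomial (AztecStrip.K n m),
        P.map (algebraMap (AztecStrip.K n m) (AlgebraicClosure (AztecStrip.K n m))) =
          AztecStrip.plethE (AztecStrip.Q n m) j ∧
        AztecStrip.SatisfiesRecurrence
          (fun ℓ : ℕ => AztecStrip.Z n m (i + ℓ * n) j (ℓ * n + ℓ₀)) P) := by
  have hlt : (Finset.univ.filter fun b : Fin m => (b : ℕ) < j).card = j := by
    rw [Fin.card_filter_val_lt, min_eq_right hj]
  constructor
  · intro h
    refine AztecStrip.exists_recurrence i hj ℓ₀ ?_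
    have h1 := Finset.card_filter_add_card_filter_not (s := (Finset.univ : Finset (Fin m)))
      fun b : Fin m => (b : ℕ) < j
    rw [hlt, Finset.card_univ, Fintype.card_fin] at h1
    rw [← Nat.eq_sub_of_add_eq' h1]
    congr 1
    refine Finset.filter_congr fun b _ => ?_
    rw [Int.even_iff] at h
    rw [Int.odd_iff]
    omega
  · intro h
    refine AztecStrip.exists_recurrence i hj ℓ₀ (Eq.trans ?_ hlt)
    congr 1
    refine Finset.filter_congr fun b _ => ?_
    rw [Int.odd_iff] at h ⊢
    omega
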